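/- By a curve over a field $k$ we mean an integral separated $k$-scheme of finite type and of dimension $1$; its (geometric) genus is the genus of its function field $F$ over $k$, i.e. $\max_D\,(\deg D-\dim_k L(D)+1)$ over all divisors $D$ of $F/k$ (formal $\mathbb{Z}$-linear combinations of places of $F/k$). A point of a scheme is nonsingular if its local ring is regular. Let $p$ be a prime, and let $J\subseteq\mathbb{Z}[x_0,\dots,x_n]$ be a homogeneous ideal. For a commutative ring $A$ write $X_A=\operatorname{Proj}\bigl(A[x_0,\dots,x_n]/J\,A[x_0,\dots,x_n]\bigr)\subseteq\mathbb{P}^n_A$ for the closed subscheme cut out by $J$. Let $X=X_{\mathbb{Q}}$ and let $\tilde X=X_{\mathbb{F}_p}$ be the reduction of $X$ mod $p$. Let $Y$ be a geometrically irreducible curve over $\mathbb{Q}$, and suppose that $X$ is a nonsingular projective model of $Y$, that is, $X$ is a curve over $\mathbb{Q}$, all points of $X$ are nonsingular, and $X$ is birational to $Y$ over $\mathbb{Q}$. Suppose that $\tilde X$ is an integral (i.e. reduced and irreducible) curve over $\mathbb{F}_p$, that $\tilde X$ has a nonsingular $\mathbb{F}_p$-point, and that the geometric genus of $\tilde X$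 equals the genus of $Y$. Then $X$ has good reduction at $p$: the model $X_{\mathbb{Z}_{(p)}}$ is smooth over $\mathbb{Z}_{(p)}$, and its special fibre $\tilde X$ is smooth over $\mathbb{F}_p$. -/

import Mathlib

open CategoryTheory AlgebraicGeometry

noncomputable section

/-! ### The graded ring `S / I` for a homogeneous ideal `I` -/

namespace GradedQuotient

open DirectSum

variable {R S : Type*} [CommRing R] [CommRing S] [Algebra R S]
  (𝒜 : ℕ → Submodule R S) [GradedAlgebra 𝒜] (I : HomogeneousIdeal 𝒜)

/-- The degree `d` part of `S / I`: the image of the degree `d` part of `S`. -/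
def grading (d : ℕ) : Submodule R (S ⧸ I.toIdeal) :=
  (𝒜 d).map (Ideal.Quotient.mkₐ R I.toIdeal).toLinearMap

instance gradedMonoid : SetLike.GradedMonoid (grading 𝒜 I) where
  one_mem := ⟨1, SetLike.GradedOne.one_mem, map_one (Ideal.Quotient.mkₐ R I.toIdeal)⟩
  mul_mem := by
    rintro i j _ _ ⟨a, ha, rfl⟩ ⟨b, hb, rfl⟩
    exact ⟨a * b, SetLike.GradedMul.mul_mem ha hb, map_mul (Ideal.Quotient.mkₐ R I.toIdeal) a b⟩

/-- The quotient map in degree `d`. -/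
def mkDeg (d : ℕ) : 𝒜 d →+ grading 𝒜 I d where
  toFun a := ⟨Ideal.Quotient.mk I.toIdeal a, ⟨a, a.2, rfl⟩⟩
  map_zero' := Subtype.ext (by simp)
  map_add' a b := Subtype.ext (by simp)

/-- Decompose an element of `S` and reduce its components modulo `I`. -/
def preDecompose : S →+ ⨁ d, grading 𝒜 I d :=
  (DirectSum.map (mkDeg 𝒜 I)).comp (decomposeAddEquiv 𝒜).toAddMonoidHom

theorem preDecompose_of_mem {d : ℕ} {a : S} (ha : a ∈ 𝒜 d) :
    preDecompose 𝒜 I a =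
      DirectSum.of (fun d => grading 𝒜 I d) d ⟨Ideal.Quotient.mk I.toIdeal a, ⟨a, ha, rfl⟩⟩ := by
  simp only [preDecompose, AddMonoidHom.comp_apply, AddEquiv.coe_toAddMonoidHom,
    decomposeAddEquiv_apply]
  rw [decompose_of_mem 𝒜 ha, DirectSum.map_of]
  rfl

theorem preDecompose_eq_zero {a : S} (ha : a ∈ I.toIdeal) : preDecompose 𝒜 I a = 0 := by
  ext d
  simp only [preDecompose, AddMonoidHom.comp_apply, AddEquiv.coe_toAddMonoidHom,
    decomposeAddEquiv_apply, DirectSum.map_apply, DirectSum.zero_apply, ZeroMemClass.coe_zero]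
  exact Ideal.Quotient.eq_zero_iff_mem.mpr (I.isHomogeneous d ha)

/-- The decomposition of an element of `S / I` into its homogeneous components. -/
def quotDecompose : S ⧸ I.toIdeal →+ ⨁ d, grading 𝒜 I d :=
  QuotientAddGroup.lift I.toIdeal.toAddSubgroup (preDecompose 𝒜 I)
    (fun _ ha => AddMonoidHom.mem_ker.mpr (preDecompose_eq_zero 𝒜 I ha))

theorem quotDecompose_mk (a : S) :
    quotDecompose 𝒜 I (Ideal.Quotient.mk I.toIdeal a) = preDecompose 𝒜 I a := rfl

theorem coe_quotDecompose (x : S ⧸ I.toIdeal) :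
    DirectSum.coeAddMonoidHom (grading 𝒜 I) (quotDecompose 𝒜 I x) = x := by
  obtain ⟨a, rfl⟩ := Ideal.Quotient.mk_surjective x
  rw [quotDecompose_mk]
  induction a using DirectSum.Decomposition.inductionOn 𝒜 with
  | zero => simp
  | homogeneous m => rw [preDecompose_of_mem 𝒜 I m.2, DirectSum.coeAddMonoidHom_of]
  | add a b ha hb => rw [map_add, map_add, map_add, ha, hb]

theorem quotDecompose_of (d : ℕ) (x : grading 𝒜 I d) :
    quotDecompose 𝒜 I x = DirectSum.of (fun d => grading 𝒜 I d) d x := by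
  obtain ⟨_, a, ha, rfl⟩ := x
  exact preDecompose_of_mem 𝒜 I ha

instance gradedAlgebra : GradedAlgebra (grading 𝒜 I) :=
  { gradedMonoid 𝒜 I with
    toDecomposition := Decomposition.ofAddHom _ (quotDecompose 𝒜 I)
      (AddMonoidHom.ext (coe_quotDecompose 𝒜 I))
      (DirectSum.addHom_ext fun d x => by
        rw [AddMonoidHom.comp_apply, DirectSum.coeAddMonoidHom_of, quotDecompose_of]
        rfl) }

end GradedQuotient

/-! ### The subscheme of projective space cut out by integral homogeneous equations -/

namespace ProjectiveModel

open MvPolynomial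

instance mvPolynomialGradedAlgebra (σ R : Type*) [CommRing R] :
    GradedAlgebra (homogeneousSubmodule σ R) :=
  MvPolynomial.gradedAlgebra

/-- A homogeneous ideal of `ℤ[x₀, …, xₙ]`. -/
abbrev Equations (n : ℕ) := HomogeneousIdeal (homogeneousSubmodule (Fin (n + 1)) ℤ)

/-- The graded ring homomorphism `ℤ[x₀, …, xₙ] → A[x₀, …, xₙ]`. -/
def coeffHom (n : ℕ) (A : Type) [CommRing A] :
    homogeneousSubmodule (Fin (n + 1)) ℤ →+*ᵍ homogeneousSubmodule (Fin (n + 1)) A where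
  toRingHom := MvPolynomial.map (Int.castRingHom A)
  map_mem h := IsHomogeneous.map h _

variable {n : ℕ} (J : Equations n) (A : Type) [CommRing A]

/-- The homogeneous ideal `J · A[x₀, …, xₙ]`. -/
abbrev idealOver : HomogeneousIdeal (homogeneousSubmodule (Fin (n + 1)) A) :=
  J.map (coeffHom n A)

/-- The grading of `A[x₀, …, xₙ] / J · A[x₀, …, xₙ]` by degree. -/
abbrev coordGrading : ℕ → Submodule A (MvPolynomial (Fin (n + 1)) A ⧸ (idealOver J A).toIdeal) :=
  GradedQuotient.grading (homogeneousSubmodule (Fin (n + 1)) A) (idealOver J A)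

/-- The closed subscheme `V(J)_A` of `ℙⁿ_A` cut out by `J`, that is
`Proj (A[x₀, …, xₙ] / J · A[x₀, …, xₙ])`. -/
abbrev scheme : Scheme.{0} := Proj (coordGrading J A)

/-- The structure morphism `V(J)_A ⟶ Spec A`. -/
def toSpec : scheme J A ⟶ Spec (.of A) :=
  Proj.toSpecZero (coordGrading J A) ≫
    Spec.map (CommRingCat.ofHom (algebraMap A (coordGrading J A 0)))

end ProjectiveModel

/-! ### Genus of a function field of one variable -/

namespace FunctionField1

variable (k F : Type*) [Field k] [Field F] [Algebra k F]

/-- A place of `F / k`: a discrete valuation ring of `F` (with fraction field `F`)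
that contains `k`. -/
structure Place where
  ring : ValuationSubring F
  dvr : IsDiscreteValuationRing ring
  algebraMap_mem : ∀ c : k, algebraMap k F c ∈ ring

attribute [instance] Place.dvr

variable {k F}

/-- The normalised valuation of a place, written multiplicatively: `v_P f = exp (-ord_P f)`. -/
def Place.valuation (P : Place k F) : Valuation F (WithZero (Multiplicative ℤ)) :=
  (IsDiscreteValuationRing.maximalIdeal P.ring).valuation F

/-- The embedding of `k` into the residue field of a place. -/
def Place.residueHom (P : Place k F) : k →+* IsLocalRing.ResidueField P.ring :=
  (IsLocalRing.residue P.ring).comp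
    ((algebraMap k F).codRestrict P.ring.toSubring P.algebraMap_mem)

/-- The degree of a place: the degree of its residue field over `k`. -/
def Place.degree (P : Place k F) : ℕ :=
  letI : Algebra k (IsLocalRing.ResidueField P.ring) := P.residueHom.toAlgebra
  Module.finrank k (IsLocalRing.ResidueField P.ring)

variable (k F) in
/-- Divisors: finite formal `ℤ`-linear combinations of places. -/
abbrev Divisor := Place k F →₀ ℤ

/-- The degree of a divisor. -/
def Divisor.degree (D : Divisor k F) : ℤ := D.sum fun P m => m * P.degree

theorem Place.valuation_algebraMap_le_one (P : Place k F) (c : k) :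
    P.valuation (algebraMap k F c) ≤ 1 :=
  (IsDiscreteValuationRing.maximalIdeal P.ring).valuation_le_one (K := F)
    ⟨algebraMap k F c, P.algebraMap_mem c⟩

/-- The Riemann–Roch space `L(D) = {f ∈ F : ord_P f ≥ -D(P) for all P}`. -/
def riemannRochSpace (D : Divisor k F) : Submodule k F where
  carrier := {f | ∀ P : Place k F, P.valuation f ≤ WithZero.exp (D P)}
  zero_mem' P := by simp
  add_mem' hf hg P := (P.valuation.map_add _ _).trans (max_le (hf P) (hg P))
  smul_mem' c f hf P := by
    rw [Algebra.smul_def, map_mul]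
    exact (mul_le_of_le_one_left' (P.valuation_algebraMap_le_one c)).trans (hf P)

variable (k F) in
/-- The genus of `F / k`: the maximum over all divisors `D` of `deg D - dim_k L(D) + 1`. -/
def genus : ℤ :=
  sSup (Set.range fun D : Divisor k F => D.degree - Module.finrank k (riemannRochSpace D) + 1)

end FunctionField1

/-! ### Curves over a field -/

namespace AlgebraicCurve

/-- A curve over a field `k`: an integral separated `k`-scheme of finite type and dimension `1`. -/
structure IsCurve {k : Type} [Field k] {X : Scheme.{0}} (f : X ⟶ Spec (.of k)) : Prop where
  isIntegral : IsIntegral X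
  isSeparated : IsSeparated f
  locallyOfFiniteType : LocallyOfFiniteType f
  quasiCompact : QuasiCompact f
  dim_eq_one : topologicalKrullDim X = 1

/-- A point of a scheme is nonsingular if its local ring is regular. -/
def IsNonsingularAt (X : Scheme.{0}) (x : X) : Prop :=
  IsRegularLocalRing (X.presheaf.stalk x)

/-- The ring homomorphism from `k` to the function field of an irreducible `k`-scheme. -/
def constantsHom {k : Type} [Field k] {X : Scheme.{0}} [IrreducibleSpace X]
    (f : X ⟶ Spec (.of k)) : k →+* X.functionField :=
  ((Scheme.ΓSpecIso (.of k)).inv ≫ f.appTop ≫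
    X.presheaf.germ ⊤ (genericPoint X) trivial).hom

/-- The (geometric) genus of a curve over `k`: the genus of its function field over `k`
(equivalently, of the regular projective curve with this function field). -/
def geometricGenus {k : Type} [Field k] {X : Scheme.{0}} (f : X ⟶ Spec (.of k))
    (hf : IsCurve f) : ℤ :=
  haveI := hf.isIntegral
  letI : Algebra k X.functionField := (constantsHom f).toAlgebra
  FunctionField1.genus k X.functionField

end AlgebraicCurve

/-! ### Reduction modulo `p` -/

namespace ProjectiveModel

theorem isPrime_span (p : ℕ) [hp : Fact p.Prime] : (Ideal.span {(p : ℤ)}).IsPrime :=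
  (Ideal.span_singleton_prime (Int.natCast_ne_zero.mpr hp.out.ne_zero)).mpr
    (Nat.prime_iff_prime_int.mp hp.out)

/-- The local ring `ℤ_(p)`. -/
abbrev ZAt (p : ℕ) [Fact p.Prime] : Type :=
  haveI := isPrime_span p
  Localization.AtPrime (Ideal.span {(p : ℤ)})

/-- The projective model given by `J` has good reduction at `p`: the closed subscheme of
projective space over `ℤ_(p)` cut out by `J` is smooth over `ℤ_(p)`. -/
def HasGoodReduction {n : ℕ} (J : Equations n) (p : ℕ) [Fact p.Prime] : Prop :=
  Smooth (toSpec J (ZAt p))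

end ProjectiveModel

end

/-! Write A for ℤ_(p), with fraction field K = ℚ, residue field κ = 𝔽_p and uniformizer π = p. The
genus enters through Hilbert functions.

Let y be the generic point, in homogeneous coordinates, of an integral projective curve over a field
k with function field F. The values at y of forms of degree d make up a space `formValues k y d`,
the degree d part of the coordinate ring modulo saturation. It lies in L(dD), where D is the divisor
of a hyperplane section, and Riemann's theorem (`eventually_finrank_nsmul`) gives dim L(dD) = δd + 1
- g for large d, with δ = deg D > 0. So the Hilbert function is eventually at most δd + 1 - g, and
it equals this for all large d exactly when the affine charts are integrally closed
(`exists_hilbert`). Degrees and dimensions are all taken over k, so k need not be the full constant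
field of F.

Now compare the fibres (`chartsIntegrallyClosed_reduction`). A-forms of degree d have values in both
function fields. For large d the Hilbert function of the special fibre is that of the generic fibre
plus the dimension of the reduction of the torsion, that is, of the forms vanishing on the generic
fibre (`finrank_generic_add`). If one such form t did not vanish on the special fibre, then, that
fibre being integral, multiplication by t would put a whole copy of its coordinate ring into the
torsion. The increments of the special Hilbert function over deg t steps would then grow at least
like δ₁d, although they are bounded. Hence torsion reduces to zero, and since it is killed by a
fixed power of π, it vanishes in large degrees: the model is flat. The two Hilbert functions now
agree in large degrees, so the degrees δ agree; as the genera agree too and X is normal, the special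
fibre attains its upper bound and is normal.

A normal curve over a perfect field has Dedekind charts, and these are smooth because a local
uniformizer makes them étale over the affine line (`Algebra.Smooth.of_isDedekindDomain`). Both
fibres are therefore smooth, and a flat finitely presented algebra with smooth fibres is smooth
(`smooth_chartRing`).

The function field theory is built from valuation rings. Its engine is
`linearIndependent_adjoin_of_mod`: independence over k modulo x gives independence over k(x), so [F
: k(x)] bounds residue degrees, numbers of zeros and quotients O/xO. The scheme side only has to
produce the generic points (`exists_isGenericPoint`) and to identify the charts of Proj with
explicit quotients (`chartRingEquivAway`). -/

/-! ### Valuation rings of function fields of one variable -/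

namespace FunctionField1

open IntermediateField
open scoped IntermediateField.algebraAdjoinAdjoin

/-- `F / k` is a function field of one variable: it has transcendental elements, and is finite
over the rational function field generated by any of them. -/
class IsFunctionField (k F : Type*) [Field k] [Field F] [Algebra k F] : Prop where
  exists_transcendental : ∃ x : F, Transcendental k x
  finite_adjoin : ∀ x : F, Transcendental k x → FiniteDimensional k⟮x⟯ F

variable {k F : Type*} [Field k] [Field F] [Algebra k F]

/-- Descent on powers of x. After clearing denominators a relation has coefficients in k[x]. Its
constant terms form a k-relation modulo xO, hence vanish, and the relation can be divided by x. -/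
theorem linearIndependent_adjoin_of_mod (O : Subalgebra k F) {x : F} (hxO : x ∈ O)
    (hx : Transcendental k x) {ι : Type*} [Fintype ι] {v : ι → F} (hv : ∀ i, v i ∈ O)
    (h : ∀ c : ι → k, (∃ o ∈ O, ∑ i, c i • v i = x * o) → c = 0) :
    LinearIndependent k⟮x⟯ v := by
  have hx0 : x ≠ 0 := by
    rintro rfl
    exact hx isAlgebraic_zero
  have key : ∀ N : ℕ, ∀ p : ι → Polynomial k, (∀ i, (p i).degree < N) →
      ∑ i, Polynomial.aeval x (p i) * v i = 0 → p = 0 := by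
    intro N
    induction N with
    | zero =>
      intro p hp _
      funext i
      simpa using hp i
    | succ N ih =>
      intro p hp hs
      have hdec : ∀ i, Polynomial.aeval x (p i) =
          x * Polynomial.aeval x (p i).divX + algebraMap k F ((p i).coeff 0) := by
        intro i
        have := congrArg (Polynomial.aeval x) (Polynomial.divX_mul_X_add (p i))
        rw [map_add, map_mul, Polynomial.aeval_X, Polynomial.aeval_C] at this
        linear_combination -this
      have hsum : ∑ i, (p i).coeff 0 • v i =
          x * (-∑ i, Polynomial.aeval x (p i).divX * v i) := by
        have : ∑ i, Polynomial.aeval x (p i) * v i =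
            x * (∑ i, Polynomial.aeval x (p i).divX * v i) + ∑ i, (p i).coeff 0 • v i := by
          rw [Finset.mul_sum, ← Finset.sum_add_distrib]
          refine Finset.sum_congr rfl fun i _ => ?_
          rw [hdec i, Algebra.smul_def]
          ring
        rw [hs] at this
        linear_combination -this
      have h0 : (fun i => (p i).coeff 0) = 0 := by
        refine h _ ⟨_, ?_, hsum⟩
        refine O.neg_mem (O.sum_mem fun i _ => O.mul_mem ?_ (hv i))
        exact Algebra.adjoin_le (by simpa using hxO : {x} ⊆ (O : Set F))
          (Polynomial.aeval_mem_adjoin_singleton k x)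
      have h1 : ∑ i, Polynomial.aeval x (p i).divX * v i = 0 := by
        have : x * (-∑ i, Polynomial.aeval x (p i).divX * v i) = 0 := by
          rw [← hsum]
          refine Finset.sum_eq_zero fun i _ => ?_
          rw [congrFun h0 i]; simp
        simpa [hx0] using this
      have h2 := ih (fun i => (p i).divX) (fun i => ?_) h1
      · funext i
        rw [← Polynomial.divX_mul_X_add (p i), congrFun h2 i, congrFun h0 i]
        simp
      · by_cases hpi : p i = 0
        · simp [hpi]
        · have := Polynomial.degree_divX_lt hpi
          have h3 := hp i
          rw [Polynomial.degree_lt_iff_coeff_zero] at h3 ⊢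
          intro m hm
          rw [Polynomial.coeff_divX]
          exact h3 _ (by omega)
  -- Independence over k(x) may be tested over k[x], where coefficients are polynomials in x.
  rw [← LinearIndependent.iff_fractionRing (Algebra.adjoin k {x}) k⟮x⟯, Fintype.linearIndependent_iff]
  intro g hg
  have hex : ∀ i, ∃ p : Polynomial k, Polynomial.aeval x p = (g i : F) := fun i =>
    (Algebra.adjoin_singleton_eq_range_aeval k x).le (g i).2
  choose p hp using hex
  have hp0 := key (Finset.univ.sup (fun i => (p i).natDegree) + 1) p (fun i => by
      refine lt_of_le_of_lt Polynomial.degree_le_natDegree ?_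
      exact_mod_cast Nat.lt_succ_of_le
        (Finset.le_sup (f := fun i => (p i).natDegree) (Finset.mem_univ i))) (by
      simpa [hp, Algebra.smul_def, Subalgebra.smul_def] using hg)
  intro i
  apply Subtype.ext
  rw [← hp i, hp0]
  simp

theorem card_le_finrank_adjoin [IsFunctionField k F] (O : Subalgebra k F) {x : F} (hxO : x ∈ O)
    (hx : Transcendental k x) {ι : Type*} [Fintype ι] {v : ι → F} (hv : ∀ i, v i ∈ O)
    (h : ∀ c : ι → k, (∃ o ∈ O, ∑ i, c i • v i = x * o) → c = 0) :
    Fintype.card ι ≤ Module.finrank k⟮x⟯ F :=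
  haveI := IsFunctionField.finite_adjoin x hx
  (linearIndependent_adjoin_of_mod O hxO hx hv h).fintype_card_le_finrank

/-- For a subalgebra `O` of `F` and a transcendental `x ∈ O`, the dimension of `O / x O` is at
most `[F : k(x)]`. -/
theorem rank_quotient_span_le [IsFunctionField k F] (O : Subalgebra k F) (x : O)
    (hx : Transcendental k (x : F)) :
    Module.rank k (O ⧸ Ideal.span {x}) ≤ Module.finrank k⟮(x : F)⟯ F := by
  refine rank_le fun s hs => ?_
  have hlift : ∀ i : s, ∃ o : O, Ideal.Quotient.mk (Ideal.span {x}) o = i.1 := fun i =>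
    Ideal.Quotient.mk_surjective _
  choose v hv using hlift
  rw [← Fintype.card_coe]
  refine card_le_finrank_adjoin O x.2 hx (v := fun i => (v i : F)) (fun i => (v i).2) ?_
  rintro c ⟨o, ho, heq⟩
  rw [Fintype.linearIndependent_iff] at hs
  funext i
  refine hs c ?_ i
  have h1 : ∑ i, c i • v i = x * ⟨o, ho⟩ := Subtype.ext (by push_cast; exact heq)
  have h2 : (Ideal.Quotient.mkₐ k (Ideal.span {x})) (∑ i, c i • v i) = 0 := by
    rw [h1, Ideal.Quotient.mkₐ_eq_mk, Ideal.Quotient.eq_zero_iff_mem]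
    exact Ideal.mul_mem_right _ _ (Ideal.mem_span_singleton_self x)
  rw [← h2, map_sum]
  refine Finset.sum_congr rfl fun i _ => ?_
  rw [← hv i, map_smul]
  rfl

theorem finite_quotient_span [IsFunctionField k F] (O : Subalgebra k F) (x : O)
    (hx : Transcendental k (x : F)) : Module.Finite k (O ⧸ Ideal.span {x}) :=
  haveI : Module.Free k (O ⧸ Ideal.span {x}) := Module.Free.of_divisionRing k _
  Module.rank_lt_aleph0_iff.mp
    ((rank_quotient_span_le O x hx).trans_lt (Cardinal.natCast_lt_aleph0 ))

theorem inv_mem_of_isAlgebraic (O : Subalgebra k F) {x : F} (hxO : x ∈ O)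
    (hx : IsAlgebraic k x) : x⁻¹ ∈ O := by
  have h1 : x⁻¹ ∈ Algebra.adjoin k {x} := by
    have := IntermediateField.adjoin_simple_toSubalgebra_of_isAlgebraic hx
    rw [← this]
    exact (IntermediateField.adjoin k {x}).inv_mem (IntermediateField.mem_adjoin_simple_self k x)
  exact Algebra.adjoin_le (by simpa using hxO : {x} ⊆ (O : Set F)) h1

/-- A nonzero element x of an ideal is either algebraic, hence a unit, or transcendental. In the
second case O/xO is finite-dimensional over k, so the ideal is finitely generated modulo x. -/
theorem isNoetherianRing_subalgebra [IsFunctionField k F] (O : Subalgebra k F) :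
    IsNoetherianRing O := by
  refine ⟨fun I => ?_⟩
  by_cases hI : I = ⊥
  · rw [hI]; exact Submodule.fg_bot
  obtain ⟨x, hxI, hx0⟩ := Submodule.exists_mem_ne_zero_of_ne_bot hI
  by_cases hx : IsAlgebraic k (x : F)
  · have hu : IsUnit x := by
      refine IsUnit.of_mul_eq_one ⟨(x : F)⁻¹, inv_mem_of_isAlgebraic O x.2 hx⟩ (Subtype.ext ?_)
      exact mul_inv_cancel₀ (by simpa using hx0)
    rw [Ideal.eq_top_of_isUnit_mem I hxI hu]
    exact Module.Finite.fg_top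
  have hfin := finite_quotient_span O x hx
  have hN : IsNoetherian O (O ⧸ Ideal.span {x}) :=
    isNoetherian_of_tower k (inferInstance : IsNoetherian k (O ⧸ Ideal.span {x}))
  refine Submodule.fg_of_fg_map_of_fg_inf_ker (Ideal.span {x}).mkQ (hN.noetherian _) ?_
  have : I ⊓ LinearMap.ker (Ideal.span {x}).mkQ = Ideal.span {x} := by
    rw [Submodule.ker_mkQ]
    exact inf_eq_right.mpr ((Ideal.span_singleton_le_iff_mem _).mpr hxI)
  rw [this]
  exact ⟨{x}, by simp⟩

/-- A valuation ring containing `k`, as a subalgebra. -/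
def toSubalgebra (V : ValuationSubring F) (hV : ∀ c : k, algebraMap k F c ∈ V) :
    Subalgebra k F :=
  { V.toSubring with algebraMap_mem' := hV }

/-- A noetherian valuation ring that is not a field is discrete. Hence the valuation rings supplied
by Zorn-type existence theorems are places as soon as they are proper. -/
theorem isDiscreteValuationRing_of_ne_top [IsFunctionField k F] (V : ValuationSubring F)
    (hV : ∀ c : k, algebraMap k F c ∈ V) (htop : V ≠ ⊤) : IsDiscreteValuationRing V := by
  have : IsNoetherianRing V := isNoetherianRing_subalgebra (toSubalgebra V hV)
  have hf : ¬ IsField V := by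
    intro h
    apply htop
    rw [eq_top_iff]
    intro x _
    by_cases hx0 : x = 0
    · rw [hx0]; exact V.zero_mem
    rcases V.mem_or_inv_mem x with hx | hx
    · exact hx
    · obtain ⟨y, hy⟩ := h.mul_inv_cancel (a := ⟨x⁻¹, hx⟩) (fun h0 => hx0 (by
        simpa using congrArg (Subtype.val : V → F) h0))
      have : x = y := by
        have := congrArg (Subtype.val : V → F) hy
        simp only [MulMemClass.coe_mul, OneMemClass.coe_one] at this
        field_simp at this
        exact this.symm
      rw [this]; exact y.2
  have h2 := (IsDiscreteValuationRing.TFAE V hf).out 0 1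
  exact h2.mpr inferInstance

namespace Place

theorem ext_ring {P Q : Place k F} (h : P.ring = Q.ring) : P = Q := by
  cases P; cases Q; cases h; rfl

theorem valuation_le_one_iff (P : Place k F) (f : F) : P.valuation f ≤ 1 ↔ f ∈ P.ring := by
  constructor
  · intro h
    obtain ⟨n, d, hnd⟩ := IsDedekindDomain.HeightOneSpectrum.exists_primeCompl_mul_eq_of_integer
      (K := F) (IsDiscreteValuationRing.maximalIdeal P.ring) f h
    have hu : IsUnit (d : P.ring) := by
      have := d.2
      simpa [Ideal.primeCompl, IsDiscreteValuationRing.maximalIdeal] using this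
    obtain ⟨u, hu⟩ := hu
    have h1 : ((u : P.ring) : F) * ((u⁻¹ : P.ringˣ) : P.ring) = 1 := by
      exact_mod_cast congrArg (Subtype.val : P.ring → F) u.mul_inv
    have h2 : f = ((n * (u⁻¹ : P.ringˣ) : P.ring) : F) := by
      have h3 : f * (d : P.ring) = (n : F) := hnd
      rw [← hu] at h3
      push_cast
      rw [← h3, mul_assoc, h1, mul_one]
    rw [h2]
    exact (n * (u⁻¹ : P.ringˣ) : P.ring).2
  · intro h
    exact (IsDiscreteValuationRing.maximalIdeal P.ring).valuation_le_one (K := F) ⟨f, h⟩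

theorem exists_uniformizer (P : Place k F) : ∃ π : F, P.valuation π = WithZero.exp (-1) :=
  (IsDiscreteValuationRing.maximalIdeal P.ring).valuation_exists_uniformizer F

end Place
end FunctionField1

/-! ### Places: existence, weak approximation, residue fields -/

namespace FunctionField1

open IntermediateField WithZero

variable {k F : Type*} [Field k] [Field F] [Algebra k F]

namespace Place

/-- The ring of a place, as a subalgebra. -/
def subalgebra (P : Place k F) : Subalgebra k F := toSubalgebra P.ring P.algebraMap_mem

theorem mem_subalgebra {P : Place k F} {f : F} : f ∈ P.subalgebra ↔ P.valuation f ≤ 1 :=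
  (P.valuation_le_one_iff f).symm

theorem valuation_ne_zero (P : Place k F) {f : F} (hf : f ≠ 0) : P.valuation f ≠ 0 :=
  (Valuation.ne_zero_iff _).mpr hf

theorem valuation_lt_one_iff (P : Place k F) (f : F) :
    P.valuation f < 1 ↔ f ∈ P.ring.nonunits := by
  rw [ValuationSubring.mem_nonunits_iff_or, ← P.valuation_le_one_iff, map_inv₀]
  by_cases hf : f = 0
  · simp [hf]
  · have h0 : 0 < P.valuation f := zero_lt_iff.mpr (P.valuation_ne_zero hf)
    simp [hf, inv_le_one₀ h0]

theorem ring_ne_top (P : Place k F) : P.ring ≠ ⊤ := by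
  intro h
  obtain ⟨π, hπ⟩ := P.exists_uniformizer
  have h1 : P.valuation π⁻¹ ≤ 1 := (P.valuation_le_one_iff _).mpr (by rw [h]; trivial)
  rw [map_inv₀, hπ, ← exp_neg, ← exp_zero, exp_le_exp] at h1
  omega

/-- A discrete valuation ring has rank one, so no ring lies strictly between it and the field. -/
theorem eq_of_ring_le {P Q : Place k F} (h : P.ring ≤ Q.ring) : P = Q :=
  ext_ring (ValuationSubring.eq_of_le_of_ne_top _ h Q.ring_ne_top)

theorem valuation_eq_one_of_isAlgebraic (P : Place k F) {f : F} (hf0 : f ≠ 0)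
    (hf : IsAlgebraic k f) : P.valuation f = 1 := by
  have key : ∀ g : F, g ≠ 0 → IsAlgebraic k g → P.valuation g ≤ 1 := by
    intro g hg0 hg
    rcases P.ring.mem_or_inv_mem g with h | h
    · exact (P.valuation_le_one_iff g).mpr h
    · have := inv_mem_of_isAlgebraic P.subalgebra (x := g⁻¹) h (hg.inv)
      rw [inv_inv] at this
      exact mem_subalgebra.mp this
  refine le_antisymm (key f hf0 hf) ?_
  have := key f⁻¹ (inv_ne_zero hf0) hf.inv
  rwa [map_inv₀, inv_le_one₀ (zero_lt_iff.mpr (P.valuation_ne_zero hf0))] at this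

theorem transcendental_of_valuation_ne_one (P : Place k F) {f : F} (hf0 : f ≠ 0)
    (h : P.valuation f ≠ 1) : Transcendental k f :=
  fun hf => h (P.valuation_eq_one_of_isAlgebraic hf0 hf)

/-- The place defined by a valuation ring. -/
def ofValuationSubring [IsFunctionField k F] (V : ValuationSubring F)
    (hV : ∀ c : k, algebraMap k F c ∈ V) (htop : V ≠ ⊤) : Place k F where
  ring := V
  dvr := isDiscreteValuationRing_of_ne_top V hV htop
  algebraMap_mem := hV

/-- Since f is not a unit of k[f], the ideal (f) is proper and some valuation ring containing k[f]
has f as a nonunit. -/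
theorem exists_valuation_lt_one [IsFunctionField k F] {f : F} (hf : Transcendental k f) :
    ∃ P : Place k F, P.valuation f < 1 := by
  have hf0 : f ≠ 0 := by
    rintro rfl
    exact hf isAlgebraic_zero
  let A : Subring F := (Algebra.adjoin k {f}).toSubring
  let f' : A := ⟨f, Algebra.self_mem_adjoin_singleton k f⟩
  have hI : Ideal.span {f'} ≠ ⊤ := by
    rw [Ne, Ideal.span_singleton_eq_top]
    intro hu
    obtain ⟨g, hg⟩ := hu.exists_right_inv
    obtain ⟨p, hp⟩ := (Algebra.adjoin_singleton_eq_range_aeval k f).le g.2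
    -- An inverse p(f) of f would make f a root of X p - 1, which is nonzero since its value at 0 is
    -- -1.
    refine hf ⟨Polynomial.X * p - 1, ?_, ?_⟩
    · intro h0
      have := congrArg (Polynomial.eval 0) h0
      simp at this
    · have := congrArg (Subtype.val : A → F) hg
      simp only [Subring.coe_mul, Subring.coe_one] at this
      rw [map_sub, map_mul, Polynomial.aeval_X, map_one]
      erw [hp]
      rw [← this]
      exact sub_self _
  obtain ⟨V, hAV, hV⟩ := Ideal.image_subset_nonunits_valuationSubring (Ideal.span {f'}) hI
  have hfV : f ∈ V.nonunits := hV ⟨f', Ideal.mem_span_singleton_self f', rfl⟩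
  have hk : ∀ c : k, algebraMap k F c ∈ V := fun c =>
    hAV ((Algebra.adjoin k {f}).algebraMap_mem c)
  have htop : V ≠ ⊤ := by
    rintro rfl
    rw [ValuationSubring.mem_nonunits_iff_or] at hfV
    rcases hfV with h | h
    · exact hf0 h
    · exact h trivial
  exact ⟨ofValuationSubring V hk htop, (valuation_lt_one_iff _ _).mpr hfV⟩

variable (k F) in
theorem nonempty [IsFunctionField k F] : Nonempty (Place k F) := by
  obtain ⟨x, hx⟩ := IsFunctionField.exists_transcendental (k := k) (F := F)
  exact ⟨(exists_valuation_lt_one hx).choose⟩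

theorem lt_one_iff_le_exp {v : WithZero (Multiplicative ℤ)} : v < 1 ↔ v ≤ exp (-1) := by
  by_cases hv : v = 0
  · simp [hv]
  · rw [← exp_zero, ← log_lt_iff_lt_exp hv, ← log_le_iff_le_exp hv]
    omega

theorem lt_exp_iff_le_exp {v : WithZero (Multiplicative ℤ)} {m : ℤ} :
    v < exp m ↔ v ≤ exp (m - 1) := by
  by_cases hv : v = 0
  · simp [hv]
  · rw [← log_lt_iff_lt_exp hv, ← log_le_iff_le_exp hv]
    omega

theorem pow_le_exp_neg {v : WithZero (Multiplicative ℤ)} (hv : v < 1) (m : ℕ) :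
    v ^ m ≤ exp (-(m : ℤ)) := by
  have h := pow_le_pow_left₀ zero_le (lt_one_iff_le_exp.mp hv) m
  rwa [← exp_nsmul, nsmul_eq_mul, mul_neg, mul_one] at h

theorem eventually_pow_mul_lt_one {v w : WithZero (Multiplicative ℤ)} (hv : v < 1) :
    ∀ᶠ m : ℕ in Filter.atTop, v ^ m * w < 1 := by
  by_cases hw : w = 0
  · simp [hw]
  filter_upwards [Filter.eventually_gt_atTop (log w).toNat] with m hm
  have h1 : v ^ m * w ≤ exp (-(m : ℤ)) * exp (log w) := by
    rw [exp_log hw]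
    exact mul_le_mul_left (pow_le_exp_neg hv m) w
  refine h1.trans_lt ?_
  rw [← exp_add, ← exp_zero, exp_lt_exp]
  omega

theorem valuation_one_add_of_one_lt (P : Place k F) {a : F} (ha : 1 < P.valuation a) :
    P.valuation (1 + a) = P.valuation a :=
  P.valuation.map_add_eq_of_lt_right (by simpa using ha)

theorem valuation_one_add_of_lt_one (P : Place k F) {a : F} (ha : P.valuation a < 1) :
    P.valuation (1 + a) = 1 := by
  rw [P.valuation.map_add_eq_of_lt_left (by simpa using ha), map_one]

/-- Neither ring contains the other, so there are f with a pole only at Q and g with a pole only at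
P among the two; take g / f. -/
theorem exists_one_lt_and_lt_one {P Q : Place k F} (h : P ≠ Q) :
    ∃ a : F, 1 < P.valuation a ∧ Q.valuation a < 1 := by
  have h1 : ∃ f, P.valuation f ≤ 1 ∧ 1 < Q.valuation f := by
    by_contra! hc
    exact h (eq_of_ring_le fun f hf =>
      (Q.valuation_le_one_iff f).mp (hc f ((P.valuation_le_one_iff f).mpr hf)))
  have h2 : ∃ f, Q.valuation f ≤ 1 ∧ 1 < P.valuation f := by
    by_contra! hc
    exact h.symm (eq_of_ring_le fun f hf =>
      (P.valuation_le_one_iff f).mp (hc f ((Q.valuation_le_one_iff f).mpr hf)))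
  obtain ⟨f, hf1, hf2⟩ := h1
  obtain ⟨g, hg1, hg2⟩ := h2
  have hf0 : f ≠ 0 := by rintro rfl; simp at hf2
  have hg0 : g ≠ 0 := by rintro rfl; simp at hg2
  refine ⟨g / f, ?_, ?_⟩
  · rw [map_div₀, one_lt_div₀ (zero_lt_iff.mpr (P.valuation_ne_zero hf0))]
    exact hf1.trans_lt hg2
  · rw [map_div₀, div_lt_one₀ (zero_lt_iff.mpr (Q.valuation_ne_zero hf0))]
    exact hg1.trans_lt hf2

theorem exists_one_lt_and_forall_lt_one (P : Place k F) (s : Finset (Place k F)) (hP : P ∉ s) :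
    ∃ a : F, 1 < P.valuation a ∧ ∀ Q ∈ s, Q.valuation a < 1 := by
  classical
  induction s using Finset.induction_on with
  | empty =>
    obtain ⟨π, hπ⟩ := P.exists_uniformizer
    refine ⟨π⁻¹, ?_, by simp⟩
    rw [map_inv₀, hπ, ← exp_neg, ← exp_zero, exp_lt_exp]
    omega
  | insert R s hR ih =>
    obtain ⟨a, ha1, ha2⟩ := ih (fun h => hP (Finset.mem_insert_of_mem h))
    obtain ⟨b, hb1, hb2⟩ := exists_one_lt_and_lt_one (P := P) (Q := R)
      (fun h => hP (h ▸ Finset.mem_insert_self R s))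
    have hev : ∀ᶠ m : ℕ in Filter.atTop, ∀ Q ∈ s, Q.valuation a ^ m * Q.valuation b < 1 :=
      (Filter.eventually_all_finset s).mpr fun Q hQ => eventually_pow_mul_lt_one (ha2 Q hQ)
    obtain ⟨m, hm0, hm⟩ := (Filter.eventually_gt_atTop 0).and hev |>.exists
    rcases lt_trichotomy (R.valuation a) 1 with h | h | h
    · refine ⟨a, ha1, fun Q hQ => ?_⟩
      rcases Finset.mem_insert.mp hQ with rfl | hQ
      · exact h
      · exact ha2 Q hQ
    · refine ⟨a ^ m * b, ?_, fun Q hQ => ?_⟩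
      · rw [map_mul, map_pow]
        exact one_lt_mul_of_le_of_lt (one_le_pow₀ ha1.le) hb1
      · rw [map_mul, map_pow]
        rcases Finset.mem_insert.mp hQ with rfl | hQ
        · rw [h, one_pow, one_mul]
          exact hb2
        · exact hm Q hQ
    -- The factor a ^ m / (1 + a ^ m) has valuation 1 wherever a has a pole, so at P and R only b
    -- counts; where a is small it behaves like a ^ m.
    · have hbig : ∀ S : Place k F, 1 < S.valuation a →
          S.valuation (a ^ m / (1 + a ^ m) * b) = S.valuation b := by
        intro S hS
        have h1 : 1 < S.valuation (a ^ m) := by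
          rw [map_pow]
          exact one_lt_pow₀ hS hm0.ne'
        rw [map_mul, map_div₀, S.valuation_one_add_of_one_lt h1,
          div_self (by rintro h0; rw [h0] at h1; simp at h1), one_mul]
      refine ⟨a ^ m / (1 + a ^ m) * b, ?_, fun Q hQ => ?_⟩
      · rwa [hbig P ha1]
      · rcases Finset.mem_insert.mp hQ with rfl | hQ
        · rwa [hbig _ h]
        · have h1 : Q.valuation (a ^ m) < 1 := by
            rw [map_pow]
            exact pow_lt_one₀ zero_le (ha2 Q hQ) hm0.ne'
          rw [map_mul, map_div₀, Q.valuation_one_add_of_lt_one h1, div_one, map_pow]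
          exact hm Q hQ

/-- Weak approximation of `(1, 0, …, 0)`. -/
theorem exists_approx_one (P : Place k F) (s : Finset (Place k F)) (hP : P ∉ s) (m : ℕ) :
    ∃ c : F, P.valuation (c - 1) ≤ exp (-(m : ℤ)) ∧ ∀ Q ∈ s, Q.valuation c ≤ exp (-(m : ℤ)) := by
  obtain ⟨a, ha1, ha2⟩ := exists_one_lt_and_forall_lt_one P s hP
  set n := m + 1
  have h1 : 1 < P.valuation (a ^ n) := by
    rw [map_pow]
    exact one_lt_pow₀ ha1 (by omega)
  have hle : exp (-(n : ℤ)) ≤ exp (-(m : ℤ)) := exp_le_exp.mpr (by omega)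
  -- This quotient is close to 1 where a has a pole and close to 0 where a has a zero.
  refine ⟨a ^ n / (1 + a ^ n), ?_, fun Q hQ => ?_⟩
  · have h2 : (1 + a ^ n) ≠ 0 := by
      rw [← Valuation.ne_zero_iff P.valuation, P.valuation_one_add_of_one_lt h1]
      rintro h0; rw [h0] at h1; simp at h1
    have h3 : a ^ n / (1 + a ^ n) - 1 = -(1 + a ^ n)⁻¹ := by
      field_simp
      ring
    rw [h3, Valuation.map_neg, map_inv₀, P.valuation_one_add_of_one_lt h1, map_pow, ← inv_pow]
    refine le_trans (pow_le_exp_neg ?_ n) hle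
    exact inv_lt_one_of_one_lt₀ ha1
  · have h2 : Q.valuation (a ^ n) < 1 := by
      rw [map_pow]
      exact pow_lt_one₀ zero_le (ha2 Q hQ) (by omega)
    rw [map_div₀, Q.valuation_one_add_of_lt_one h2, div_one, map_pow]
    exact (pow_le_exp_neg (ha2 Q hQ) n).trans hle

noncomputable instance residueAlgebra (P : Place k F) : Algebra k (IsLocalRing.ResidueField P.ring) :=
  P.residueHom.toAlgebra

theorem degree_eq (P : Place k F) :
    P.degree = Module.finrank k (IsLocalRing.ResidueField P.ring) := rfl

/-- A chosen uniformizer. -/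
noncomputable def uniformizer (P : Place k F) : F := P.exists_uniformizer.choose

theorem valuation_uniformizer (P : Place k F) : P.valuation P.uniformizer = exp (-1) :=
  P.exists_uniformizer.choose_spec

theorem uniformizer_ne_zero (P : Place k F) : P.uniformizer ≠ 0 := by
  rw [← Valuation.ne_zero_iff P.valuation, valuation_uniformizer]
  exact exp_ne_zero

theorem valuation_uniformizer_zpow (P : Place k F) (m : ℤ) :
    P.valuation (P.uniformizer ^ m) = exp (-m) := by
  rw [map_zpow₀, valuation_uniformizer, ← exp_zsmul]
  simp

/-- The functions with a pole of order at most `m` at `P`. -/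
def ball (P : Place k F) (m : ℤ) : Submodule k F where
  carrier := {f | P.valuation f ≤ exp m}
  zero_mem' := by simp
  add_mem' hf hg := (P.valuation.map_add _ _).trans (max_le hf hg)
  smul_mem' c f hf := by
    rw [Set.mem_ofPred_eq, Algebra.smul_def, map_mul]
    exact (mul_le_of_le_one_left' (P.valuation_algebraMap_le_one c)).trans hf

theorem mem_ball {P : Place k F} {m : ℤ} {f : F} : f ∈ P.ball m ↔ P.valuation f ≤ exp m := Iff.rfl

theorem mul_zpow_mem {P : Place k F} {m : ℤ} {f : F} (hf : f ∈ P.ball m) :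
    f * P.uniformizer ^ m ∈ P.ring := by
  rw [← valuation_le_one_iff, map_mul, valuation_uniformizer_zpow, ← exp_zero,
    show (0 : ℤ) = m + -m by ring, exp_add]
  exact mul_le_mul_left hf _

/-- The leading coefficient at `P` of a function with a pole of order at most `m`. -/
noncomputable def leadingCoeff (P : Place k F) (m : ℤ) :
    P.ball m →ₗ[k] IsLocalRing.ResidueField P.ring where
  toFun f := IsLocalRing.residue P.ring ⟨f * P.uniformizer ^ m, mul_zpow_mem f.2⟩
  map_add' f g := by
    rw [← map_add]
    congr 1
    exact Subtype.ext (add_mul _ _ _)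
  map_smul' c f := by
    rw [RingHom.id_apply, Algebra.smul_def]
    change _ = IsLocalRing.residue P.ring _ * _
    rw [← map_mul]
    congr 1
    apply Subtype.ext
    change (c • (f : F)) * _ = algebraMap k F c * (f * _)
    rw [Algebra.smul_def, mul_assoc]

theorem leadingCoeff_eq_zero_iff {P : Place k F} {m : ℤ} (f : P.ball m) :
    P.leadingCoeff m f = 0 ↔ P.valuation (f : F) ≤ exp (m - 1) := by
  change IsLocalRing.residue P.ring _ = 0 ↔ _
  rw [IsLocalRing.residue_eq_zero_iff, ← ValuationSubring.coe_mem_nonunits_iff,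
    ← valuation_lt_one_iff]
  change P.valuation ((f : F) * _) < 1 ↔ _
  rw [map_mul, valuation_uniformizer_zpow, lt_one_iff_le_exp, exp_neg, ← div_eq_mul_inv,
    div_le_iff₀ (by exact exp_pos), ← exp_add]
  rw [show -1 + m = m - 1 by ring]

theorem leadingCoeff_surjective (P : Place k F) (m : ℤ) :
    Function.Surjective (P.leadingCoeff m) := by
  intro z
  obtain ⟨u, rfl⟩ := IsLocalRing.residue_surjective z
  have hu : P.valuation (u : F) ≤ 1 := (P.valuation_le_one_iff _).mpr u.2
  have hmem : (u : F) * P.uniformizer ^ (-m) ∈ P.ball m := by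
    rw [mem_ball, map_mul, valuation_uniformizer_zpow, neg_neg]
    exact mul_le_of_le_one_left' hu
  refine ⟨⟨_, hmem⟩, ?_⟩
  change IsLocalRing.residue P.ring _ = _
  congr 1
  apply Subtype.ext
  change (u : F) * P.uniformizer ^ (-m) * P.uniformizer ^ m = u
  rw [mul_assoc, ← zpow_add₀ P.uniformizer_ne_zero]
  simp

/-- Lifts of residue classes independent over k are independent modulo the uniformizer, so their
number is at most the degree of F over the field the uniformizer generates. -/
theorem finite_residueField [IsFunctionField k F] (P : Place k F) :
    Module.Finite k (IsLocalRing.ResidueField P.ring) := by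
  have hx : Transcendental k P.uniformizer := P.transcendental_of_valuation_ne_one
    P.uniformizer_ne_zero (by rw [valuation_uniformizer, ← exp_zero, Ne, exp_inj]; omega)
  refine Module.rank_lt_aleph0_iff.mp (lt_of_le_of_lt (b := (Module.finrank k⟮P.uniformizer⟯ F :
    Cardinal)) (rank_le fun s hs => ?_) Cardinal.natCast_lt_aleph0)
  choose v hv using fun i : s => P.leadingCoeff_surjective 0 i.1
  rw [← Fintype.card_coe]
  refine card_le_finrank_adjoin P.subalgebra (mem_subalgebra.mpr ?_) hx (v := fun i => (v i : F))
    (fun i => mem_subalgebra.mpr (v i).2) ?_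
  · rw [valuation_uniformizer, ← exp_zero, exp_le_exp]
    omega
  · rintro c ⟨o, ho, heq⟩
    rw [Fintype.linearIndependent_iff] at hs
    funext i
    refine hs c ?_ i
    have h2 : P.leadingCoeff 0 (∑ i, c i • v i) = 0 := by
      rw [leadingCoeff_eq_zero_iff]
      have : ((∑ i, c i • v i : P.ball 0) : F) = P.uniformizer * o := by
        push_cast
        exact heq
      rw [this, map_mul, valuation_uniformizer]
      exact mul_le_of_le_one_right' (mem_subalgebra.mp ho)
    rw [← h2, map_sum]
    refine Finset.sum_congr rfl fun i _ => ?_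
    rw [map_smul, hv]

theorem degree_pos [IsFunctionField k F] (P : Place k F) : 0 < P.degree := by
  have := P.finite_residueField
  rw [degree_eq]
  exact Module.finrank_pos

end Place

end FunctionField1

/-! ### Zeros, poles, and dimensions of Riemann–Roch spaces -/

namespace FunctionField1

open IntermediateField WithZero

variable {k F : Type*} [Field k] [Field F] [Algebra k F]

namespace Place

theorem eventually_mul_exp_neg_le {w : WithZero (Multiplicative ℤ)} (n : ℤ) :
    ∀ᶠ m : ℕ in Filter.atTop, w * exp (-(m : ℤ)) ≤ exp n := by
  by_cases hw : w = 0
  · simp [hw]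
  filter_upwards [Filter.eventually_gt_atTop (log w - n).toNat] with m hm
  rw [← exp_log hw, ← exp_add, exp_le_exp]
  omega

/-- A function with prescribed leading coefficient at `P` and small at finitely many other
places. -/
theorem exists_leadingCoeff_eq (P : Place k F) (s : Finset (Place k F)) (hP : P ∉ s)
    (D : Place k F → ℤ) (m : ℤ) (z : IsLocalRing.ResidueField P.ring) :
    ∃ f : P.ball m, P.leadingCoeff m f = z ∧ ∀ Q ∈ s, Q.valuation (f : F) ≤ exp (D Q) := by
  obtain ⟨u, rfl⟩ := P.leadingCoeff_surjective m z
  have hev : ∀ᶠ N : ℕ in Filter.atTop, ∀ Q ∈ s,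
      Q.valuation (u : F) * exp (-(N : ℤ)) ≤ exp (D Q) :=
    (Filter.eventually_all_finset s).mpr fun Q _ => eventually_mul_exp_neg_le _
  obtain ⟨N, hN1, hN⟩ := ((Filter.eventually_ge_atTop 1).and hev).exists
  obtain ⟨c, hc1, hc2⟩ := P.exists_approx_one s hP N
  have hd : P.valuation ((u : F) * (c - 1)) ≤ exp (m - 1) := by
    rw [map_mul, show m - 1 = m + -1 by ring, exp_add]
    exact mul_le_mul' u.2 (hc1.trans (exp_le_exp.mpr (by omega)))
  have hd' : (u : F) * (c - 1) ∈ P.ball m := hd.trans (exp_le_exp.mpr (by omega))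
  refine ⟨u + ⟨(u : F) * (c - 1), hd'⟩, ?_, fun Q hQ => ?_⟩
  · rw [map_add, (leadingCoeff_eq_zero_iff (⟨_, hd'⟩ : P.ball m)).mpr hd, add_zero]
  · have : ((u + ⟨(u : F) * (c - 1), hd'⟩ : P.ball m) : F) = u * c := by
      push_cast
      ring
    rw [this, map_mul]
    exact (mul_le_mul' le_rfl (hc2 Q hQ)).trans (hN Q hQ)

/-- This is the lower bound ∑ e_P deg P for the dimension of the semilocal ring of s modulo
functions vanishing to order e_P at each P, with explicit representatives. Each unit of e_P
contributes deg P functions whose leading coefficients at P form a basis of the residue field and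
which are small at the other places. -/
theorem exists_independent_family [IsFunctionField k F] (s : Finset (Place k F)) (n : ℕ) :
    ∀ e : Place k F → ℕ, ∑ P ∈ s, e P = n →
      ∃ (ι : Type) (_ : Fintype ι) (v : ι → F), Fintype.card ι = ∑ P ∈ s, e P * P.degree ∧
        (∀ i, ∀ P ∈ s, P.valuation (v i) ≤ 1) ∧
        ∀ c : ι → k, (∀ P ∈ s, P.valuation (∑ i, c i • v i) ≤ exp (-(e P : ℤ))) → c = 0 := by
  classical
  induction n with
  | zero =>
    intro e he
    rw [Finset.sum_eq_zero_iff] at he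
    refine ⟨Fin 0, inferInstance, Fin.elim0, ?_, fun i => i.elim0, fun c _ => funext fun i =>
      i.elim0⟩
    rw [Fintype.card_fin, eq_comm]
    exact Finset.sum_eq_zero fun P hP => by rw [he P hP, zero_mul]
  | succ n ih =>
    intro e he
    obtain ⟨P, hPs, hP⟩ : ∃ P ∈ s, e P ≠ 0 := by
      by_contra! hc
      rw [Finset.sum_eq_zero hc] at he
      omega
    let e' : Place k F → ℕ := Function.update e P (e P - 1)
    have he'P : e' P = e P - 1 := Function.update_self ..
    have he'Q : ∀ Q ∈ s.erase P, e' Q = e Q := fun Q hQ =>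
      Function.update_of_ne (Finset.ne_of_mem_erase hQ) _ _
    have hle : ∀ Q, e' Q ≤ e Q := by
      intro Q
      by_cases h : Q = P
      · rw [h, he'P]; omega
      · exact (Function.update_of_ne h _ _).le
    have hsum' : ∑ Q ∈ s, e' Q = n := by
      have h1 := Finset.add_sum_erase s e hPs
      have h2 := Finset.add_sum_erase s e' hPs
      have h3 : ∑ x ∈ s.erase P, e' x = ∑ x ∈ s.erase P, e x := Finset.sum_congr rfl he'Q
      rw [h3, he'P] at h2
      omega
    obtain ⟨ι, _, v, hcard, hv, hind⟩ := ih e' hsum'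
    have := P.finite_residueField
    let b := Module.finBasis k (IsLocalRing.ResidueField P.ring)
    choose f hf1 hf2 using fun j => P.exists_leadingCoeff_eq (s.erase P) (Finset.notMem_erase P s)
      (fun Q => -(e' Q : ℤ)) (-(e' P : ℤ)) (b j)
    have hf3 : ∀ j, ∀ Q ∈ s, Q.valuation (f j : F) ≤ exp (-(e' Q : ℤ)) := by
      intro j Q hQ
      by_cases h : Q = P
      · subst h; exact (f j).2
      · exact hf2 j Q (Finset.mem_erase.mpr ⟨h, hQ⟩)
    refine ⟨ι ⊕ Fin (Module.finrank k (IsLocalRing.ResidueField P.ring)), inferInstance, Sum.elim v (fun j => (f j : F)), ?_, ?_, ?_⟩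
    · rw [Fintype.card_sum, hcard, Fintype.card_fin, ← P.degree_eq, ← Finset.add_sum_erase s _ hPs,
        ← Finset.add_sum_erase s _ hPs, he'P,
        Finset.sum_congr rfl fun Q hQ => by rw [he'Q Q hQ]]
      obtain ⟨m, hm⟩ := Nat.exists_eq_succ_of_ne_zero hP
      rw [hm]
      simp only [Nat.succ_eq_add_one, Nat.add_sub_cancel]
      ring
    · rintro (i | j) Q hQ
      · exact hv i Q hQ
      · refine (hf3 j Q hQ).trans ?_
        rw [← exp_zero, exp_le_exp]
        omega
    · intro c hc
      have hsplit : ∑ i, c i • Sum.elim v (fun j => (f j : F)) i =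
          ∑ i, c (Sum.inl i) • v i + ∑ j, c (Sum.inr j) • (f j : F) := by
        rw [Fintype.sum_sum_type]
        rfl
      have hsecond : ∀ Q ∈ s, Q.valuation (∑ j, c (Sum.inr j) • (f j : F)) ≤
          exp (-(e' Q : ℤ)) := fun Q hQ =>
        (Q.ball (-(e' Q : ℤ))).sum_mem fun j _ => Submodule.smul_mem _ _ (hf3 j Q hQ)
      -- The new functions vanish to order e' everywhere on s, so modulo order e' only the old
      -- family is seen. Once its coefficients are gone, leading coefficients at P kill the new
      -- ones.
      have h1 : (fun i => c (Sum.inl i)) = 0 := by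
        refine hind _ fun Q hQ => ?_
        have h2 : ∑ i, c (Sum.inl i) • v i = ∑ i, c i • Sum.elim v (fun j => (f j : F)) i -
            ∑ j, c (Sum.inr j) • (f j : F) := by
          rw [hsplit]; ring
        rw [h2]
        exact (Q.ball (-(e' Q : ℤ))).sub_mem
          ((hc Q hQ).trans (exp_le_exp.mpr (by have := hle Q; omega))) (hsecond Q hQ)
      have h2 : P.leadingCoeff (-(e' P : ℤ)) (∑ j, c (Sum.inr j) • f j) = 0 := by
        rw [leadingCoeff_eq_zero_iff]
        have h3 := hc P hPs
        rw [hsplit, Finset.sum_eq_zero (fun i _ => by rw [congrFun h1 i]; simp), zero_add] at h3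
        push_cast
        refine h3.trans (exp_le_exp.mpr ?_)
        rw [he'P]
        omega
      rw [map_sum] at h2
      have h3 : (fun j => c (Sum.inr j)) = 0 := by
        funext j
        refine Fintype.linearIndependent_iff.mp b.linearIndependent (fun j => c (Sum.inr j)) ?_ j
        rw [← h2]
        refine Finset.sum_congr rfl fun j _ => ?_
        rw [map_smul, hf1]
      funext i
      rcases i with i | j
      · exact congrFun h1 i
      · exact congrFun h3 j

/-- Work in the intersection of the valuation rings of s: a multiple of x there vanishes to order
e_P at each P, so the independent family stays independent modulo x. -/
theorem sum_zeros_le [IsFunctionField k F] {x : F} (hx : Transcendental k x)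
    (s : Finset (Place k F)) (e : Place k F → ℕ)
    (h : ∀ P ∈ s, P.valuation x ≤ exp (-(e P : ℤ))) :
    ∑ P ∈ s, e P * P.degree ≤ Module.finrank k⟮x⟯ F := by
  obtain ⟨ι, _, v, hcard, hv, hind⟩ := exists_independent_family s _ e rfl
  rw [← hcard]
  have hmem : ∀ f : F, f ∈ (⨅ P ∈ s, P.subalgebra) ↔ ∀ P ∈ s, P.valuation f ≤ 1 := by
    intro f
    simp only [Algebra.mem_iInf, mem_subalgebra]
  refine card_le_finrank_adjoin (⨅ P ∈ s, P.subalgebra) ((hmem _).mpr fun P hP => ?_) hx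
    (fun i => (hmem _).mpr (hv i)) ?_
  · refine (h P hP).trans ?_
    rw [← exp_zero, exp_le_exp]
    omega
  · rintro c ⟨o, ho, heq⟩
    refine hind c fun P hP => ?_
    rw [heq, map_mul]
    exact (mul_le_of_le_one_right' ((hmem o).mp ho P hP)).trans (h P hP)

theorem finite_zeros [IsFunctionField k F] {x : F} (hx0 : x ≠ 0) :
    {P : Place k F | P.valuation x < 1}.Finite := by
  by_contra hinf
  obtain ⟨P, hP⟩ := Set.Infinite.nonempty hinf
  have hx : Transcendental k x := P.transcendental_of_valuation_ne_one hx0 (ne_of_lt hP)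
  obtain ⟨t, hts, htc⟩ := Set.Infinite.exists_subset_card_eq hinf (Module.finrank k⟮x⟯ F + 1)
  have h1 := sum_zeros_le hx t (fun _ => 1) fun P hP => lt_one_iff_le_exp.mp (hts hP)
  have h2 : t.card ≤ ∑ P ∈ t, 1 * P.degree := by
    rw [Finset.card_eq_sum_ones]
    exact Finset.sum_le_sum fun P _ => by have := P.degree_pos; omega
  omega

theorem finite_log_ne_zero [IsFunctionField k F] (x : F) :
    {P : Place k F | log (P.valuation x) ≠ 0}.Finite := by
  by_cases hx0 : x = 0
  · simp [hx0]
  refine ((finite_zeros (k := k) hx0).union (finite_zeros (k := k) (inv_ne_zero hx0))).subset ?_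
  intro P hP
  have h0 := P.valuation_ne_zero hx0
  have h1 : P.valuation x ≠ 1 := fun h => hP (by rw [h, log_one])
  rcases lt_or_gt_of_ne h1 with h | h
  · exact Or.inl h
  · right
    change P.valuation x⁻¹ < 1
    rw [map_inv₀]
    exact inv_lt_one_of_one_lt₀ h

end Place

namespace Divisor

theorem degree_add (D E : Divisor k F) : (D + E).degree = D.degree + E.degree :=
  Finsupp.sum_add_index' (fun _ => by simp) (fun _ _ _ => by ring)

theorem degree_zero : (0 : Divisor k F).degree = 0 := Finsupp.sum_zero_index

theorem degree_single (P : Place k F) (m : ℤ) :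
    degree (Finsupp.single P m : Divisor k F) = m * P.degree :=
  Finsupp.sum_single_index (by simp)

theorem degree_neg (D : Divisor k F) : (-D).degree = -D.degree := by
  have := degree_add D (-D)
  rw [add_neg_cancel, degree_zero] at this
  omega

theorem degree_sub (D E : Divisor k F) : (D - E).degree = D.degree - E.degree := by
  rw [sub_eq_add_neg, degree_add, degree_neg]
  ring

theorem degree_nsmul (n : ℕ) (D : Divisor k F) : (n • D).degree = n * D.degree := by
  induction n with
  | zero => simp [degree_zero]
  | succ n ih =>
    rw [succ_nsmul, degree_add, ih]
    push_cast
    ring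

theorem degree_nonneg {D : Divisor k F} (h : 0 ≤ D) : 0 ≤ D.degree :=
  Finset.sum_nonneg fun P _ => mul_nonneg (h P) (by positivity)

theorem degree_mono {D E : Divisor k F} (h : D ≤ E) : D.degree ≤ E.degree := by
  have h1 := degree_nonneg (sub_nonneg.mpr h)
  rw [degree_sub] at h1
  omega

theorem degree_pos [IsFunctionField k F] {D : Divisor k F} (h : 0 ≤ D) (h0 : D ≠ 0) :
    0 < D.degree := by
  obtain ⟨P, hP⟩ := Finsupp.ne_iff.mp h0
  have hle : Finsupp.single P 1 ≤ D := by
    classical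
    intro Q
    rw [Finsupp.single_apply]
    have h1 := h P
    have h2 := h Q
    simp only [Finsupp.coe_zero, Pi.zero_apply] at h1 h2 hP
    split_ifs with hQ
    · subst hQ; omega
    · exact h2
  have := degree_mono hle
  rw [degree_single] at this
  have := P.degree_pos
  omega

end Divisor

theorem riemannRochSpace_mono {D E : Divisor k F} (h : D ≤ E) :
    riemannRochSpace D ≤ riemannRochSpace E :=
  fun _ hf P => (hf P).trans (exp_le_exp.mpr (h P))

/-- The leading coefficient at P maps L(D + P) to the residue field of P with kernel L(D). -/
theorem finrank_add_single_le [IsFunctionField k F] (D : Divisor k F) (P : Place k F)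
    (hfin : Module.Finite k (riemannRochSpace D)) :
    Module.Finite k (riemannRochSpace (D + Finsupp.single P 1)) ∧
      Module.finrank k (riemannRochSpace (D + Finsupp.single P 1)) ≤
        Module.finrank k (riemannRochSpace D) + P.degree := by
  classical
  have hle : riemannRochSpace (D + Finsupp.single P 1) ≤ P.ball (D P + 1) := fun f hf => by
    have := hf P
    rwa [Finsupp.add_apply, Finsupp.single_eq_same] at this
  let φ := (P.leadingCoeff (D P + 1)).comp (Submodule.inclusion hle)
  have hDle : riemannRochSpace D ≤ riemannRochSpace (D + Finsupp.single P 1) :=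
    riemannRochSpace_mono (by
      rw [le_add_iff_nonneg_right]
      exact Finsupp.single_nonneg.mpr zero_le_one)
  have hker : LinearMap.ker φ = (riemannRochSpace D).submoduleOf _ := by
    ext f
    rw [LinearMap.mem_ker, Submodule.submoduleOf, Submodule.mem_comap]
    refine (Place.leadingCoeff_eq_zero_iff _).trans ?_
    rw [add_sub_cancel_right]
    constructor
    · intro h Q
      by_cases hQ : Q = P
      · subst hQ; exact h
      · have := f.2 Q
        rwa [Finsupp.add_apply, Finsupp.single_eq_of_ne hQ, add_zero] at this
    · intro h
      exact h P
  have e : LinearMap.ker φ ≃ₗ[k] riemannRochSpace D :=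
    (LinearEquiv.ofEq _ _ hker).trans (Submodule.submoduleOfEquivOfLe hDle)
  have hfk : Module.Finite k (LinearMap.ker φ) := Module.Finite.equiv e.symm
  have := P.finite_residueField
  have hfin' : Module.Finite k (riemannRochSpace (D + Finsupp.single P 1)) := by
    refine ⟨Submodule.fg_of_fg_map_of_fg_inf_ker φ (IsNoetherian.noetherian _) ?_⟩
    rw [top_inf_eq]
    exact Module.Finite.iff_fg.mp hfk
  refine ⟨hfin', ?_⟩
  have h1 := φ.finrank_range_add_finrank_ker
  rw [e.finrank_eq] at h1
  have h2 : Module.finrank k (LinearMap.range φ) ≤ P.degree := Submodule.finrank_le _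
  omega

/-- The effective divisor added to D is given by natural multiplicities so that it can be added one
place at a time. -/
theorem finrank_le_of_le_aux [IsFunctionField k F] (E : Place k F →₀ ℕ) :
    ∀ D : Divisor k F, Module.Finite k (riemannRochSpace D) →
      Module.Finite k (riemannRochSpace (D + E.mapRange Nat.cast Nat.cast_zero)) ∧
      (Module.finrank k (riemannRochSpace (D + E.mapRange Nat.cast Nat.cast_zero)) : ℤ) ≤
        Module.finrank k (riemannRochSpace D) +
          Divisor.degree (E.mapRange Nat.cast Nat.cast_zero : Divisor k F) := by
  induction E using Finsupp.induction_linear with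
  | zero =>
    intro D hD
    rw [Finsupp.mapRange_zero, add_zero, Divisor.degree_zero]
    exact ⟨hD, by omega⟩
  | add E₁ E₂ h₁ h₂ =>
    intro D hD
    rw [Finsupp.mapRange_add (fun a b => Nat.cast_add a b), ← add_assoc, Divisor.degree_add]
    obtain ⟨hf1, hd1⟩ := h₁ D hD
    obtain ⟨hf2, hd2⟩ := h₂ _ hf1
    exact ⟨hf2, by omega⟩
  | single P n =>
    rw [Finsupp.mapRange_single, Divisor.degree_single]
    induction n with
    | zero =>
      intro D hD
      rw [Nat.cast_zero, Finsupp.single_zero, add_zero]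
      exact ⟨hD, by simp⟩
    | succ n ih =>
      intro D hD
      rw [Nat.cast_add, Nat.cast_one, Finsupp.single_add, ← add_assoc]
      obtain ⟨hf1, hd1⟩ := ih D hD
      obtain ⟨hf2, hd2⟩ := finrank_add_single_le _ P hf1
      refine ⟨hf2, ?_⟩
      have : ((n : ℤ) + 1) * P.degree = n * P.degree + P.degree := by ring
      rw [this]
      omega

theorem finite_and_finrank_le_of_le [IsFunctionField k F] {D D' : Divisor k F} (h : D ≤ D')
    (hD : Module.Finite k (riemannRochSpace D)) :
    Module.Finite k (riemannRochSpace D') ∧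
      (Module.finrank k (riemannRochSpace D') : ℤ) ≤
        Module.finrank k (riemannRochSpace D) + (D'.degree - D.degree) := by
  obtain ⟨h1, h2⟩ := finrank_le_of_le_aux ((D' - D).mapRange Int.toNat rfl) D hD
  have : ((D' - D).mapRange Int.toNat rfl).mapRange Nat.cast Nat.cast_zero = D' - D := by
    ext P
    have := h P
    simp only [Finsupp.mapRange_apply, Finsupp.sub_apply]
    omega
  rw [this, add_sub_cancel] at h1 h2
  rw [Divisor.degree_sub] at h2
  exact ⟨h1, h2⟩

/-- A nonzero function with a zero is transcendental, so its inverse also has a zero somewhere,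
which is a pole forbidden by D ≤ 0. -/
theorem riemannRochSpace_eq_bot [IsFunctionField k F] {D : Divisor k F} (hD : D ≤ 0)
    {P : Place k F} (hP : D P < 0) : riemannRochSpace D = ⊥ := by
  rw [eq_bot_iff]
  intro f hf
  by_contra hf0
  have hf0 : f ≠ 0 := hf0
  have h1 : P.valuation f < 1 := (hf P).trans_lt (by rw [← exp_zero, exp_lt_exp]; exact hP)
  have htr : Transcendental k f := P.transcendental_of_valuation_ne_one hf0 h1.ne
  obtain ⟨Q, hQ⟩ := Place.exists_valuation_lt_one (k := k) (f := f⁻¹)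
    (fun h => htr (by simpa using h.inv))
  rw [map_inv₀, inv_lt_one₀ (zero_lt_iff.mpr (Q.valuation_ne_zero hf0))] at hQ
  refine absurd ((hf Q).trans ?_) (not_le.mpr hQ)
  rw [← exp_zero, exp_le_exp]
  exact hD Q

instance finite_riemannRochSpace [IsFunctionField k F] (D : Divisor k F) :
    Module.Finite k (riemannRochSpace D) := by
  obtain ⟨P⟩ := Place.nonempty k F
  -- Below D lies a nonpositive divisor that is negative at P; its space is zero, and going up to D
  -- adds finite dimension.
  have h : riemannRochSpace (D ⊓ -Finsupp.single P 1) = ⊥ := by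
    refine riemannRochSpace_eq_bot (P := P) ?_ ?_
    · exact inf_le_right.trans (neg_nonpos.mpr (Finsupp.single_nonneg.mpr zero_le_one))
    · refine lt_of_le_of_lt (b := -1) ?_ (by omega)
      rw [Finsupp.inf_apply]
      refine inf_le_right.trans ?_
      simp
  refine (finite_and_finrank_le_of_le (D := D ⊓ -Finsupp.single P 1) inf_le_left ?_).1
  rw [h]
  infer_instance

theorem finrank_le_of_le [IsFunctionField k F] {D D' : Divisor k F} (h : D ≤ D') :
    (Module.finrank k (riemannRochSpace D') : ℤ) ≤
      Module.finrank k (riemannRochSpace D) + (D'.degree - D.degree) :=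
  (finite_and_finrank_le_of_le h inferInstance).2

end FunctionField1

/-! ### Riemann's theorem -/

namespace FunctionField1

open IntermediateField WithZero
open scoped IntermediateField.algebraAdjoinAdjoin

variable {k F : Type*} [Field k] [Field F] [Algebra k F]

theorem adjoin_inv (x : F) : k⟮x⁻¹⟯ = k⟮x⟯ := by
  apply le_antisymm
  · rw [adjoin_simple_le_iff]
    exact inv_mem (mem_adjoin_simple_self k x)
  · rw [adjoin_simple_le_iff]
    simpa using inv_mem (mem_adjoin_simple_self k x⁻¹)

theorem Place.valuation_le_one_of_isIntegral (P : Place k F) {A : Subalgebra k F}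
    (hA : A ≤ P.subalgebra) {f : F} (hf : IsIntegral A f) : P.valuation f ≤ 1 := by
  have h1 : IsIntegral P.subalgebra f := by
    obtain ⟨p, hp, hpe⟩ := hf
    refine ⟨p.map (Subalgebra.inclusion hA).toRingHom, hp.map _, ?_⟩
    rw [Polynomial.eval₂_map]
    exact hpe
  have h2 : IsIntegral P.ring f := h1
  obtain ⟨y, hy⟩ := IsIntegrallyClosed.isIntegral_iff.mp h2
  rw [Place.valuation_le_one_iff, ← hy]
  exact y.2

theorem valuation_le_one_of_isIntegral {x f : F} (hf : IsIntegral (Algebra.adjoin k {x}) f)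
    {P : Place k F} (hP : P.valuation x ≤ 1) : P.valuation f ≤ 1 :=
  P.valuation_le_one_of_isIntegral
    (Algebra.adjoin_le (by simpa using Place.mem_subalgebra.mpr hP)) hf

theorem linearIndependent_mul_pow {x : F} (hx : Transcendental k x) {ι : Type*} [Fintype ι]
    {u : ι → F} (hu : LinearIndependent k⟮x⟯ u) (l : ℕ) :
    LinearIndependent k (fun p : ι × Fin l => u p.1 * x ^ (p.2 : ℕ)) := by
  rw [Fintype.linearIndependent_iff]
  intro g hg
  have h1 := Fintype.linearIndependent_iff.mp hu
    (fun i => ∑ j : Fin l, algebraMap k k⟮x⟯ (g (i, j)) * AdjoinSimple.gen k x ^ (j : ℕ)) (by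
      rw [← hg, Fintype.sum_prod_type]
      refine Finset.sum_congr rfl fun i _ => ?_
      rw [Finset.sum_smul]
      refine Finset.sum_congr rfl fun j _ => ?_
      rw [IntermediateField.smul_def]
      simp only [MulMemClass.coe_mul, SubmonoidClass.coe_pow, AdjoinSimple.coe_gen, smul_eq_mul,
        Algebra.smul_def]
      change algebraMap k F (g (i, j)) * _ * _ = _
      ring)
  rintro ⟨i, j⟩
  have h2 := congrArg (algebraMap k⟮x⟯ F) (h1 i)
  let p : Polynomial k := ∑ j : Fin l, Polynomial.monomial (j : ℕ) (g (i, j))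
  have hp : Polynomial.aeval x p = 0 := by
    rw [map_zero] at h2
    rw [← h2]
    simp only [p, map_sum, Polynomial.aeval_monomial, map_mul, map_pow,
      AdjoinSimple.algebraMap_gen]
    rfl
  have hp0 : p = 0 := by
    by_contra h
    exact hx ⟨p, h, hp⟩
  have h3 := congrArg (fun q => Polynomial.coeff q (j : ℕ)) hp0
  simpa [p, Polynomial.finsetSum_coeff, Polynomial.coeff_monomial, Fin.val_inj] using h3

variable [IsFunctionField k F]

variable (k) in
/-- The divisor `∑ log (v_P x) P` of `x⁻¹`. -/
noncomputable def logDiv (x : F) : Divisor k F :=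
  Finsupp.ofSupportFinite (fun P => log (P.valuation x)) (Place.finite_log_ne_zero x)

variable (k) in
/-- The divisor of poles of `x`. -/
noncomputable def poleDiv (x : F) : Divisor k F := logDiv k x ⊔ 0

theorem logDiv_apply (x : F) (P : Place k F) : logDiv k x P = log (P.valuation x) := rfl

theorem poleDiv_apply (x : F) (P : Place k F) : poleDiv k x P = max (log (P.valuation x)) 0 := rfl

theorem poleDiv_nonneg (x : F) : 0 ≤ poleDiv k x := le_sup_right

theorem valuation_le_exp_poleDiv (x : F) (P : Place k F) :
    P.valuation x ≤ exp (poleDiv k x P) := by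
  by_cases hx : x = 0
  · simp [hx]
  · rw [← log_le_iff_le_exp (P.valuation_ne_zero hx)]
    exact le_max_left _ _

theorem one_le_poleDiv {x : F} {P : Place k F} (h : 1 < P.valuation x) : 1 ≤ poleDiv k x P := by
  rw [poleDiv_apply]
  have h0 : P.valuation x ≠ 0 := (zero_lt_one.trans h).ne'
  have : 0 < log (P.valuation x) := by
    rw [← log_one, log_lt_log one_ne_zero h0]
    exact h
  omega

theorem logDiv_inv (x : F) : logDiv k x⁻¹ = -logDiv k x := by
  ext P
  rw [logDiv_apply, Finsupp.neg_apply, logDiv_apply, map_inv₀, log_inv]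

theorem logDiv_eq_sub (x : F) : logDiv k x = poleDiv k x - poleDiv k x⁻¹ := by
  ext P
  rw [Finsupp.sub_apply, poleDiv_apply, poleDiv_apply, logDiv_apply, map_inv₀, log_inv]
  omega

/-- Poles of x are zeros of x⁻¹, and x and x⁻¹ generate the same field. -/
theorem degree_poleDiv_le {x : F} (hx : Transcendental k x) :
    (poleDiv k x).degree ≤ Module.finrank k⟮x⟯ F := by
  have hx0 : x ≠ 0 := by
    rintro rfl
    exact hx isAlgebraic_zero
  have hxi : Transcendental k x⁻¹ := fun h => hx (by simpa using h.inv)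
  have h := Place.sum_zeros_le hxi (poleDiv k x).support (fun P => (poleDiv k x P).toNat) (by
    intro P hP
    have h1 : poleDiv k x P ≠ 0 := Finsupp.mem_support_iff.mp hP
    have h0 := P.valuation_ne_zero hx0
    rw [map_inv₀, exp_neg, Int.toNat_of_nonneg (poleDiv_nonneg x P)]
    rw [poleDiv_apply] at h1 ⊢
    have : max (log (P.valuation x)) 0 = log (P.valuation x) := by omega
    rw [this, exp_log h0])
  rw [adjoin_inv] at h
  refine le_trans (le_of_eq ?_) (Nat.cast_le.mpr h)
  rw [Divisor.degree, Finsupp.sum]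
  push_cast
  refine Finset.sum_congr rfl fun P _ => ?_
  rw [Int.toNat_of_nonneg (poleDiv_nonneg x P)]

theorem exists_mem_nsmul_poleDiv {x f : F} (hf : ∀ P : Place k F, P.valuation x ≤ 1 →
    P.valuation f ≤ 1) : ∃ c : ℕ, ∀ m ≥ c, f ∈ riemannRochSpace (m • poleDiv k x) := by
  refine ⟨∑ P ∈ (poleDiv k f).support, (poleDiv k f P).toNat, fun m hm P => ?_⟩
  rw [Finsupp.smul_apply, nsmul_eq_mul]
  by_cases hP : P.valuation x ≤ 1
  · refine (hf P hP).trans ?_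
    rw [← exp_zero, exp_le_exp]
    exact mul_nonneg (by positivity) (poleDiv_nonneg x P)
  · have h1 := one_le_poleDiv (not_le.mp hP)
    refine (valuation_le_exp_poleDiv f P).trans (exp_le_exp.mpr ?_)
    have h2 : poleDiv k f P ≤ m := by
      by_cases hs : P ∈ (poleDiv k f).support
      · have := Finset.single_le_sum (f := fun P => (poleDiv k f P).toNat)
          (fun _ _ => Nat.zero_le _) hs
        have h3 := poleDiv_nonneg f P
        simp only [Finsupp.coe_zero, Pi.zero_apply] at h3
        omega
      · rw [Finsupp.notMem_support_iff.mp hs]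
        positivity
    nlinarith

/-- A basis of `F / k(x)` whose elements have poles at most at the poles of `x`. -/
theorem exists_basis_mem_nsmul_poleDiv {x : F} (hx : Transcendental k x) :
    ∃ (u : Fin (Module.finrank k⟮x⟯ F) → F) (c : ℕ), LinearIndependent k⟮x⟯ u ∧
      ∀ i, ∀ m ≥ c, u i ∈ riemannRochSpace (m • poleDiv k x) := by
  have := IsFunctionField.finite_adjoin x hx
  let b := Module.finBasis k⟮x⟯ F
  -- Scaling by a denominator in k[x] makes each basis element integral over k[x], hence regular
  -- wherever x is, and preserves independence over k(x).
  have hex : ∀ i, ∃ y : Algebra.adjoin k {x}, y ≠ 0 ∧ IsIntegral (Algebra.adjoin k {x}) (y • b i) :=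
    fun i => IsAlgebraic.exists_integral_multiple
      (isAlgebraic_adjoin_iff.mp (Algebra.IsAlgebraic.isAlgebraic (b i)))
  choose y hy0 hy using hex
  have hy0' : ∀ i, algebraMap (Algebra.adjoin k {x}) k⟮x⟯ (y i) ≠ 0 := fun i h =>
    hy0 i ((map_eq_zero_iff _ (IsFractionRing.injective (Algebra.adjoin k {x}) k⟮x⟯)).mp h)
  have hc : ∀ i, ∃ c : ℕ, ∀ m ≥ c, y i • b i ∈ riemannRochSpace (m • poleDiv k x) := fun i =>
    exists_mem_nsmul_poleDiv fun P hP => valuation_le_one_of_isIntegral (hy i) hP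
  choose c hc using hc
  refine ⟨fun i => y i • b i, ∑ i, c i, ?_, fun i m hm => hc i m (le_trans ?_ hm)⟩
  · have h1 := b.linearIndependent.units_smul (fun i => Units.mk0 _ (hy0' i))
    convert h1 using 1
    funext i
    exact (algebraMap_smul k⟮x⟯ (y i) (b i)).symm
  · exact Finset.single_le_sum (f := c) (fun _ _ => Nat.zero_le _) (Finset.mem_univ i)

/-- The products u_i x ^ j with j ≤ l are independent over k, and each extra power of x costs one
copy of its pole divisor. -/
theorem exists_le_finrank_nsmul_poleDiv {x : F} (hx : Transcendental k x) :
    ∃ c : ℕ, ∀ l : ℕ, Module.finrank k⟮x⟯ F * (l + 1) ≤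
      Module.finrank k (riemannRochSpace ((c + l) • poleDiv k x)) := by
  obtain ⟨u, c, hu, huc⟩ := exists_basis_mem_nsmul_poleDiv hx
  refine ⟨c, fun l => ?_⟩
  have hmem : ∀ p : Fin (Module.finrank k⟮x⟯ F) × Fin (l + 1),
      u p.1 * x ^ (p.2 : ℕ) ∈ riemannRochSpace ((c + l) • poleDiv k x) := by
    rintro ⟨i, j⟩ P
    have h1 := huc i c le_rfl P
    have h2 := pow_le_pow_left₀ zero_le (valuation_le_exp_poleDiv x P) (j : ℕ)
    rw [map_mul, map_pow]
    refine (mul_le_mul' h1 h2).trans ?_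
    rw [← exp_nsmul, ← exp_add, exp_le_exp]
    simp only [Finsupp.smul_apply, nsmul_eq_mul]
    have h3 : 0 ≤ poleDiv k x P := poleDiv_nonneg x P
    have h4 : (j : ℤ) ≤ l := by have := j.2; omega
    push_cast
    nlinarith
  have hli : LinearIndependent k (fun p => (⟨_, hmem p⟩ : riemannRochSpace _)) :=
    LinearIndependent.of_comp (riemannRochSpace ((c + l) • poleDiv k x)).subtype
      (linearIndependent_mul_pow hx hu (l + 1))
  simpa using hli.fintype_card_le_finrank

/-- Compare growth in l: dim L((c + l)(x)_∞) is at least [F : k(x)](l + 1), but at most a constant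
plus l times the degree of the pole divisor. -/
theorem degree_poleDiv {x : F} (hx : Transcendental k x) :
    (poleDiv k x).degree = Module.finrank k⟮x⟯ F := by
  refine le_antisymm (degree_poleDiv_le hx) ?_
  by_contra! hlt
  obtain ⟨c, hc⟩ := exists_le_finrank_nsmul_poleDiv hx
  set n := Module.finrank k⟮x⟯ F
  set d := (poleDiv k x).degree
  have hd : 0 ≤ d := Divisor.degree_nonneg (poleDiv_nonneg x)
  set l0 := Module.finrank k (riemannRochSpace (0 : Divisor k F))
  have key : ∀ l : ℕ, (n : ℤ) * (l + 1) ≤ l0 + (c + l) * d := by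
    intro l
    have h1 := hc l
    have h2 := finrank_le_of_le (nsmul_nonneg (poleDiv_nonneg (k := k) x) (c + l))
    rw [Divisor.degree_nsmul, Divisor.degree_zero] at h2
    push_cast at h2
    have h3 : ((n * (l + 1) : ℕ) : ℤ) ≤
      (Module.finrank k (riemannRochSpace ((c + l) • poleDiv k x)) : ℤ) := by exact_mod_cast h1
    push_cast at h3
    linarith
  -- With d + 1 ≤ n, this l gives (d + 1)(l + 1) ≤ l + l d, which is absurd.
  have h := key (l0 + c * d.toNat)
  push_cast [Int.toNat_of_nonneg hd] at h
  have h1 : (d + 1) * (l0 + c * d + 1) ≤ n * (l0 + c * d + 1) :=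
    mul_le_mul_of_nonneg_right (by omega) (by positivity)
  nlinarith

/-- For transcendental x, both zeros and poles have total degree [F : k(x)]; a nonzero algebraic x
has neither. -/
theorem degree_logDiv {x : F} (hx0 : x ≠ 0) : (logDiv k x).degree = 0 := by
  by_cases hx : IsAlgebraic k x
  · have : logDiv k x = 0 := by
      ext P
      rw [logDiv_apply, P.valuation_eq_one_of_isAlgebraic hx0 hx]
      simp
    rw [this, Divisor.degree_zero]
  · have hxi : Transcendental k x⁻¹ := fun h => hx (by simpa using h.inv)
    rw [logDiv_eq_sub, Divisor.degree_sub, degree_poleDiv hx, degree_poleDiv hxi, adjoin_inv]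
    simp

/-- Multiplication by `z` identifies `L(D)` with `L(D - div z)`. -/
theorem finrank_add_logDiv {z : F} (hz : z ≠ 0) (D : Divisor k F) :
    Module.finrank k (riemannRochSpace (D + logDiv k z)) =
      Module.finrank k (riemannRochSpace D) := by
  have key : ∀ (w : F) (hw : w ≠ 0) (E : Divisor k F),
      (riemannRochSpace E).map (LinearMap.mulLeft k w) ≤ riemannRochSpace (E + logDiv k w) := by
    rintro w hw E _ ⟨f, hf, rfl⟩ P
    rw [LinearMap.mulLeft_apply, map_mul, Finsupp.add_apply, logDiv_apply, exp_add,
      exp_log (P.valuation_ne_zero hw), mul_comm]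
    exact mul_le_mul_left (hf P) _
  have hinj : ∀ w : F, w ≠ 0 → Function.Injective (LinearMap.mulLeft k w) := fun w hw a b h =>
    mul_left_cancel₀ hw h
  have h1 : ∀ (w : F) (hw : w ≠ 0) (E : Divisor k F), Module.finrank k (riemannRochSpace E) ≤
      Module.finrank k (riemannRochSpace (E + logDiv k w)) := by
    intro w hw E
    rw [(Submodule.equivMapOfInjective _ (hinj w hw) (riemannRochSpace E)).finrank_eq]
    exact Submodule.finrank_mono (key w hw E)
  refine le_antisymm ?_ (h1 z hz D)
  have := h1 z⁻¹ (inv_ne_zero hz) (D + logDiv k z)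
  rwa [logDiv_inv, add_neg_cancel_right] at this

theorem sub_finrank_mono {D E : Divisor k F} (h : D ≤ E) :
    D.degree - Module.finrank k (riemannRochSpace D) ≤
      E.degree - Module.finrank k (riemannRochSpace E) := by
  have := finrank_le_of_le h
  omega

/-- A nonzero z in L(E - D) moves D to a linearly equivalent divisor below E, which changes neither
degree nor dimension; then monotonicity applies. -/
theorem sub_finrank_le_of_finrank_pos {D E : Divisor k F}
    (h : 0 < Module.finrank k (riemannRochSpace (E - D))) :
    D.degree - Module.finrank k (riemannRochSpace D) ≤
      E.degree - Module.finrank k (riemannRochSpace E) := by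
  obtain ⟨⟨z, hz⟩, hz0⟩ := (Module.finrank_pos_iff_exists_ne_zero).mp h
  have hz0 : z ≠ 0 := fun h => hz0 (Subtype.ext h)
  have hle : D + logDiv k z ≤ E := by
    intro P
    have h1 := hz P
    rw [← log_le_iff_le_exp (P.valuation_ne_zero hz0), Finsupp.sub_apply] at h1
    rw [Finsupp.add_apply, logDiv_apply]
    omega
  have h2 := sub_finrank_mono hle
  rwa [Divisor.degree_add, degree_logDiv hz0, add_zero, finrank_add_logDiv hz0] at h2

variable (k F) in
-- Riemann's inequality. Every divisor is dominated, up to linear equivalence, by a multiple of the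
-- pole divisor of one fixed x, and for those multiples the growth estimate bounds the difference.
theorem exists_bound_sub_finrank : ∃ γ : ℤ, ∀ D : Divisor k F,
    D.degree - Module.finrank k (riemannRochSpace D) ≤ γ := by
  obtain ⟨x, hx⟩ := IsFunctionField.exists_transcendental (k := k) (F := F)
  obtain ⟨c, hc⟩ := exists_le_finrank_nsmul_poleDiv hx
  have hn : 0 < Module.finrank k⟮x⟯ F := by
    have := IsFunctionField.finite_adjoin x hx
    exact Module.finrank_pos
  set n := Module.finrank k⟮x⟯ F
  refine ⟨n * c, fun D => ?_⟩
  -- Subtracting D ⊔ 0 lowers the dimension by at most l, whereas the multiple c + l has dimension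
  -- at least n(l + 1) > l.
  set l := (D ⊔ 0).degree.toNat
  have hD0 : 0 ≤ D ⊔ 0 := le_sup_right
  have hc' : (n : ℤ) * (l + 1) ≤ Module.finrank k (riemannRochSpace ((c + l) • poleDiv k x)) := by
    exact_mod_cast hc l
  refine (sub_finrank_mono (le_sup_left : D ≤ D ⊔ 0)).trans ?_
  refine (sub_finrank_le_of_finrank_pos (E := (c + l) • poleDiv k x) ?_).trans ?_
  · have h1 := finrank_le_of_le (sub_le_self ((c + l) • poleDiv k x) hD0)
    rw [Divisor.degree_sub] at h1
    have h2 : ((l : ℕ) : ℤ) = (D ⊔ 0).degree := Int.toNat_of_nonneg (Divisor.degree_nonneg hD0)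
    have : (0 : ℤ) < Module.finrank k (riemannRochSpace ((c + l) • poleDiv k x - D ⊔ 0)) := by
      nlinarith
    exact_mod_cast this
  · rw [Divisor.degree_nsmul, degree_poleDiv hx]
    push_cast
    nlinarith

theorem bddAbove_genus : BddAbove (Set.range fun D : Divisor k F =>
    D.degree - Module.finrank k (riemannRochSpace D) + 1) := by
  obtain ⟨γ, hγ⟩ := exists_bound_sub_finrank k F
  refine ⟨γ + 1, ?_⟩
  rintro _ ⟨D, rfl⟩
  have := hγ D
  simp only
  omega

theorem sub_finrank_le_genus (D : Divisor k F) :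
    D.degree - Module.finrank k (riemannRochSpace D) + 1 ≤ genus k F :=
  le_csSup bddAbove_genus ⟨D, rfl⟩

/-- Riemann's theorem for the multiples of an effective divisor. -/
theorem eventually_finrank_nsmul {E : Divisor k F} (hE : 0 < E.degree) :
    ∃ d₀ : ℕ, ∀ d ≥ d₀,
      (Module.finrank k (riemannRochSpace (d • E)) : ℤ) = d * E.degree + 1 - genus k F := by
  -- A bounded nonempty set of integers attains its supremum. For d large, L(dE - D) is nonzero, so
  -- dE does at least as well as this optimal D.
  obtain ⟨D, hD⟩ : genus k F ∈ _ := Int.csSup_mem (Set.range_nonempty _) (bddAbove_genus (k := k))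
  obtain ⟨γ, hγ⟩ := exists_bound_sub_finrank k F
  refine ⟨(D.degree + γ + 1).toNat, fun d hd => ?_⟩
  have h1 := sub_finrank_le_genus (d • E)
  have h2 := sub_finrank_le_of_finrank_pos (D := D) (E := d • E) (by
    have h3 := hγ (d • E - D)
    rw [Divisor.degree_sub, Divisor.degree_nsmul] at h3
    have : (0 : ℤ) < Module.finrank k (riemannRochSpace (d • E - D)) := by
      have : D.degree + γ + 1 ≤ d := by omega
      nlinarith
    exact_mod_cast this)
  rw [Divisor.degree_nsmul] at h1 h2
  simp only at hD
  omega

end FunctionField1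

/-! ### Hilbert functions of projectively embedded curves -/

namespace FunctionField1

open IntermediateField WithZero MvPolynomial

variable {k F : Type*} [Field k] [Field F] [Algebra k F] {σ : Type*}

variable (k) in
/-- The values at `y` of the forms of degree `d`. -/
noncomputable def formValues (y : σ → F) (d : ℕ) : Submodule k F :=
  (homogeneousSubmodule σ k d).map (aeval y).toLinearMap

variable (k) in
/-- The coordinate ring of the affine chart `y_j ≠ 0`. -/
noncomputable def chart (y : σ → F) (j : σ) : Subalgebra k F :=
  Algebra.adjoin k (Set.range fun i => y i / y j)

section formValues

variable {y : σ → F}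

theorem mem_formValues {d : ℕ} {f : F} :
    f ∈ formValues k y d ↔ ∃ p : MvPolynomial σ k, p.IsHomogeneous d ∧ aeval y p = f := Iff.rfl

theorem mul_mem_formValues {a b : ℕ} {f g : F} (hf : f ∈ formValues k y a)
    (hg : g ∈ formValues k y b) : f * g ∈ formValues k y (a + b) := by
  obtain ⟨p, hp, rfl⟩ := mem_formValues.mp hf
  obtain ⟨q, hq, rfl⟩ := mem_formValues.mp hg
  exact mem_formValues.mpr ⟨p * q, hp.mul hq, map_mul _ _ _⟩

theorem pow_mem_formValues {a : ℕ} {f : F} (hf : f ∈ formValues k y a) (m : ℕ) :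
    f ^ m ∈ formValues k y (a * m) := by
  obtain ⟨p, hp, rfl⟩ := mem_formValues.mp hf
  exact mem_formValues.mpr ⟨p ^ m, hp.pow m, map_pow _ _ _⟩

theorem one_mem_formValues_zero : (1 : F) ∈ formValues k y 0 :=
  mem_formValues.mpr ⟨1, isHomogeneous_one σ k, map_one _⟩

theorem prod_mem_formValues {ι : Type*} (s : Finset ι) (a : ι → ℕ) (f : ι → F)
    (hf : ∀ i ∈ s, f i ∈ formValues k y (a i)) : ∏ i ∈ s, f i ∈ formValues k y (∑ i ∈ s, a i) := by
  classical
  induction s using Finset.induction_on with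
  | empty => simpa using one_mem_formValues_zero
  | insert i s hi ih =>
    rw [Finset.prod_insert hi, Finset.sum_insert hi]
    exact mul_mem_formValues (hf i (Finset.mem_insert_self i s))
      (ih fun j hj => hf j (Finset.mem_insert_of_mem hj))

theorem coord_mem_formValues (i : σ) : y i ∈ formValues k y 1 :=
  mem_formValues.mpr ⟨X i, isHomogeneous_X k i, aeval_X _ _⟩

theorem coord_pow_mem_formValues (i : σ) (m : ℕ) : y i ^ m ∈ formValues k y m := by
  simpa using pow_mem_formValues (k := k) (coord_mem_formValues i) m

/-- A coordinate normalised to 1 turns multiplication by it into an inclusion. -/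
theorem formValues_mono {i₀ : σ} (h : y i₀ = 1) {a b : ℕ} (hab : a ≤ b) :
    formValues k y a ≤ formValues k y b := by
  intro f hf
  have h1 := mul_mem_formValues hf (coord_pow_mem_formValues (k := k) i₀ (b - a))
  rwa [h, one_pow, mul_one, Nat.add_sub_cancel' hab] at h1

theorem exists_mul_pow_mem_formValues {j : σ} (hj : y j ≠ 0) {f : F} (hf : f ∈ chart k y j) :
    ∃ N : ℕ, f * y j ^ N ∈ formValues k y N := by
  induction hf using Algebra.adjoin_induction with
  | mem f hf =>
    obtain ⟨i, rfl⟩ := hf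
    refine ⟨1, ?_⟩
    rw [pow_one]
    simp only [div_mul_cancel₀ _ hj]
    exact coord_mem_formValues i
  | algebraMap c =>
    refine ⟨0, ?_⟩
    rw [pow_zero, mul_one, Algebra.algebraMap_eq_smul_one]
    exact Submodule.smul_mem _ _ one_mem_formValues_zero
  | add f g _ _ hf hg =>
    obtain ⟨N, hN⟩ := hf
    obtain ⟨M, hM⟩ := hg
    refine ⟨N + M, ?_⟩
    have h1 := mul_mem_formValues hN (coord_pow_mem_formValues (k := k) j M)
    have h2 := mul_mem_formValues hM (coord_pow_mem_formValues (k := k) j N)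
    rw [add_comm M N] at h2
    convert add_mem h1 h2 using 1
    ring
  | mul f g _ _ hf hg =>
    obtain ⟨N, hN⟩ := hf
    obtain ⟨M, hM⟩ := hg
    refine ⟨N + M, ?_⟩
    convert mul_mem_formValues hN hM using 1
    ring

variable [Fintype σ]

/-- Forms are linear combinations of monomials. -/
theorem formValues_le {d : ℕ} {T : Submodule k F}
    (h : ∀ m : σ →₀ ℕ, m.degree = d → ∏ i, y i ^ m i ∈ T) : formValues k y d ≤ T := by
  intro f hf
  obtain ⟨p, hp, rfl⟩ := mem_formValues.mp hf
  rw [aeval_def, eval₂_eq']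
  refine T.sum_mem fun m hm => ?_
  rw [← Algebra.smul_def]
  refine T.smul_mem _ (h m ?_)
  rw [Finsupp.degree_eq_weight_one]
  exact hp (mem_support_iff.mp hm)

theorem div_pow_mem_chart {j : σ} {d : ℕ} {f : F} (hf : f ∈ formValues k y d) :
    f / y j ^ d ∈ chart k y j := by
  have hle : formValues k y d ≤
      (chart k y j).toSubmodule.comap (LinearMap.mulRight k (y j ^ d)⁻¹) := by
    refine formValues_le fun m hm => ?_
    change (∏ i, y i ^ m i) * (y j ^ d)⁻¹ ∈ chart k y j
    have : (∏ i, y i ^ m i) * (y j ^ d)⁻¹ = ∏ i, (y i / y j) ^ m i := by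
      rw [← hm, Finsupp.degree_eq_sum, ← Finset.prod_pow_eq_pow_sum, ← div_eq_mul_inv,
        ← Finset.prod_div_distrib]
      simp_rw [div_pow]
    rw [this]
    exact (chart k y j).prod_mem fun i _ =>
      (chart k y j).pow_mem (Algebra.subset_adjoin ⟨i, rfl⟩) _
  rw [div_eq_mul_inv]
  exact hle hf

end formValues

/-- `D` is the divisor of poles of the linear system spanned by `y`. -/
structure IsHyperplaneDivisor (y : σ → F) (D : Divisor k F) : Prop where
  nonneg : 0 ≤ D
  le : ∀ P i, P.valuation (y i) ≤ exp (D P)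
  eq : ∀ P, ∃ i, P.valuation (y i) = exp (D P)

section

variable [Fintype σ] {y : σ → F} {D : Divisor k F}

theorem IsHyperplaneDivisor.formValues_le (hD : IsHyperplaneDivisor y D) (d : ℕ) :
    formValues k y d ≤ riemannRochSpace (d • D) := by
  refine FunctionField1.formValues_le fun m hm P => ?_
  rw [map_prod, Finsupp.smul_apply, ← hm, Finsupp.degree_eq_sum, Finset.sum_smul]
  have h1 : exp (∑ i, m i • D P) = ∏ i, exp (D P) ^ m i := by
    simp_rw [← exp_nsmul]
    induction (Finset.univ : Finset σ) using Finset.cons_induction with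
    | empty => simp
    | cons a s ha ih => rw [Finset.sum_cons, exp_add, ih, Finset.prod_cons]
  rw [h1]
  refine Finset.prod_le_prod' fun i _ => ?_
  rw [map_pow]
  exact pow_le_pow_left₀ zero_le (hD.le P i) _

theorem IsHyperplaneDivisor.valuation_le (hD : IsHyperplaneDivisor y D) {d : ℕ} {f : F}
    (hf : f ∈ formValues k y d) (P : Place k F) : P.valuation f ≤ exp (D P) ^ d := by
  have := hD.formValues_le d hf P
  rwa [Finsupp.smul_apply, exp_nsmul] at this

/-- Prime avoidance: a form not vanishing at finitely many places. -/
theorem IsHyperplaneDivisor.exists_valuation_eq (hD : IsHyperplaneDivisor y D) (i₀ : σ)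
    (n : ℕ) : ∀ s : Finset (Place k F), s.card = n →
    ∃ e, 0 < e ∧ ∃ w ∈ formValues k y e, ∀ P ∈ s, P.valuation w = exp (D P) ^ e := by
  classical
  induction n with
  | zero =>
    intro s hs
    rw [Finset.card_eq_zero] at hs
    exact ⟨1, one_pos, y i₀, coord_mem_formValues i₀, by simp [hs]⟩
  | succ n ih =>
    intro s hs
    have hcard : ∀ Q ∈ s, (s.erase Q).card = n := fun Q hQ => by
      rw [Finset.card_erase_of_mem hQ, hs]
      rfl
    have hex : ∀ Q : s, ∃ e, 0 < e ∧ ∃ w ∈ formValues k y e, ∀ P ∈ s.erase Q.1,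
        P.valuation w = exp (D P) ^ e := fun Q => ih _ (hcard Q.1 Q.2)
    choose e he w hw hval using hex
    -- By induction, w Q is maximal at every place of s other than Q. If some w Q is maximal at Q
    -- too, it is the form sought; otherwise each w Q drops at Q only.
    by_cases hgood : ∃ Q : s, Q.1.valuation (w Q) = exp (D Q.1) ^ e Q
    · obtain ⟨Q, hQ⟩ := hgood
      refine ⟨e Q, he Q, w Q, hw Q, fun P hP => ?_⟩
      by_cases hPQ : P = Q.1
      · rw [hPQ]; exact hQ
      · exact hval Q P (Finset.mem_erase.mpr ⟨hPQ, hP⟩)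
    · have hbad : ∀ Q : s, Q.1.valuation (w Q) < exp (D Q.1) ^ e Q := fun Q =>
        lt_of_le_of_ne (hD.valuation_le (hw Q) _) fun h => hgood ⟨Q, h⟩
      obtain ⟨P₀, hP₀⟩ : s.Nonempty := Finset.card_pos.mp (by omega)
      let p₀ : s := ⟨P₀, hP₀⟩
      -- For a single place the product below is empty and of degree 0, so a coordinate is used
      -- instead.
      by_cases hone : s = {P₀}
      · obtain ⟨i, hi⟩ := hD.eq P₀
        refine ⟨1, one_pos, y i, coord_mem_formValues i, fun P hP => ?_⟩
        rw [hone, Finset.mem_singleton] at hP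
        rw [hP, hi, pow_one]
      let t : Finset s := Finset.univ.erase p₀
      have ht : t.Nonempty := by
        have : s ≠ {P₀} := hone
        obtain ⟨Q, hQ, hne⟩ := Finset.exists_mem_ne (s := s) (by
          by_contra hc
          have : s.card ≤ 1 := not_lt.mp hc
          exact hone (Finset.eq_singleton_iff_unique_mem.mpr ⟨hP₀, fun x hx =>
            Finset.card_le_one.mp this x hx P₀ hP₀⟩)) P₀
        exact ⟨⟨Q, hQ⟩, Finset.mem_erase.mpr ⟨fun h => hne (congrArg Subtype.val h),
          Finset.mem_univ _⟩⟩
      set b := ∏ Q ∈ t, w Q with hb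
      set eb := ∑ Q ∈ t, e Q with heb
      have hebpos : 0 < eb := Finset.sum_pos (fun Q _ => he Q) ht
      have hbW : b ∈ formValues k y eb := prod_mem_formValues t e w fun Q _ => hw Q
      have hbP₀ : P₀.valuation b = exp (D P₀) ^ eb := by
        rw [hb, map_prod, heb, ← Finset.prod_pow_eq_pow_sum]
        refine Finset.prod_congr rfl fun Q hQ => ?_
        refine hval Q P₀ (Finset.mem_erase.mpr ⟨fun h => ?_, hP₀⟩)
        exact Finset.ne_of_mem_erase hQ (Subtype.ext h.symm)
      have hbQ : ∀ Q ∈ t, Q.1.valuation b < exp (D Q.1) ^ eb := by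
        intro Q hQ
        rw [hb, map_prod, heb, ← Finset.prod_pow_eq_pow_sum, ← Finset.mul_prod_erase t _ hQ,
          ← Finset.mul_prod_erase t _ hQ]
        have hle : ∏ x ∈ t.erase Q, Q.1.valuation (w x) ≤ ∏ x ∈ t.erase Q, exp (D Q.1) ^ e x :=
          Finset.prod_le_prod' fun R _ => hD.valuation_le (hw R) _
        refine mul_lt_mul_of_lt_of_le_of_nonneg_of_pos (hbad Q) hle zero_le ?_
        exact zero_lt_iff.mpr (Finset.prod_ne_zero_iff.mpr fun _ _ => pow_ne_zero _ exp_ne_zero)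
      set a := w p₀
      -- The exponents equalise degrees. At P₀ only the second summand is maximal, at the other
      -- places only the first, so nothing cancels.
      refine ⟨e p₀ * eb, Nat.mul_pos (he p₀) hebpos, a ^ eb + b ^ e p₀, ?_, fun P hP => ?_⟩
      · refine add_mem (pow_mem_formValues (hw p₀) eb) ?_
        rw [mul_comm]
        exact pow_mem_formValues hbW (e p₀)
      · by_cases hPP : P = P₀
        · subst hPP
          have h2 : P.valuation (b ^ e p₀) = exp (D P) ^ (e p₀ * eb) := by
            rw [map_pow, hbP₀, ← pow_mul, mul_comm]
          rw [P.valuation.map_add_eq_of_lt_right, h2]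
          rw [h2, map_pow, pow_mul]
          exact pow_lt_pow_left₀ (hbad p₀) zero_le hebpos.ne'
        · have hPt : (⟨P, hP⟩ : s) ∈ t :=
            Finset.mem_erase.mpr ⟨fun h => hPP (congrArg Subtype.val h), Finset.mem_univ _⟩
          have h2 : P.valuation (a ^ eb) = exp (D P) ^ (e p₀ * eb) := by
            rw [map_pow, hval p₀ P (Finset.mem_erase.mpr ⟨hPP, hP⟩), ← pow_mul]
          rw [P.valuation.map_add_eq_of_lt_left, h2]
          rw [h2, map_pow, mul_comm, pow_mul]
          exact pow_lt_pow_left₀ (hbQ _ hPt) zero_le (he p₀).ne'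

variable [IsFunctionField k F]

variable (k) in
-- Take the largest pole order of the coordinates at each place; the coordinate 1 makes it
-- nonnegative and attains it where it is 0.
theorem exists_isHyperplaneDivisor {i₀ : σ} (h : y i₀ = 1) :
    ∃ D : Divisor k F, IsHyperplaneDivisor y D := by
  classical
  have hne : (Finset.univ : Finset σ).Nonempty := ⟨i₀, Finset.mem_univ _⟩
  let m : Place k F → ℤ := fun P => Finset.univ.sup' hne fun i => poleDiv k (y i) P
  have hm : (Function.support m).Finite := by
    refine (Set.finite_iUnion fun i : σ => (poleDiv k (y i)).hasFiniteSupport).subset ?_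
    intro P hP
    obtain ⟨i, _, hi⟩ := Finset.exists_mem_eq_sup' hne fun i => poleDiv k (y i) P
    refine Set.mem_iUnion.mpr ⟨i, ?_⟩
    rw [Function.mem_support]
    rw [Function.mem_support] at hP
    exact hi ▸ hP
  have h0 : ∀ P, 0 ≤ m P := fun P =>
    (poleDiv_nonneg (k := k) (y i₀) P).trans
      (Finset.le_sup' (fun i => poleDiv k (y i) P) (Finset.mem_univ i₀))
  refine ⟨Finsupp.ofSupportFinite m hm, h0, fun P i => ?_, fun P => ?_⟩
  · exact (valuation_le_exp_poleDiv _ P).trans (exp_le_exp.mpr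
      (Finset.le_sup' (fun i => poleDiv k (y i) P) (Finset.mem_univ i)))
  · obtain ⟨i, _, hi⟩ := Finset.exists_mem_eq_sup' hne fun i => poleDiv k (y i) P
    have hi : m P = poleDiv k (y i) P := hi
    change ∃ i, P.valuation (y i) = exp (m P)
    by_cases hmP : m P = 0
    · exact ⟨i₀, by rw [hmP, h]; simp⟩
    · refine ⟨i, ?_⟩
      rw [hi, poleDiv_apply] at hmP
      have h1 : max (log (P.valuation (y i))) 0 = log (P.valuation (y i)) := by omega
      have h2 : P.valuation (y i) ≠ 0 := by
        intro h0
        rw [h0] at hmP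
        simp at hmP
      rw [hi, poleDiv_apply, h1, exp_log h2]

/-- Prime avoidance on the support of D yields w with pole divisor exactly eD, so 1 and w span a
base point free pencil in L(eD). -/
theorem IsHyperplaneDivisor.exists_pencil (hD : IsHyperplaneDivisor y D) (i₀ : σ) :
    ∃ e, 0 < e ∧ ∃ w ∈ formValues k y e, poleDiv k w = e • D ∧
      ∀ P, D P ≠ 0 → P.valuation w = exp (e • D P) := by
  obtain ⟨e, he, w, hw, hval⟩ := hD.exists_valuation_eq i₀ _ D.support rfl
  refine ⟨e, he, w, hw, ?_, fun P hP => ?_⟩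
  · ext P
    rw [poleDiv_apply, Finsupp.smul_apply]
    by_cases hP : D P = 0
    · have h2 := hD.valuation_le hw P
      rw [hP, exp_zero, one_pow] at h2
      rw [hP, smul_zero, max_eq_right_iff]
      by_cases hw0 : P.valuation w = 0
      · rw [hw0, log_zero]
      · rwa [log_le_iff_le_exp hw0, exp_zero]
    · rw [hval P (Finsupp.mem_support_iff.mpr hP), ← exp_nsmul, log_exp, max_eq_left]
      exact nsmul_nonneg (hD.nonneg P) e
  · rw [hval P (Finsupp.mem_support_iff.mpr hP), exp_nsmul]

end

end FunctionField1

/-! ### Forms versus Riemann–Roch spaces, and normality of the charts -/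

namespace FunctionField1

open IntermediateField WithZero MvPolynomial Module

variable {k F : Type*} [Field k] [Field F] [Algebra k F]

variable {σ : Type*} {y : σ → F}

/-- A common denominator for finitely many functions. -/
theorem exists_common_denominator
    (hfrac : ∀ f : F, ∃ m, ∃ a ∈ formValues k y m, ∃ b ∈ formValues k y m, b ≠ 0 ∧ f * b = a)
    {ι : Type*} [Fintype ι] (u : ι → F) :
    ∃ M, ∃ b : F, b ≠ 0 ∧ ∀ i, u i * b ∈ formValues k y M := by
  classical
  choose m a ha b hb hb0 hab using hfrac
  refine ⟨∑ i, m (u i), ∏ i, b (u i), Finset.prod_ne_zero_iff.mpr fun i _ => hb0 _, fun i => ?_⟩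
  rw [← Finset.mul_prod_erase _ _ (Finset.mem_univ i), ← mul_assoc, hab,
    ← Finset.add_sum_erase _ _ (Finset.mem_univ i)]
  exact mul_mem_formValues (ha _) (prod_mem_formValues _ _ _ fun j _ => hb _)

variable [IsFunctionField k F] {D : Divisor k F}

/-- The affine charts of the embedded curve are integrally closed. -/
def ChartsIntegrallyClosed (k : Type*) {F σ : Type*} [Field k] [Field F] [Algebra k F]
    (y : σ → F) : Prop :=
  ∀ j, y j ≠ 0 → ∀ f : F, IsIntegral (chart k y j) f → f ∈ chart k y j

/-- An integrally closed chart is an intersection of valuation rings. At a place containing the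
chart all y i / y j are regular, so y j has the maximal pole order D P, and dividing by y j ^ d
absorbs the poles of f. -/
theorem IsHyperplaneDivisor.div_pow_mem_chart (hD : IsHyperplaneDivisor y D)
    (hc : ChartsIntegrallyClosed k y) {j : σ} (hj : y j ≠ 0) {d : ℕ} {f : F}
    (hf : f ∈ riemannRochSpace (d • D)) : f / y j ^ d ∈ chart k y j := by
  by_contra hmem
  have hcl : IsIntegrallyClosedIn (chart k y j).toSubring F :=
    Subring.isIntegrallyClosedIn_iff.mpr fun {x} hx => hc j hj x hx
  obtain ⟨V, hV, hfV⟩ := Subring.exists_le_valuationSubring_of_isIntegrallyClosedIn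
    (R := (chart k y j).toSubring) hmem
  have hk : ∀ c : k, algebraMap k F c ∈ V := fun c => hV ((chart k y j).algebraMap_mem c)
  have htop : V ≠ ⊤ := fun h => hfV (h ▸ ValuationSubring.mem_top _)
  let P : Place k F := Place.ofValuationSubring V hk htop
  obtain ⟨i, hi⟩ := hD.eq P
  have hle : P.valuation (y i / y j) ≤ 1 :=
    (P.valuation_le_one_iff _).mpr (hV (Algebra.subset_adjoin ⟨i, rfl⟩))
  have hyj := P.valuation_ne_zero hj
  rw [map_div₀, hi, div_le_one₀ (zero_lt_iff.mpr hyj)] at hle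
  refine hfV ((P.valuation_le_one_iff _).mp ?_)
  rw [map_div₀, map_pow, div_le_one₀ (pow_pos (zero_lt_iff.mpr hyj) d)]
  have h2 := hf P
  rw [Finsupp.smul_apply, exp_nsmul] at h2
  exact h2.trans (pow_le_pow_left₀ zero_le hle d)

theorem IsHyperplaneDivisor.exists_mul_coord_pow_mem (hD : IsHyperplaneDivisor y D)
    (hc : ChartsIntegrallyClosed k y) {d : ℕ} {f : F} (hf : f ∈ riemannRochSpace (d • D)) (j : σ) :
    ∃ N, ∀ N' ≥ N, f * y j ^ N' ∈ formValues k y (N' + d) := by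
  by_cases hj : y j = 0
  · refine ⟨1, fun N' hN' => ?_⟩
    rw [hj, zero_pow (by omega), mul_zero]
    exact zero_mem _
  · obtain ⟨N, hN⟩ := exists_mul_pow_mem_formValues hj (hD.div_pow_mem_chart hc hj hf)
    refine ⟨N, fun N' hN' => ?_⟩
    have h2 := mul_mem_formValues hN (coord_pow_mem_formValues (k := k) j (N' - N + d))
    rw [show N + (N' - N + d) = N' + d by omega] at h2
    convert h2 using 1
    rw [show N' = N + (N' - N) by omega, pow_add]
    have : y j ^ d ≠ 0 := pow_ne_zero _ hj
    rw [show N + (N' - N) - N = N' - N by omega, pow_add]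
    field_simp

/-- The base point free pencil trick. -/
theorem IsHyperplaneDivisor.eventually_riemannRochSpace_le (hD : IsHyperplaneDivisor y D)
    (hδ : 0 < D.degree) {e : ℕ} {w : F}
    (hpole : poleDiv k w = e • D) (hw0 : w ≠ 0)
    (hval : ∀ P, D P ≠ 0 → P.valuation w = exp (e • D P)) :
    ∃ d₀, ∀ d ≥ d₀, riemannRochSpace ((d + e) • D) ≤
      riemannRochSpace (d • D) ⊔ (riemannRochSpace (d • D)).map (LinearMap.mulLeft k w) := by
  obtain ⟨d₁, hd₁⟩ := eventually_finrank_nsmul hδ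
  refine ⟨d₁ + e, fun d hd => ?_⟩
  have hinj : Function.Injective (LinearMap.mulLeft k w) := mul_right_injective₀ hw0
  set L := riemannRochSpace (d • D) with hL
  set L' := L.map (LinearMap.mulLeft k w) with hL'
  have hwle : ∀ P, P.valuation w ≤ exp (e • D P) := fun P => by
    have := valuation_le_exp_poleDiv (k := k) w P
    rwa [hpole, Finsupp.smul_apply] at this
  have hle : L ⊔ L' ≤ riemannRochSpace ((d + e) • D) := by
    refine sup_le (riemannRochSpace_mono (nsmul_le_nsmul_left hD.nonneg (by omega))) ?_
    rintro _ ⟨f, hf, rfl⟩ P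
    change P.valuation (w * f) ≤ _
    rw [map_mul, add_comm d e, add_smul, Finsupp.add_apply, exp_add]
    exact mul_le_mul' (hwle P) (hf P)
  -- If g and w g both lie in L(dD), then on the support of D, where w has a pole of order exactly e
  -- D P, g loses e D P. Thus dim (L + wL) ≥ 2 l(d) - l(d - e), which is l(d + e) because l is
  -- linear in large degrees.
  have hinf : L ⊓ L' ≤ (riemannRochSpace ((d - e) • D)).map (LinearMap.mulLeft k w) := by
    rintro _ ⟨hf, g, hg, rfl⟩
    refine ⟨g, fun P => ?_, rfl⟩
    by_cases hP : D P = 0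
    · have := hg P
      rw [Finsupp.smul_apply, hP, smul_zero] at this ⊢
      exact this
    · have := hf P
      change P.valuation (w * g) ≤ _ at this
      rw [map_mul, hval P hP, show d = e + (d - e) by omega, add_smul, Finsupp.add_apply,
        exp_add] at this
      exact le_of_mul_le_mul_left this (zero_lt_iff.mpr exp_ne_zero)
  have hL'fin : finrank k L' = finrank k L := 
    (Submodule.equivMapOfInjective _ hinj L).finrank_eq.symm
  have hinf' : finrank k ↥(L ⊓ L') ≤ finrank k (riemannRochSpace ((d - e) • D)) := by
    refine (Submodule.finrank_mono hinf).trans ?_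
    exact Submodule.finrank_map_le _ _
  have hsum := Submodule.finrank_sup_add_finrank_inf_eq L L'
  have e1 := hd₁ d (by omega)
  have e2 := hd₁ (d - e) (by omega)
  have e3 := hd₁ (d + e) (by omega)
  refine (Submodule.eq_of_le_of_finrank_le hle ?_).ge
  have e4 : ((d - e : ℕ) : ℤ) = d - e := by omega
  rw [e4] at e2
  have e5 : ((d + e : ℕ) : ℤ) = d + e := by push_cast; ring
  rw [e5] at e3
  have : (finrank k (riemannRochSpace ((d + e) • D)) : ℤ) ≤ finrank k ↥(L ⊔ L') := by
    have h6 : (finrank k ↥(L ⊔ L') : ℤ) = 2 * finrank k L - finrank k ↥(L ⊓ L') := by omega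
    have h7 : (finrank k ↥(L ⊓ L') : ℤ) ≤ finrank k (riemannRochSpace ((d - e) • D)) := by
      exact_mod_cast hinf'
    rw [e3, h6, e1]
    rw [e2] at h7
    linarith
  exact_mod_cast this

variable [Fintype σ]

/-- A function without poles is constant. -/
theorem isAlgebraic_of_mem_riemannRochSpace_zero {f : F}
    (hf : f ∈ riemannRochSpace (0 : Divisor k F)) : IsAlgebraic k f := by
  by_contra h
  obtain ⟨P, hP⟩ := Place.exists_valuation_lt_one (k := k) (f := f⁻¹) (by
    intro h'
    exact h (by simpa using h'.inv))
  have h1 : P.valuation f ≤ 1 := by simpa using hf P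
  have h0 : f ≠ 0 := fun h0 => h (h0 ▸ isAlgebraic_zero)
  rw [map_inv₀, inv_lt_one₀ (zero_lt_iff.mpr (P.valuation_ne_zero h0))] at hP
  exact absurd hP (not_lt.mpr h1)

/-- If D were 0, all form values would have no poles, hence be algebraic over k, and so would their
quotients, which fill F. -/
theorem IsHyperplaneDivisor.degree_pos (hD : IsHyperplaneDivisor y D)
    (hfrac : ∀ f : F, ∃ m, ∃ a ∈ formValues k y m, ∃ b ∈ formValues k y m, b ≠ 0 ∧ f * b = a) :
    0 < D.degree := by
  refine Divisor.degree_pos hD.nonneg fun h0 => ?_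
  obtain ⟨x, hx⟩ := IsFunctionField.exists_transcendental (k := k) (F := F)
  obtain ⟨m, a, ha, b, hb, hb0, hab⟩ := hfrac x
  have halg : ∀ c ∈ formValues k y m, IsAlgebraic k c := fun c hc => by
    refine isAlgebraic_of_mem_riemannRochSpace_zero ?_
    simpa [h0] using hD.formValues_le m hc
  refine hx ?_
  rw [eq_div_of_mul_eq hb0 hab, div_eq_mul_inv]
  exact (halg a ha).mul (halg b hb).inv

theorem IsHyperplaneDivisor.transcendental_pencil {e : ℕ} (he : 0 < e) (h0 : 0 < D.degree) {w : F}
    (hw : poleDiv k w = e • D) : Transcendental k w := by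
  have hne : D ≠ 0 := fun h => by simp [h, Divisor.degree_zero] at h0
  obtain ⟨P, hP⟩ := Finsupp.ne_iff.mp hne
  have hP' : poleDiv k w P ≠ 0 := by
    rw [hw, Finsupp.smul_apply]
    exact smul_ne_zero he.ne' hP
  rw [poleDiv_apply] at hP'
  refine P.transcendental_of_valuation_ne_one (fun h => ?_) fun h => ?_
  · simp [h] at hP'
  · simp [h] at hP'

/-- Multiply a basis of F over k(w) by a common denominator of degree M, then by powers of w. This
gives [F : k(w)] = eδ independent forms for each step of e in the degree. -/
theorem IsHyperplaneDivisor.exists_le_finrank (hD : IsHyperplaneDivisor y D) {i₀ : σ}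
    (h1 : y i₀ = 1)
    (hfrac : ∀ f : F, ∃ m, ∃ a ∈ formValues k y m, ∃ b ∈ formValues k y m, b ≠ 0 ∧ f * b = a) :
    ∃ C : ℤ, ∀ d : ℕ, D.degree * d - C ≤ finrank k (formValues k y d) := by
  have hδ := hD.degree_pos hfrac
  obtain ⟨e, he, w, hw, hpole, -⟩ := hD.exists_pencil i₀
  have hwt := IsHyperplaneDivisor.transcendental_pencil he hδ hpole
  have := IsFunctionField.finite_adjoin (k := k) w hwt
  have hdeg := degree_poleDiv hwt
  rw [hpole, Divisor.degree_nsmul] at hdeg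
  let u := Module.finBasis k⟮w⟯ F
  obtain ⟨M, b, hb0, hb⟩ := exists_common_denominator hfrac u
  have hu : LinearIndependent k⟮w⟯ fun i => u i * b := by
    have := u.linearIndependent.map' (LinearMap.mulRight k⟮w⟯ b)
      (LinearMap.ker_eq_bot.mpr (mul_left_injective₀ hb0))
    exact this
  -- M pays for the denominator, e for rounding in the division by e.
  refine ⟨D.degree * (M + e), fun d => ?_⟩
  by_cases hd : d < M
  · have h2 : D.degree * d ≤ D.degree * (M + e) :=
      mul_le_mul_of_nonneg_left (by exact_mod_cast (by omega : d ≤ M + e)) hδ.le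
    linarith [Int.natCast_nonneg (finrank k (formValues k y d))]
  set l := (d - M) / e with hl
  have hli := linearIndependent_mul_pow hwt hu l
  have hmem : ∀ p : Fin (finrank k⟮w⟯ F) × Fin l, u p.1 * b * w ^ (p.2 : ℕ) ∈ formValues k y d := by
    intro p
    refine formValues_mono h1 ?_ (mul_mem_formValues (hb p.1) (pow_mem_formValues hw p.2))
    have h2 : e * (p.2 : ℕ) ≤ e * l := Nat.mul_le_mul_left e p.2.2.le
    have h3 : e * l ≤ d - M := Nat.mul_div_le _ _
    omega
  have : FiniteDimensional k (formValues k y d) :=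
    Submodule.finiteDimensional_of_le (hD.formValues_le d)
  have hli' : LinearIndependent k fun p => (⟨_, hmem p⟩ : formValues k y d) :=
    LinearIndependent.of_comp (formValues k y d).subtype hli
  have hcard := hli'.fintype_card_le_finrank
  rw [Fintype.card_prod, Fintype.card_fin, Fintype.card_fin] at hcard
  have h3 : d ≤ M + e * l + e := by
    have := Nat.lt_mul_div_succ (d - M) he
    rw [mul_add, mul_one, ← hl] at this
    omega
  have h4 : D.degree * d ≤ D.degree * (M + e * l + e) :=
    mul_le_mul_of_nonneg_left (by exact_mod_cast h3) hδ.le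
  have h5 : ((finrank k⟮w⟯ F : ℕ) : ℤ) * l ≤ finrank k (formValues k y d) := by
    exact_mod_cast hcard
  rw [← hdeg] at h5
  linarith

/-- Sections of `d D` multiply forms of large degree into forms. -/
theorem IsHyperplaneDivisor.exists_mul_formValues_le (hD : IsHyperplaneDivisor y D)
    (hc : ChartsIntegrallyClosed k y) (i₀ : σ) (d : ℕ) :
    ∃ M, ∀ M' ≥ M, ∀ f ∈ riemannRochSpace (d • D), ∀ g ∈ formValues k y M',
      f * g ∈ formValues k y (M' + d) := by
  classical
  let b := Module.finBasis k (riemannRochSpace (d • D))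
  have hex := fun (i : Fin _) (j : σ) => hD.exists_mul_coord_pow_mem hc (b i).2 j
  choose N hN using hex
  let N₀ := ∑ i, ∑ j, N i j
  have hN₀ : ∀ i j, N i j ≤ N₀ := fun i j =>
    (Finset.single_le_sum (f := fun j => N i j) (fun _ _ => Nat.zero_le _) (Finset.mem_univ j)).trans
      (Finset.single_le_sum (f := fun i => ∑ j, N i j) (fun _ _ => Nat.zero_le _)
        (Finset.mem_univ i))
  have hgen : ∀ f ∈ riemannRochSpace (d • D), ∀ j, f * y j ^ N₀ ∈ formValues k y (N₀ + d) := by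
    intro f hf j
    have h2 : (⊤ : Submodule k (riemannRochSpace (d • D))) ≤
        ((formValues k y (N₀ + d)).comap (LinearMap.mulRight k (y j ^ N₀))).comap
          (riemannRochSpace (d • D)).subtype := by
      rw [← b.span_eq, Submodule.span_le]
      rintro _ ⟨i, rfl⟩
      exact hN i j N₀ (hN₀ i j)
    exact h2 (x := ⟨f, hf⟩) trivial
  refine ⟨Fintype.card σ * N₀, fun M' hM' f hf => ?_⟩
  refine (FunctionField1.formValues_le (T := (formValues k y (M' + d)).comap
    (LinearMap.mulLeft k f)) fun m hm => ?_)
  change f * _ ∈ formValues k y (M' + d)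
  have : Nonempty σ := ⟨i₀⟩
  -- Pigeonhole: a monomial of degree at least |σ| N₀ contains some y j ^ N₀, which already turns f
  -- into a form.
  obtain ⟨j, hj⟩ : ∃ j, N₀ ≤ m j := by
    by_contra! hlt
    have h3 : ∑ j, m j < ∑ _j : σ, N₀ :=
      Finset.sum_lt_sum_of_nonempty Finset.univ_nonempty fun j _ => hlt j
    rw [← Finsupp.degree_eq_sum, hm, Finset.sum_const, smul_eq_mul, Finset.card_univ] at h3
    omega
  let m' : σ →₀ ℕ := m - Finsupp.single j N₀
  have hmm : m = m' + Finsupp.single j N₀ :=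
    (tsub_add_cancel_of_le (Finsupp.single_le_iff.mpr hj)).symm
  have hdeg : m'.degree + N₀ = M' := by
    rw [← hm, hmm, map_add, Finsupp.degree_single]
  have hprod : f * ∏ i, y i ^ m i = (f * y j ^ N₀) * ∏ i, y i ^ m' i := by
    rw [hmm]
    simp_rw [Finsupp.add_apply, pow_add]
    have hsingle : ∏ i, y i ^ (Finsupp.single j N₀ i) = y j ^ N₀ := by
      rw [Finset.prod_eq_single j (fun i _ hi => by
        rw [Finsupp.single_eq_of_ne hi, pow_zero]) (by simp), Finsupp.single_eq_same]
    rw [Finset.prod_mul_distrib, hsingle]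
    ring
  rw [hprod, show M' + d = N₀ + d + m'.degree by omega]
  refine mul_mem_formValues (hgen f hf j) ?_
  rw [Finsupp.degree_eq_sum]
  exact prod_mem_formValues _ _ _ fun i _ => coord_pow_mem_formValues i _

/-- Iterating the pencil trick, L((d + qe)D) is spanned by the w ^ i L(dD) with i ≤ q. Only d in one
period d₁ ≤ d < d₁ + e is needed, and for these finitely many d forms of large degree carry L(dD)
into forms. -/
theorem IsHyperplaneDivisor.eventually_formValues_eq (hD : IsHyperplaneDivisor y D) {i₀ : σ}
    (h1 : y i₀ = 1) (hδ : 0 < D.degree) (hc : ChartsIntegrallyClosed k y) :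
    ∃ d₀, ∀ d ≥ d₀, formValues k y d = riemannRochSpace (d • D) := by
  obtain ⟨e, he, w, hw, hpole, hval⟩ := hD.exists_pencil i₀
  have hwt := IsHyperplaneDivisor.transcendental_pencil he hδ hpole
  have hw0 : w ≠ 0 := fun h => hwt (h ▸ isAlgebraic_zero)
  obtain ⟨d₁, hd₁⟩ := hD.eventually_riemannRochSpace_le hδ hpole hw0 hval
  choose M hM using hD.exists_mul_formValues_le hc i₀
  let M₀ := ∑ d ∈ Finset.range (d₁ + e), M d
  have key : ∀ d ≥ d₁, ∀ q : ℕ, ∀ T : Submodule k F,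
      (∀ f ∈ riemannRochSpace (d • D), ∀ i ≤ q, w ^ i * f ∈ T) →
      riemannRochSpace ((d + q * e) • D) ≤ T := by
    intro d hd q
    induction q with
    | zero =>
      intro T hT f hf
      simpa using hT f (by simpa using hf) 0 le_rfl
    | succ q ih =>
      intro T hT
      rw [add_mul, one_mul, ← add_assoc]
      refine (hd₁ _ (by omega)).trans (sup_le (ih T fun f hf i hi => hT f hf i (by omega)) ?_)
      rw [Submodule.map_le_iff_le_comap]
      refine ih _ fun f hf i hi => ?_
      change w * (w ^ i * f) ∈ T
      rw [← mul_assoc, ← pow_succ']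
      exact hT f hf _ (by omega)
  refine ⟨d₁ + e * (M₀ + 1), fun d hd => le_antisymm (hD.formValues_le d) ?_⟩
  set q := (d - d₁) / e with hq
  set r := (d - d₁) % e with hr
  have hdq : d = (d₁ + r) + q * e := by
    have := Nat.mod_add_div (d - d₁) e
    rw [mul_comm e, ← hq, ← hr] at this
    have : d₁ ≤ d := by nlinarith
    omega
  have hqM : M₀ ≤ q := by
    rw [hq, Nat.le_div_iff_mul_le he]
    have : e * (M₀ + 1) = M₀ * e + e := by ring
    omega
  have hrlt : r < e := Nat.mod_lt _ he
  have hMr : M (d₁ + r) ≤ M₀ :=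
    Finset.single_le_sum (f := M) (fun _ _ => Nat.zero_le _) (Finset.mem_range.mpr (by omega))
  conv_lhs => rw [hdq]
  refine key (d₁ + r) (by omega) q _ fun f hf i hi => ?_
  have hqe : M₀ ≤ q * e := hqM.trans (Nat.le_mul_of_pos_right q he)
  -- The power w ^ i has degree e i only; the coordinate 1 pads it to degree q e, large enough for
  -- multiplication by f.
  have := hM (d₁ + r) (q * e) (hMr.trans hqe) f hf (w ^ i)
    (formValues_mono h1 (by rw [mul_comm q]; exact Nat.mul_le_mul_left e hi)
      (pow_mem_formValues hw i))
  rw [hdq, mul_comm (w ^ i), add_comm (d₁ + r)]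
  exact this

/-- An f integral over the chart has poles only where y j is not maximal. There each factor y j
gains at least one order over D, so f y_j ^ m lies in L(mD) for large m and is a form. -/
theorem IsHyperplaneDivisor.chartsIntegrallyClosed (hD : IsHyperplaneDivisor y D)
    {d₀ : ℕ} (h : ∀ d ≥ d₀, formValues k y d = riemannRochSpace (d • D)) :
    ChartsIntegrallyClosed k y := by
  classical
  intro j hj f hf
  have hval : ∀ P : Place k F, P.valuation (y j) = exp (D P) → P.valuation f ≤ 1 := by
    intro P hP
    have hsub : chart k y j ≤ P.subalgebra := by
      refine Algebra.adjoin_le ?_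
      rintro _ ⟨i, rfl⟩
      refine Place.mem_subalgebra.mpr ?_
      rw [map_div₀, hP, div_le_one₀ (zero_lt_iff.mpr exp_ne_zero)]
      exact hD.le P i
    exact P.valuation_le_one_of_isIntegral hsub hf
  let m := d₀ + ∑ P ∈ (poleDiv k f).support, (poleDiv k f P).toNat
  have hm : ∀ P, poleDiv k f P ≤ m := by
    intro P
    by_cases hP : P ∈ (poleDiv k f).support
    · have := Finset.single_le_sum (f := fun P => (poleDiv k f P).toNat)
        (fun _ _ => Nat.zero_le _) hP
      have h3 := Int.self_le_toNat (poleDiv k f P)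
      simp only [m]
      push_cast
      have : ((poleDiv k f P).toNat : ℤ) ≤
        ∑ P ∈ (poleDiv k f).support, ((poleDiv k f P).toNat : ℤ) := by exact_mod_cast this
      omega
    · rw [Finsupp.notMem_support_iff.mp hP]
      omega
  have hmem : f * y j ^ m ∈ riemannRochSpace (m • D) := by
    intro P
    rw [Finsupp.smul_apply, exp_nsmul, map_mul, map_pow]
    by_cases hP : P.valuation (y j) = exp (D P)
    · rw [hP]
      exact mul_le_of_le_one_left' (hval P hP)
    · have hlt := Place.lt_exp_iff_le_exp.mp (lt_of_le_of_ne (hD.le P j) hP)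
      calc P.valuation f * P.valuation (y j) ^ m ≤ exp (m : ℤ) * exp (D P - 1) ^ m :=
            mul_le_mul' ((valuation_le_exp_poleDiv f P).trans (exp_le_exp.mpr (hm P)))
              (pow_le_pow_left₀ zero_le hlt m)
        _ = exp (D P) ^ m := by
            rw [← exp_nsmul, ← exp_nsmul, ← exp_add]
            congr 1
            simp only [nsmul_eq_mul]
            ring
  rw [← h m (by omega)] at hmem
  have := FunctionField1.div_pow_mem_chart (j := j) hmem
  rwa [mul_div_cancel_right₀ _ (pow_ne_zero m hj)] at this

/-- The Hilbert function of a projectively embedded curve, in terms of its degree `δ` and the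
geometric genus. -/
theorem exists_hilbert {i₀ : σ} (h1 : y i₀ = 1)
    (hfrac : ∀ f : F, ∃ m, ∃ a ∈ formValues k y m, ∃ b ∈ formValues k y m, b ≠ 0 ∧ f * b = a) :
    ∃ δ : ℤ, 0 < δ ∧
      (∃ C d₀, ∀ d ≥ d₀, δ * d - C ≤ finrank k (formValues k y d) ∧
        finrank k (formValues k y d) ≤ δ * d + 1 - genus k F) ∧
      (ChartsIntegrallyClosed k y ↔
        ∃ d₀, ∀ d ≥ d₀, (finrank k (formValues k y d) : ℤ) = δ * d + 1 - genus k F) := by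
  obtain ⟨D, hD⟩ := exists_isHyperplaneDivisor k h1
  have hδ := hD.degree_pos hfrac
  obtain ⟨C, hC⟩ := hD.exists_le_finrank h1 hfrac
  obtain ⟨d₀, hd₀⟩ := eventually_finrank_nsmul hδ
  refine ⟨D.degree, hδ, ⟨C, d₀, fun d hd => ⟨hC d, ?_⟩⟩, fun hc => ?_, fun ⟨d₁, hd₁⟩ => ?_⟩
  · rw [mul_comm, ← hd₀ d hd]
    exact_mod_cast Submodule.finrank_mono (hD.formValues_le d)
  · obtain ⟨d₁, hd₁⟩ := hD.eventually_formValues_eq h1 hδ hc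
    refine ⟨max d₀ d₁, fun d hd => ?_⟩
    rw [hd₁ d (le_of_max_le_right hd), hd₀ d (le_of_max_le_left hd), mul_comm]
  · refine hD.chartsIntegrallyClosed (d₀ := max d₀ d₁) fun d hd => ?_
    refine Submodule.eq_of_le_of_finrank_eq (hD.formValues_le d) ?_
    have e1 := hd₀ d (le_of_max_le_left hd)
    have e2 := hd₁ d (le_of_max_le_right hd)
    rw [mul_comm, ← e2] at e1
    exact_mod_cast e1.symm

end FunctionField1

/-! ### Homogeneous ideals and their affine charts -/

namespace ProjectiveModel

open MvPolynomial

variable {A σ : Type*} [CommRing A]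

/-- Every polynomial becomes homogeneous modulo `X j - 1`. -/
theorem exists_homogenization (j : σ) (f : MvPolynomial σ A) :
    ∃ d h, h.IsHomogeneous d ∧ f - h ∈ Ideal.span {X j - 1} := by
  let d := f.totalDegree
  refine ⟨d, ∑ i ∈ Finset.range (d + 1), X j ^ (d - i) * homogeneousComponent i f, ?_, ?_⟩
  · refine IsHomogeneous.sum _ _ _ fun i hi => ?_
    have h1 := (isHomogeneous_X_pow (R := A) j (d - i)).mul (homogeneousComponent_isHomogeneous i f)
    rwa [Nat.sub_add_cancel (Nat.lt_succ_iff.mp (Finset.mem_range.mp hi))] at h1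
  · have h2 : f = ∑ i ∈ Finset.range (d + 1), homogeneousComponent i f :=
      (sum_homogeneousComponent f).symm
    nth_rw 1 [h2]
    rw [← Finset.sum_sub_distrib]
    refine sum_mem fun i _ => ?_
    have h3 : homogeneousComponent i f - X j ^ (d - i) * homogeneousComponent i f =
        -(homogeneousComponent i f * (X j ^ (d - i) - 1)) := by ring
    rw [h3]
    exact neg_mem (Ideal.mul_mem_left _ _
      (Ideal.mem_span_singleton.mpr (sub_one_dvd_pow_sub_one (X j) (d - i))))

variable (I : Ideal (MvPolynomial σ A))

/-- The ideal of the affine chart `X j ≠ 0` of the projective scheme defined by `I`. -/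
noncomputable def chartIdeal (j : σ) : Ideal (MvPolynomial σ A) := I ⊔ Ideal.span {X j - 1}

variable {I} in
-- Homogenizing modulo X j - 1 reduces the kernel to forms, and modulo X j - 1 a power of X j can be
-- dropped.
theorem mem_chartIdeal_of_map_eq_zero {B : Type*} [CommRing B] {φ : MvPolynomial σ A →+* B} {j : σ}
    (hj : φ (X j) = 1)
    (hφ : ∀ d g, g.IsHomogeneous d → φ g = 0 → ∃ N : ℕ, X j ^ N * g ∈ I)
    {f : MvPolynomial σ A} (hf : φ f = 0) : f ∈ chartIdeal I j := by
  obtain ⟨d, h, hh, hfh⟩ := exists_homogenization j f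
  have hker : Ideal.span {X j - 1} ≤ RingHom.ker φ := by
    rw [Ideal.span_singleton_le_iff_mem, RingHom.mem_ker, map_sub, hj, map_one, sub_self]
  have h0 : φ h = 0 := by
    have := hker hfh
    rwa [RingHom.mem_ker, map_sub, hf, zero_sub, neg_eq_zero] at this
  obtain ⟨N, hN⟩ := hφ d h hh h0
  have h1 : X j ^ N * h - h ∈ Ideal.span {X j - 1} := by
    rw [← sub_one_mul]
    exact Ideal.mul_mem_right _ _
      (Ideal.mem_span_singleton.mpr (sub_one_dvd_pow_sub_one (X j) N))
  have h2 : f = X j ^ N * h + ((f - h) - (X j ^ N * h - h)) := by ring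
  rw [h2]
  exact add_mem (Ideal.mem_sup_left hN) (Ideal.mem_sup_right (sub_mem hfh h1))

/-- The saturation of `I` with respect to the variables. -/
noncomputable def saturation : Ideal (MvPolynomial σ A) where
  carrier := {g | ∀ j, ∃ N, X j ^ N * g ∈ I}
  zero_mem' j := ⟨0, by simp⟩
  add_mem' {f g} hf hg j := by
    obtain ⟨N, hN⟩ := hf j
    obtain ⟨M, hM⟩ := hg j
    refine ⟨N + M, ?_⟩
    have : X j ^ (N + M) * (f + g) = X j ^ M * (X j ^ N * f) + X j ^ N * (X j ^ M * g) := by ring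
    rw [this]
    exact add_mem (I.mul_mem_left _ hN) (I.mul_mem_left _ hM)
  smul_mem' c g hg j := by
    obtain ⟨N, hN⟩ := hg j
    refine ⟨N, ?_⟩
    rw [smul_eq_mul, mul_left_comm]
    exact I.mul_mem_left _ hN

variable {I} in
theorem mem_saturation {g : MvPolynomial σ A} :
    g ∈ saturation I ↔ ∀ j, ∃ N, X j ^ N * g ∈ I := Iff.rfl

theorem X_pow_dvd_monomial {j : σ} {N : ℕ} {m : σ →₀ ℕ} (h : N ≤ m j) (c : A) :
    (X j ^ N : MvPolynomial σ A) ∣ monomial m c := by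
  refine ⟨monomial (m - Finsupp.single j N) c, ?_⟩
  rw [X_pow_eq_monomial, monomial_mul, one_mul,
    add_tsub_cancel_of_le (Finsupp.single_le_iff.mpr h)]

theorem coe_decompose (d : ℕ) (f : MvPolynomial σ A) :
    (DirectSum.decompose (homogeneousSubmodule σ A) f d : MvPolynomial σ A) =
      homogeneousComponent d f :=
  decomposition.decompose'_apply f d

/-- In large degrees a homogeneous ideal agrees with its saturation. -/
theorem eventually_mem_of_mem_saturation [IsNoetherianRing A] [Finite σ]
    (hI : I.IsHomogeneous (homogeneousSubmodule σ A)) :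
    ∃ d₀, ∀ d ≥ d₀, ∀ g : MvPolynomial σ A, g.IsHomogeneous d → g ∈ saturation I → g ∈ I := by
  classical
  have := Fintype.ofFinite σ
  obtain ⟨s, hs⟩ := (isNoetherianRing_iff_ideal_fg _).mp inferInstance (saturation I)
  have hsK : ∀ g : s, g.1 ∈ saturation I := fun g => hs ▸ Ideal.subset_span g.2
  choose N hN using fun (g : s) (j : σ) => mem_saturation.mp (hsK g) j
  let N₀ := ∑ g, ∑ j, N g j
  have hN₀ : ∀ g j, N g j ≤ N₀ := fun g j =>
    (Finset.single_le_sum (f := fun j => N g j) (fun _ _ => Nat.zero_le _) (Finset.mem_univ j)).trans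
      (Finset.single_le_sum (f := fun g => ∑ j, N g j) (fun _ _ => Nat.zero_le _)
        (Finset.mem_univ g))
  have hmul : ∀ g ∈ s, ∀ j, X j ^ N₀ * g ∈ I := by
    intro g hg j
    rw [← Nat.sub_add_cancel (hN₀ ⟨g, hg⟩ j), pow_add, mul_assoc]
    exact I.mul_mem_left _ (hN ⟨g, hg⟩ j)
  let M := Fintype.card σ * N₀
  -- Monomials of degree above M carry every generator of the saturation into I. So coefficients may
  -- be truncated at degree M, and in degree d > M + E the truncated combination has no component.
  have hlow : ∀ h : MvPolynomial σ A, ∃ l : MvPolynomial σ A, l.totalDegree ≤ M ∧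
      ∀ g ∈ s, (h - l) * g ∈ I := by
    intro h
    induction h using MvPolynomial.induction_on' with
    | monomial m c =>
      by_cases hm : m.degree ≤ M
      · refine ⟨monomial m c, (totalDegree_monomial_le m c).trans ?_, by simp⟩
        exact hm
      · refine ⟨0, by simp, fun g hg => ?_⟩
        obtain ⟨j, hj⟩ : ∃ j, N₀ ≤ m j := by
          by_contra! hlt
          refine hm ?_
          rw [Finsupp.degree_eq_sum]
          calc ∑ j, m j ≤ ∑ _j : σ, N₀ := Finset.sum_le_sum fun j _ => (hlt j).le
            _ = M := by simp [M]
        obtain ⟨q, hq⟩ := X_pow_dvd_monomial hj c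
        rw [sub_zero, hq, mul_right_comm]
        exact I.mul_mem_right _ (hmul g hg j)
    | add p q hp hq =>
      obtain ⟨l, hl, hl'⟩ := hp
      obtain ⟨l₂, hl₂, hl₂'⟩ := hq
      refine ⟨l + l₂, (totalDegree_add _ _).trans (max_le hl hl₂), fun g hg => ?_⟩
      rw [add_sub_add_comm, add_mul]
      exact add_mem (hl' g hg) (hl₂' g hg)
  choose l hl hlI using hlow
  let E := ∑ g ∈ s, g.totalDegree
  refine ⟨M + E + 1, fun d hd g hgd hg => ?_⟩
  rw [← hs, ← Ideal.submodule_span_eq, Submodule.mem_span_finset] at hg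
  obtain ⟨c, -, hc⟩ := hg
  have h1 : g - ∑ a ∈ s, l (c a) * a ∈ I := by
    rw [← hc, ← Finset.sum_sub_distrib]
    refine sum_mem fun a ha => ?_
    rw [smul_eq_mul, ← sub_mul]
    exact hlI (c a) a ha
  have h2 := hI d h1
  rw [coe_decompose, map_sub, homogeneousComponent_of_mem hgd, if_pos rfl, map_sum,
    Finset.sum_eq_zero, sub_zero] at h2
  · exact h2
  · intro a ha
    refine homogeneousComponent_eq_zero _ _ (lt_of_le_of_lt (totalDegree_mul _ _) ?_)
    have h3 := hl (c a)
    have h4 : a.totalDegree ≤ E :=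
      Finset.single_le_sum (f := fun g => g.totalDegree) (fun _ _ => Nat.zero_le _) ha
    omega

end ProjectiveModel

/-! ### Generic points and the coordinate rings of their charts -/

namespace FunctionField1

open MvPolynomial ProjectiveModel

variable {k F σ : Type*} [Field k] [Field F] [Algebra k F]

/-- `y` is the generic point, in projective coordinates, of the integral projective scheme over `k`
defined by the ideal `I`, and `F` is its function field. -/
structure IsGenericPoint (I : Ideal (MvPolynomial σ k)) (y : σ → F) : Prop where
  exists_eq_one : ∃ i, y i = 1
  exists_fraction : ∀ f : F, ∃ m, ∃ a ∈ formValues k y m, ∃ b ∈ formValues k y m, b ≠ 0 ∧ f * b = a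
  aeval_eq_zero_iff : ∀ d (g : MvPolynomial σ k), g.IsHomogeneous d →
    (aeval y g = 0 ↔ g ∈ saturation I)

theorem aeval_div (y : σ → F) (j : σ) {d : ℕ} {g : MvPolynomial σ k} (hg : g.IsHomogeneous d) :
    aeval (fun i => y i / y j) g = aeval y g / y j ^ d := by
  rw [aeval_def, aeval_def, eval₂_eq, eval₂_eq, Finset.sum_div]
  refine Finset.sum_congr rfl fun m hm => ?_
  rw [mul_div_assoc]
  congr 1
  have hd : m.degree = d := by
    rw [Finsupp.degree_eq_weight_one]
    exact hg (mem_support_iff.mp hm)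
  rw [← hd, Finsupp.degree_apply, ← Finset.prod_pow_eq_pow_sum, ← Finset.prod_div_distrib]
  simp_rw [div_pow]

variable {I : Ideal (MvPolynomial σ k)} {y : σ → F}

theorem IsGenericPoint.ker_aeval_div (h : IsGenericPoint I y) (hI : I.IsHomogeneous
    (homogeneousSubmodule σ k)) {j : σ} (hj : y j ≠ 0) :
    RingHom.ker (aeval (R := k) fun i => y i / y j) = chartIdeal I j := by
  have hj1 : aeval (R := k) (fun i => y i / y j) (X j) = 1 := by rw [aeval_X, div_self hj]
  refine le_antisymm (fun f hf => ?_) (sup_le (fun f hf => ?_) ?_)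
  · refine mem_chartIdeal_of_map_eq_zero (φ := (aeval (R := k) fun i => y i / y j).toRingHom)
      hj1 (fun d g hg hg0 => ?_) hf
    change aeval _ g = 0 at hg0
    rw [aeval_div y j hg, div_eq_zero_iff, or_iff_left (pow_ne_zero _ hj),
      h.aeval_eq_zero_iff d g hg] at hg0
    exact hg0 j
  · rw [RingHom.mem_ker, ← sum_homogeneousComponent f, map_sum]
    refine Finset.sum_eq_zero fun d _ => ?_
    have hd := homogeneousComponent_isHomogeneous d f
    rw [aeval_div y j hd, (h.aeval_eq_zero_iff d _ hd).mpr, zero_div]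
    intro i
    refine ⟨0, ?_⟩
    rw [pow_zero, one_mul, ← coe_decompose]
    exact hI d hf
  · rw [Ideal.span_singleton_le_iff_mem, RingHom.mem_ker, map_sub, hj1, map_one, sub_self]

/-- The coordinate ring of a chart of an integral projective scheme, as a subring of the
function field. -/
noncomputable def IsGenericPoint.chartEquiv (h : IsGenericPoint I y) (hI : I.IsHomogeneous
    (homogeneousSubmodule σ k)) {j : σ} (hj : y j ≠ 0) :
    (MvPolynomial σ k ⧸ chartIdeal I j) ≃ₐ[k] chart k y j :=
  (Ideal.quotientEquivAlgOfEq k (h.ker_aeval_div hI hj).symm).trans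
    ((Ideal.quotientKerEquivRange (aeval (R := k) fun i => y i / y j)).trans
      (Subalgebra.equivOfEq _ _ (Algebra.adjoin_range_eq_range_aeval k _).symm))

/-- The coordinate X j then lies in the saturation, so a power of X j is in I; that power is 1 on
the chart, which is therefore empty. -/
theorem IsGenericPoint.chartIdeal_eq_top (h : IsGenericPoint I y) {j : σ} (hj : y j = 0) :
    chartIdeal I j = ⊤ := by
  have h1 := (h.aeval_eq_zero_iff 1 (X j) (isHomogeneous_X k j)).mp (by rw [aeval_X, hj])
  obtain ⟨N, hN⟩ := h1 j
  rw [← pow_succ] at hN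
  rw [Ideal.eq_top_iff_one]
  have h2 : (1 : MvPolynomial σ k) = X j ^ (N + 1) - (X j ^ (N + 1) - 1) := by ring
  rw [h2]
  exact sub_mem (Ideal.mem_sup_left hN) (Ideal.mem_sup_right
    (Ideal.mem_span_singleton.mpr (sub_one_dvd_pow_sub_one (X j) _)))

end FunctionField1

/-! ### Comparison of Hilbert functions over a discrete valuation ring -/

namespace ProjectiveModel

open MvPolynomial Module

section LinearAlgebra

variable {A : Type*} [CommRing A]
  {K κ : Type*} [Field K] [Algebra A K] [IsFractionRing A K] [Field κ] [Algebra A κ]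

theorem finrank_span_of_fractionRing (K : Type*) [Field K] [Algebra A K] [IsFractionRing A K]
    {V : Type*} [AddCommGroup V] [Module K V] [Module A V]
    [IsScalarTower A K V] {r : ℕ} {Q : Submodule A V} (b : Basis (Fin r) A Q) :
    finrank K (Submodule.span K (Q : Set V)) = r := by
  have hli : LinearIndependent A fun i => (b i : V) :=
    b.linearIndependent.map' Q.subtype (Submodule.ker_subtype Q)
  have hli' : LinearIndependent K fun i => (b i : V) :=
    (LinearIndependent.iff_fractionRing A K).mp hli
  have hspan : Submodule.span K (Q : Set V) = Submodule.span K (Set.range fun i => (b i : V)) := by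
    refine le_antisymm (Submodule.span_le.mpr fun q hq => ?_) (Submodule.span_mono ?_)
    · have h1 := congrArg Subtype.val (b.sum_repr ⟨q, hq⟩)
      rw [← show _ = q from h1, Submodule.coe_sum]
      refine sum_mem fun i _ => ?_
      rw [Submodule.coe_smul, ← algebraMap_smul K]
      exact Submodule.smul_mem _ _ (Submodule.subset_span ⟨i, rfl⟩)
    · rintro _ ⟨i, rfl⟩
      exact (b i).2
  rw [hspan, finrank_span_eq_card hli', Fintype.card_fin]

variable [IsDomain A] [IsPrincipalIdealRing A]

/-- The dimensions of the generic and of the special fibre of a finite module. -/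
theorem finrank_generic_add {π : A} (hsurj : Function.Surjective (algebraMap A κ))
    (hker : ∀ a : A, algebraMap A κ a = 0 ↔ π ∣ a)
    {M V₁ V₂ : Type*} [AddCommGroup M] [Module A M] [Module.Finite A M]
    [AddCommGroup V₁] [Module A V₁] [Module K V₁] [IsScalarTower A K V₁]
    [AddCommGroup V₂] [Module A V₂] [Module κ V₂] [IsScalarTower A κ V₂]
    (e₁ : M →ₗ[A] V₁) (e₂ : M →ₗ[A] V₂)
    (h : ∀ m, e₂ m = 0 → ∃ u m', e₁ u = 0 ∧ m = u + π • m') :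
    finrank K (Submodule.span K (Set.range e₁)) +
      finrank κ (Submodule.span κ (e₂ '' {u | e₁ u = 0})) =
      finrank κ (Submodule.span κ (Set.range e₂)) := by
  have : Module.IsTorsionFree A V₁ := Module.IsTorsionFree.trans_faithfulSMul A K V₁
  let b := Module.finBasis A (LinearMap.range e₁)
  have hr : finrank K (Submodule.span K (Set.range e₁)) = finrank A (LinearMap.range e₁) := by
    rw [← LinearMap.coe_range]
    exact finrank_span_of_fractionRing K b
  choose m hm using fun i => (b i).2
  set W := Submodule.span κ (Set.range e₂) with hW
  set W' := Submodule.span κ (e₂ '' {u | e₁ u = 0}) with hW'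
  have hW'W : W' ≤ W := Submodule.span_mono (Set.image_subset_range _ _)
  have himg : ∀ w ∈ W', ∃ u, e₁ u = 0 ∧ e₂ u = w := by
    intro w hw
    induction hw using Submodule.span_induction with
    | mem w hw => obtain ⟨u, hu, rfl⟩ := hw; exact ⟨u, hu, rfl⟩
    | zero => exact ⟨0, map_zero _, map_zero _⟩
    | add x y _ _ hx hy =>
      obtain ⟨u, hu, rfl⟩ := hx
      obtain ⟨v, hv, rfl⟩ := hy
      exact ⟨u + v, by rw [map_add, hu, hv, add_zero], map_add _ _ _⟩
    | smul c x _ hx =>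
      obtain ⟨u, hu, rfl⟩ := hx
      obtain ⟨a, rfl⟩ := hsurj c
      exact ⟨a • u, by rw [map_smul, hu, smul_zero], by rw [map_smul, algebraMap_smul]⟩
  -- Lifts of an A-basis of the image of e₁ stay independent modulo the reduced torsion. A relation
  -- over κ lifts to an element of ker e₂, thus to torsion plus a multiple of π; applying e₁ shows
  -- that π divides all coefficients.
  have hli : LinearIndependent κ fun i => W'.mkQ (e₂ (m i)) := by
    rw [Fintype.linearIndependent_iff]
    intro c hc
    choose a ha using fun i => hsurj (c i)
    have h1 : ∑ i, c i • e₂ (m i) ∈ W' := by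
      rw [← Submodule.ker_mkQ W', LinearMap.mem_ker, map_sum]
      simpa using hc
    obtain ⟨u, hu, hu'⟩ := himg _ h1
    obtain ⟨u', m', hu'0, hm'⟩ := h (∑ i, a i • m i - u) (by
      rw [map_sub, hu', map_sum, sub_eq_zero]
      refine Finset.sum_congr rfl fun i _ => ?_
      rw [map_smul, ← ha, algebraMap_smul])
    have h2 : ∑ i, a i • b i = π • (⟨e₁ m', ⟨m', rfl⟩⟩ : LinearMap.range e₁) := by
      refine Subtype.ext ?_
      have h3 := congrArg e₁ hm'
      rw [map_sub, map_sum, map_add, hu, hu'0, sub_zero, zero_add, map_smul] at h3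
      rw [Submodule.coe_sum, Submodule.coe_smul, ← h3]
      refine Finset.sum_congr rfl fun i _ => ?_
      rw [Submodule.coe_smul, map_smul, hm]
    intro i
    have h4 := congrArg (fun q => b.repr q i) h2
    simp only [b.repr_sum_self, map_smul, Finsupp.smul_apply, smul_eq_mul] at h4
    rw [← ha, hker, h4]
    exact dvd_mul_right _ _
  have hspan : W.map W'.mkQ = Submodule.span κ (Set.range fun i => W'.mkQ (e₂ (m i))) := by
    refine le_antisymm ?_ (Submodule.span_le.mpr ?_)
    · rw [hW, Submodule.map_span, Submodule.span_le]
      rintro _ ⟨_, ⟨x, rfl⟩, rfl⟩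
      have h1 := congrArg Subtype.val (b.sum_repr ⟨e₁ x, ⟨x, rfl⟩⟩)
      have h2 : e₁ (x - ∑ i, b.repr ⟨e₁ x, ⟨x, rfl⟩⟩ i • m i) = 0 := by
        rw [map_sub, map_sum, sub_eq_zero]
        refine Eq.trans (show _ = e₁ x from h1).symm ?_
        rw [Submodule.coe_sum]
        refine Finset.sum_congr rfl fun i _ => ?_
        rw [Submodule.coe_smul, map_smul, hm]
      have h3 : W'.mkQ (e₂ (x - ∑ i, b.repr ⟨e₁ x, ⟨x, rfl⟩⟩ i • m i)) = 0 := by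
        rw [← LinearMap.mem_ker, Submodule.ker_mkQ]
        exact Submodule.subset_span ⟨_, h2, rfl⟩
      rw [map_sub, map_sub, sub_eq_zero] at h3
      rw [h3, map_sum, map_sum]
      refine sum_mem fun i _ => ?_
      rw [map_smul, ← algebraMap_smul κ, map_smul]
      exact Submodule.smul_mem _ _ (Submodule.subset_span ⟨i, rfl⟩)
    · rintro _ ⟨i, rfl⟩
      exact Submodule.mem_map_of_mem (Submodule.subset_span ⟨m i, rfl⟩)
  have hWfin : FiniteDimensional κ W := by
    obtain ⟨s, hs⟩ := Module.Finite.fg_top (R := A) (M := M)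
    have := FiniteDimensional.span_of_finite κ (s.finite_toSet.image e₂)
    refine Submodule.finiteDimensional_of_le
      (S₂ := Submodule.span κ (e₂ '' s)) (Submodule.span_le.mpr ?_)
    rintro _ ⟨x, rfl⟩
    have hx : x ∈ Submodule.span A (s : Set M) := hs ▸ Submodule.mem_top
    induction hx using Submodule.span_induction with
    | mem x hx => exact Submodule.subset_span ⟨x, hx, rfl⟩
    | zero => rw [map_zero]; exact zero_mem _
    | add x y _ _ hx hy => rw [map_add]; exact add_mem hx hy
    | smul a x _ hx =>
      rw [map_smul, ← algebraMap_smul κ]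
      exact Submodule.smul_mem _ _ hx
  have h5 := LinearMap.finrank_range_add_finrank_ker (W'.mkQ.domRestrict W)
  rw [LinearMap.range_domRestrict, hspan, finrank_span_eq_card hli, Fintype.card_fin] at h5
  have h6 : finrank κ (LinearMap.ker (W'.mkQ.domRestrict W)) = finrank κ W' := by
    rw [LinearMap.ker_domRestrict, Submodule.ker_mkQ]
    exact (Submodule.submoduleOfEquivOfLe hW'W).finrank_eq
  rw [h6] at h5
  rw [hr, h5]

end LinearAlgebra

section

variable {A σ : Type*} [CommRing A]

theorem map_fractionRing_mem_iff {K : Type*} [Field K] [Algebra A K] [IsFractionRing A K]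
    (I : Ideal (MvPolynomial σ A)) (f : MvPolynomial σ A) :
    map (algebraMap A K) f ∈ I.map (map (algebraMap A K)) ↔ ∃ a ∈ nonZeroDivisors A, C a * f ∈ I := by
  let := algebraMvPolynomial (σ := σ) (R := A) (S := K)
  have h := IsLocalization.algebraMap_mem_map_algebraMap_iff
    ((nonZeroDivisors A).map (C (σ := σ))) (MvPolynomial σ K) I f
  rw [algebraMap_def] at h
  rw [h]
  constructor
  · rintro ⟨_, ⟨a, ha, rfl⟩, hf⟩
    exact ⟨a, ha, hf⟩
  · rintro ⟨a, ha, hf⟩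
    exact ⟨_, ⟨a, ha, rfl⟩, hf⟩

/-- The torsion of a finitely generated algebra over a discrete valuation ring is bounded. -/
theorem exists_pow_mul_mem {K : Type*} [Field K] [Algebra A K] [IsFractionRing A K] [IsDomain A]
    [IsDiscreteValuationRing A] [Finite σ] {π : A} (hπ : Irreducible π)
    (I : Ideal (MvPolynomial σ A)) :
    ∃ N, ∀ f, map (algebraMap A K) f ∈ I.map (map (algebraMap A K)) → C (π ^ N) * f ∈ I := by
  classical
  let T := (I.map (map (algebraMap A K))).comap (map (algebraMap A K))
  obtain ⟨s, hs⟩ := (isNoetherianRing_iff_ideal_fg _).mp inferInstance T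
  have hsT : ∀ g : s, g.1 ∈ T := fun g => hs ▸ Ideal.subset_span g.2
  choose a ha haI using fun g : s => (map_fractionRing_mem_iff I g.1).mp (hsT g)
  have ha0 : ∏ g, a g ≠ 0 := Finset.prod_ne_zero_iff.mpr fun g _ => nonZeroDivisors.ne_zero (ha g)
  obtain ⟨N, hN⟩ := IsDiscreteValuationRing.associated_pow_irreducible ha0 hπ
  refine ⟨N, fun f hf => ?_⟩
  -- T is finitely generated, so one power of π, associated to the product of denominators for its
  -- generators, works throughout.
  have hle : T ≤ I.colon {C (π ^ N)} := by
    rw [← hs, Ideal.span_le]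
    intro g hg
    rw [SetLike.mem_coe, Submodule.mem_colon_singleton, smul_eq_mul]
    obtain ⟨c, hc⟩ := (Finset.dvd_prod_of_mem a (Finset.mem_univ ⟨g, hg⟩)).trans hN.dvd
    rw [hc, C_mul]
    have : g * (C (a ⟨g, hg⟩) * C c) = C c * (C (a ⟨g, hg⟩) * g) := by ring
    rw [this]
    exact I.mul_mem_left _ (haI ⟨g, hg⟩)
  have := Submodule.mem_colon_singleton.mp (hle (show f ∈ T from hf))
  rwa [smul_eq_mul, mul_comm] at this

/-- The kernel of reduction is generated by π, so f lies in I + (π); taking degree d components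
keeps this decomposition homogeneous. -/
theorem exists_of_map_residue_mem {κ : Type*} [CommRing κ] [Algebra A κ] {π : A}
    (hsurj : Function.Surjective (algebraMap A κ)) (hker : ∀ a : A, algebraMap A κ a = 0 ↔ π ∣ a)
    {I : Ideal (MvPolynomial σ A)} (hI : I.IsHomogeneous (homogeneousSubmodule σ A))
    {d : ℕ} {f : MvPolynomial σ A} (hf : f.IsHomogeneous d)
    (h : map (algebraMap A κ) f ∈ I.map (map (algebraMap A κ))) :
    ∃ u ∈ I, u.IsHomogeneous d ∧ ∃ s : MvPolynomial σ A, s.IsHomogeneous d ∧ f = u + C π * s := by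
  have hker' : RingHom.ker (map (σ := σ) (algebraMap A κ)) = Ideal.span {C π} := by
    rw [ker_map, show RingHom.ker (algebraMap A κ) = Ideal.span {π} from
      Ideal.ext fun a => by rw [RingHom.mem_ker, hker, Ideal.mem_span_singleton], Ideal.map_span,
      Set.image_singleton]
  have h1 : f ∈ I ⊔ Ideal.span {C π} := by
    rw [← hker', ← Ideal.comap_map_of_surjective' _ (map_surjective _ hsurj)]
    exact h
  obtain ⟨u, hu, v, hv, rfl⟩ := Submodule.mem_sup.mp h1
  obtain ⟨s, rfl⟩ := Ideal.mem_span_singleton.mp hv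
  refine ⟨homogeneousComponent d u, ?_, homogeneousComponent_isHomogeneous d u,
    homogeneousComponent d s, homogeneousComponent_isHomogeneous d s, ?_⟩
  · rw [← coe_decompose]
    exact hI d hu
  · have := homogeneousComponent_of_mem (m := d) hf
    rw [if_pos rfl, map_add, homogeneousComponent_C_mul] at this
    exact this.symm

end

end ProjectiveModel

/-! ### Flatness of the model and normality of the special fibre -/

namespace FunctionField1

open MvPolynomial ProjectiveModel Module

variable {A σ : Type*} [CommRing A] [Fintype σ]

/-- Recovers the degree from Hilbert function bounds that differ only by a constant, before
normality of the special fibre is known. -/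
theorem eq_of_linear_bounds {a b c : ℤ} {n : ℕ}
    (h : ∀ d ≥ n, b * (d : ℤ) ≤ a * d + c ∧ a * (d : ℤ) ≤ b * d) : a = b := by
  refine le_antisymm ?_ ?_
  · have h1 := (h (n + 1) (by omega)).2
    exact le_of_mul_le_mul_right h1 (by positivity)
  · by_contra! hlt
    have h1 := (h (n + c.toNat + 1) (by omega)).1
    have h2 := Int.self_le_toNat c
    have h3 : (a + 1) * ((n + c.toNat + 1 : ℕ) : ℤ) ≤ b * ((n + c.toNat + 1 : ℕ) : ℤ) :=
      mul_le_mul_of_nonneg_right hlt (by positivity)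
    rw [add_mul, one_mul] at h3
    have h4 : ((n + c.toNat + 1 : ℕ) : ℤ) = n + c.toNat + 1 := by push_cast; ring
    linarith [Int.natCast_nonneg n]

theorem span_range_aeval {k F : Type*} [Field k] [Algebra A k] [Field F] [Algebra k F]
    [Algebra A F] [IsScalarTower A k F] (y : σ → F) (d : ℕ) :
    Submodule.span k (Set.range ((aeval (R := A) y).toLinearMap.comp
      (homogeneousSubmodule σ A d).subtype)) = formValues k y d := by
  refine le_antisymm (Submodule.span_le.mpr ?_) (formValues_le fun m hm => ?_)
  · rintro _ ⟨⟨f, hf⟩, rfl⟩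
    exact mem_formValues.mpr ⟨map (algebraMap A k) f, IsHomogeneous.map hf _,
      aeval_map_algebraMap k y f⟩
  · refine Submodule.subset_span ⟨⟨monomial m 1, ?_⟩, ?_⟩
    · exact isHomogeneous_monomial 1 hm
    · change aeval y (monomial m 1) = _
      rw [aeval_monomial, map_one, one_mul, Finsupp.prod_fintype _ _ fun _ => pow_zero _]

theorem IsGenericPoint.eventually_aeval_map_eq_zero_iff {k F : Type*} [Field k] [Algebra A k]
    [Field F] [Algebra k F] [Algebra A F] [IsScalarTower A k F] {I : Ideal (MvPolynomial σ A)} {y : σ → F}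
    (hI : (I.map (map (algebraMap A k))).IsHomogeneous (homogeneousSubmodule σ k))
    (h : IsGenericPoint (I.map (map (algebraMap A k))) y) :
    ∃ d₀, ∀ d ≥ d₀, ∀ f : MvPolynomial σ A, f.IsHomogeneous d →
      (aeval y f = 0 ↔ map (algebraMap A k) f ∈ I.map (map (algebraMap A k))) := by
  obtain ⟨d₀, hd₀⟩ := eventually_mem_of_mem_saturation _ hI
  refine ⟨d₀, fun d hd f hf => ?_⟩
  rw [← aeval_map_algebraMap k, h.aeval_eq_zero_iff d _ (hf.map _)]
  exact ⟨hd₀ d hd _ (hf.map _), fun hmem _ => ⟨0, by simpa using hmem⟩⟩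

variable [IsDomain A] [IsDiscreteValuationRing A] {π : A}
  {K κ : Type*} [Field K] [Algebra A K] [IsFractionRing A K] [Field κ] [Algebra A κ]
  {F₁ F₂ : Type*} [Field F₁] [Algebra K F₁] [Field F₂] [Algebra κ F₂]
  {I : Ideal (MvPolynomial σ A)} {y₁ : σ → F₁} {y₂ : σ → F₂}

/-- If the geometric genus of the special fibre is the genus of the normal generic fibre, then the
special fibre is normal and the model is flat. -/
theorem chartsIntegrallyClosed_reduction [IsFunctionField K F₁] [IsFunctionField κ F₂]
    (hπ : Irreducible π)
    (hsurj : Function.Surjective (algebraMap A κ)) (hker : ∀ a : A, algebraMap A κ a = 0 ↔ π ∣ a)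
    (hI : I.IsHomogeneous (homogeneousSubmodule σ A))
    (hI₁ : (I.map (map (algebraMap A K))).IsHomogeneous (homogeneousSubmodule σ K))
    (hI₂ : (I.map (map (algebraMap A κ))).IsHomogeneous (homogeneousSubmodule σ κ))
    (h₁ : IsGenericPoint (I.map (map (algebraMap A K))) y₁)
    (h₂ : IsGenericPoint (I.map (map (algebraMap A κ))) y₂)
    (hc : ChartsIntegrallyClosed K y₁) (hg : genus κ F₂ = genus K F₁) :
    ChartsIntegrallyClosed κ y₂ ∧ ∃ d₀, ∀ d ≥ d₀, ∀ f : MvPolynomial σ A, f.IsHomogeneous d →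
      ∀ a : A, a ≠ 0 → C a * f ∈ I → f ∈ I := by
  let := ((algebraMap K F₁).comp (algebraMap A K)).toAlgebra
  have : IsScalarTower A K F₁ := .of_algebraMap_eq fun _ => rfl
  let := ((algebraMap κ F₂).comp (algebraMap A κ)).toAlgebra
  have : IsScalarTower A κ F₂ := .of_algebraMap_eq fun _ => rfl
  obtain ⟨n₁, hn₁⟩ := h₁.eventually_aeval_map_eq_zero_iff hI₁
  obtain ⟨n₂, hn₂⟩ := h₂.eventually_aeval_map_eq_zero_iff hI₂
  obtain ⟨i₁, hi₁⟩ := h₁.exists_eq_one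
  obtain ⟨i₂, hi₂⟩ := h₂.exists_eq_one
  obtain ⟨δ₁, hδ₁, -, hiff₁⟩ := exists_hilbert hi₁ h₁.exists_fraction
  obtain ⟨δ₂, hδ₂, ⟨C₂, m₂, hm₂⟩, hiff₂⟩ := exists_hilbert hi₂ h₂.exists_fraction
  obtain ⟨m₁, hm₁⟩ := hiff₁.mp hc
  have hdim : ∀ d ≥ max n₁ n₂, finrank K (formValues K y₁ d) +
      finrank κ (Submodule.span κ ((aeval (R := A) y₂).toLinearMap.comp
        (homogeneousSubmodule σ A d).subtype '' {u | aeval (R := A) y₁ u.1 = 0})) =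
      finrank κ (formValues κ y₂ d) := by
    intro d hd
    have : Module.Finite A (homogeneousSubmodule σ A d) :=
      Module.Finite.iff_fg.mpr (homogeneousSubmodule_fg σ A d)
    rw [← span_range_aeval (A := A), ← span_range_aeval (A := A)]
    refine finrank_generic_add (π := π) hsurj hker _ _ ?_
    rintro ⟨f, hf⟩ hf0
    have hf0 : aeval y₂ f = 0 := hf0
    rw [hn₂ d (le_of_max_le_right hd) f hf] at hf0
    obtain ⟨u, huI, hu, s, hs, rfl⟩ := exists_of_map_residue_mem hsurj hker hI hf hf0
    refine ⟨⟨u, hu⟩, ⟨s, hs⟩, ?_, Subtype.ext ?_⟩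
    · exact (hn₁ d (le_of_max_le_left hd) u hu).mpr (Ideal.mem_map_of_mem _ huI)
    · exact congrArg (u + ·) (C_mul' (a := π) (p := s))
  -- A form vanishing generically vanishes on the special fibre. Otherwise its multiples, a copy of
  -- `formValues κ y₂ d` since F₂ is a domain, would be reduced torsion in degree d + e, too large
  -- for a Hilbert function with bounded increments.
  have hT : ∀ e (t : MvPolynomial σ A), t.IsHomogeneous e → aeval y₁ t = 0 → aeval y₂ t = 0 := by
    intro e t ht ht1
    by_contra ht2
    have hbound : ∀ d ≥ max n₁ n₂, finrank K (formValues K y₁ (d + e)) +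
        finrank κ (formValues κ y₂ d) ≤ finrank κ (formValues κ y₂ (d + e)) := by
      intro d hd
      rw [← hdim (d + e) (by omega)]
      refine Nat.add_le_add_left ?_ _
      have hfin : FiniteDimensional κ (formValues κ y₂ (d + e)) := by
        obtain ⟨D, hD⟩ := exists_isHyperplaneDivisor κ hi₂
        exact Submodule.finiteDimensional_of_le (hD.formValues_le _)
      have hle : (formValues κ y₂ d).map (LinearMap.mulRight κ (aeval y₂ t)) ≤
          Submodule.span κ ((aeval (R := A) y₂).toLinearMap.comp
            (homogeneousSubmodule σ A (d + e)).subtype '' {u | aeval (R := A) y₁ u.1 = 0}) := by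
        rw [← span_range_aeval (A := A), Submodule.map_span]
        refine Submodule.span_mono ?_
        rintro _ ⟨_, ⟨⟨f, hf⟩, rfl⟩, rfl⟩
        refine ⟨⟨f * t, IsHomogeneous.mul hf ht⟩, ?_, ?_⟩
        · change aeval y₁ (f * t) = 0
          rw [map_mul, ht1, mul_zero]
        · exact map_mul (aeval (R := A) y₂) f t
      have hfin' : FiniteDimensional κ (Submodule.span κ ((aeval (R := A) y₂).toLinearMap.comp
            (homogeneousSubmodule σ A (d + e)).subtype '' {u | aeval (R := A) y₁ u.1 = 0})) := by
        refine Submodule.finiteDimensional_of_le (S₂ := formValues κ y₂ (d + e)) ?_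
        rw [← span_range_aeval (A := A)]
        exact Submodule.span_mono (Set.image_subset_range _ _)
      refine le_trans ?_ (Submodule.finrank_mono hle)
      exact (Submodule.equivMapOfInjective _ (mul_left_injective₀ ht2) _).finrank_eq.le
    -- The inequality for d would force δ₁(d + e) < B, while δ₁ ≥ 1 and d + e ≥ B.
    let B := δ₂ * e + 1 - genus κ F₂ + C₂ + |genus K F₁|
    let d := max (max n₁ n₂) (max m₁ m₂) + B.toNat
    have e1 := hbound d (by omega)
    have e2 := (hm₂ (d + e) (by omega)).2
    have e3 := (hm₂ d (by omega)).1
    have e4 := hm₁ (d + e) (by omega)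
    have e5 : δ₁ * ((d + e : ℕ) : ℤ) ≥ B := by
      have : B ≤ ((d + e : ℕ) : ℤ) := by
        have := Int.self_le_toNat B
        omega
      nlinarith [Int.natCast_nonneg (d + e)]
    have e6 := le_abs_self (genus K F₁)
    have e7 : (finrank K (formValues K y₁ (d + e)) : ℤ) + finrank κ (formValues κ y₂ d) ≤
      finrank κ (formValues κ y₂ (d + e)) := by exact_mod_cast e1
    have e8 : δ₂ * ((d + e : ℕ) : ℤ) = δ₂ * d + δ₂ * e := by push_cast; ring
    simp only [B] at e5
    linarith
  have htors : ∀ d ≥ max n₁ n₂, ∀ t : MvPolynomial σ A, t.IsHomogeneous d → aeval y₁ t = 0 →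
      t ∈ I := by
    obtain ⟨N, hN⟩ := exists_pow_mul_mem (K := K) hπ I
    have hπ1 : algebraMap A F₁ π ≠ 0 := by
      rw [IsScalarTower.algebraMap_apply A K F₁]
      exact (map_ne_zero _).mpr ((map_ne_zero_iff _ (IsFractionRing.injective A K)).mpr hπ.ne_zero)
    intro d hd t ht ht0
    -- Torsion s reduces to zero, so s = u' + π s' with u' in I, and s' is again torsion because π
    -- is nonzero in F₁. Repeating N times reaches the power of π that kills all torsion.
    have hrec : ∀ m : ℕ, ∃ u ∈ I, ∃ s : MvPolynomial σ A, s.IsHomogeneous d ∧ aeval y₁ s = 0 ∧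
        t = u + C (π ^ m) * s := by
      intro m
      induction m with
      | zero => exact ⟨0, zero_mem _, t, ht, ht0, by simp⟩
      | succ m ih =>
        obtain ⟨u, hu, s, hs, hs0, rfl⟩ := ih
        have hs2 := hT d s hs hs0
        rw [hn₂ d (le_of_max_le_right hd) s hs] at hs2
        obtain ⟨u', hu'I, hu', s', hs', rfl⟩ := exists_of_map_residue_mem hsurj hker hI hs hs2
        have hu'0 := (hn₁ d (le_of_max_le_left hd) u' hu').mpr (Ideal.mem_map_of_mem _ hu'I)
        rw [map_add, hu'0, zero_add, map_mul, aeval_C, mul_eq_zero, or_iff_right hπ1] at hs0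
        refine ⟨u + C (π ^ m) * u', add_mem hu (I.mul_mem_left _ hu'I), s', hs', hs0, ?_⟩
        rw [pow_succ, C_mul]
        ring
    obtain ⟨u, hu, s, hs, hs0, rfl⟩ := hrec N
    refine add_mem hu (hN s ?_)
    rwa [hn₁ d (le_of_max_le_left hd) s hs] at hs0
  -- With no reduced torsion the Hilbert functions of the fibres agree. The linear bounds give equal
  -- degrees, and equal genera then turn the upper bound for the special fibre into an equality,
  -- which is normality.
  have heq : ∀ d ≥ max n₁ n₂, finrank K (formValues K y₁ d) = finrank κ (formValues κ y₂ d) := by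
    intro d hd
    rw [← hdim d hd, left_eq_add]
    have : Submodule.span κ ((aeval (R := A) y₂).toLinearMap.comp
        (homogeneousSubmodule σ A d).subtype '' {u | aeval (R := A) y₁ u.1 = 0}) = ⊥ := by
      rw [Submodule.span_eq_bot]
      rintro _ ⟨⟨u, hu⟩, hu0, rfl⟩
      exact hT d u hu hu0
    rw [this, finrank_bot]
  have hδ : δ₁ = δ₂ := by
    have hd : ∀ d ≥ max (max n₁ n₂) (max m₁ m₂), δ₂ * d - C₂ ≤ δ₁ * d + 1 - genus K F₁ ∧
        δ₁ * d + 1 - genus K F₁ ≤ δ₂ * d + 1 - genus K F₁ := by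
      intro d hd
      have := hm₂ d (by omega)
      rwa [← heq d (by omega), hm₁ d (by omega), hg] at this
    refine eq_of_linear_bounds (c := C₂ + 1 - genus K F₁) (n := max (max n₁ n₂) (max m₁ m₂))
      fun d h => ?_
    have := hd d h
    constructor <;> linarith
  refine ⟨hiff₂.mpr ⟨max (max n₁ n₂) m₁, fun d hd => ?_⟩, max n₁ n₂, fun d hd f hf a ha haf => ?_⟩
  · rw [← heq d (le_of_max_le_left hd), hm₁ d (le_of_max_le_right hd), hδ, hg]
  · refine htors d hd f hf ?_
    rw [hn₁ d (le_of_max_le_left hd) f hf, map_fractionRing_mem_iff]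
    exact ⟨a, mem_nonZeroDivisors_of_ne_zero ha, haf⟩

end FunctionField1

/-! ### Smoothness of Dedekind domains over perfect fields -/

section Dedekind

open Polynomial

variable {k R : Type*} [Field k] [CommRing R] [Algebra k R]

theorem exists_uniformizer_localization [IsDedekindDomain R] {q : Ideal R} [q.IsPrime] (hq : q ≠ ⊥) :
    ∃ t ∈ q, t ≠ 0 ∧ IsLocalRing.maximalIdeal (Localization.AtPrime q) =
      Ideal.span {algebraMap R (Localization.AtPrime q) t} := by
  have := IsLocalization.AtPrime.isDiscreteValuationRing_of_dedekind_domain R hq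
    (Localization.AtPrime q)
  obtain ⟨ϖ, hϖ⟩ := IsDiscreteValuationRing.exists_irreducible (Localization.AtPrime q)
  obtain ⟨⟨t, s⟩, hts⟩ := IsLocalization.surj q.primeCompl ϖ
  have hs := IsLocalization.map_units (Localization.AtPrime q) s
  have hspan : IsLocalRing.maximalIdeal (Localization.AtPrime q) =
      Ideal.span {algebraMap R (Localization.AtPrime q) t} := by
    rw [hϖ.maximalIdeal_eq, ← show _ = algebraMap R (Localization.AtPrime q) t from hts,
      Ideal.span_singleton_mul_right_unit hs]
  refine ⟨t, ?_, ?_, hspan⟩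
  · rw [← IsLocalization.AtPrime.to_map_mem_maximal_iff (Localization.AtPrime q) q, hspan]
    exact Ideal.mem_span_singleton_self _
  · rintro rfl
    rw [map_zero] at hts
    exact hϖ.ne_zero ((IsUnit.mul_left_eq_zero hs).mp hts)

/-- A nonzero algebraic element of a domain divides a nonzero constant, hence is a unit. -/
theorem transcendental_of_mem_prime [IsDomain R] {q : Ideal R} [q.IsPrime] {t : R} (ht : t ∈ q) (ht0 : t ≠ 0) :
    Transcendental k t := by
  intro halg
  have hu : IsUnit t := by
    obtain ⟨r, hr, hdvd⟩ := halg.exists_nonzero_dvd (mem_nonZeroDivisors_of_ne_zero ht0)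
    exact isUnit_of_dvd_unit hdvd ((isUnit_iff_ne_zero.mpr hr).map (algebraMap k R))
  exact Ideal.IsPrime.ne_top ‹_› (Ideal.eq_top_of_isUnit_mem q ht hu)

/-- Map k[X] to R by a local uniformizer t at q. This is flat, being torsion-free over a PID, and
unramified at q, since t generates the maximal ideal and the residue extension is separable over a
perfect field. So R is étale over the affine line at q. -/
theorem isSmoothAt_of_ne_bot [PerfectField k] [Algebra.FiniteType k R] [IsDedekindDomain R]
    {q : Ideal R} [q.IsPrime] (hq : q ≠ ⊥) : Algebra.IsSmoothAt k q := by
  obtain ⟨t, htq, ht0, hspan⟩ := exists_uniformizer_localization hq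
  have htr : Transcendental k t := transcendental_of_mem_prime htq ht0
  let : Algebra k[X] R := (aeval t).toAlgebra
  have : IsScalarTower k k[X] R := .of_algebraMap_eq fun c => ((aeval t).commutes c).symm
  have hX : algebraMap k[X] R X = t := aeval_X t
  have : Algebra.FiniteType k[X] R := .of_restrictScalars_finiteType k _ _
  have : Algebra.FinitePresentation k[X] R := Algebra.FinitePresentation.of_finiteType.mp this
  have : FaithfulSMul k[X] R :=
    (faithfulSMul_iff_algebraMap_injective _ _).mpr (transcendental_iff_injective.mp htr)
  have : Module.IsTorsionFree k[X] R := inferInstance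
  have : Module.Flat k[X] R := inferInstance
  have hqmax : q.IsMaximal := Ideal.IsPrime.isMaximal ‹_› hq
  let p := q.under k[X]
  let := Localization.AtPrime.algebraOfLiesOver p q
  have hfin : Module.Finite k q.ResidueField := by
    let := Ideal.Quotient.field q
    have := finite_of_finite_type_of_isJacobsonRing k (R ⧸ q)
    exact Module.Finite.of_surjective
      (IsScalarTower.toAlgHom k (R ⧸ q) q.ResidueField).toLinearMap
      q.bijective_algebraMap_quotient_residueField.surjective
  have : Algebra.IsSeparable p.ResidueField q.ResidueField := by
    have : Algebra.IsAlgebraic k q.ResidueField := inferInstance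
    have : Algebra.IsAlgebraic p.ResidueField q.ResidueField := .tower_top (K := k) _
    have : Algebra.IsAlgebraic k p.ResidueField := .tower_bot k _ q.ResidueField
    have : PerfectField p.ResidueField := Algebra.IsAlgebraic.perfectField k
    infer_instance
  have : Algebra.IsUnramifiedAt k[X] q := by
    rw [Algebra.isUnramifiedAt_iff_map_eq k[X] p q]
    refine ⟨this, le_antisymm ?_ ?_⟩
    · rw [IsScalarTower.algebraMap_eq k[X] R, ← Ideal.map_map, 
        ← Localization.AtPrime.map_eq_maximalIdeal]
      exact Ideal.map_mono Ideal.map_comap_le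
    · rw [hspan, Ideal.span_singleton_le_iff_mem, ← hX,
        ← IsScalarTower.algebraMap_apply k[X] R]
      refine Ideal.mem_map_of_mem _ ?_
      change algebraMap k[X] R X ∈ q
      rwa [hX]
  have : Algebra.IsEtaleAt k[X] q := Algebra.IsEtaleAt.of_isUnramifiedAt_of_flat q
  have : Algebra.FormallySmooth k[X] (Localization.AtPrime q) := inferInstance
  exact .comp k k[X] _

theorem Algebra.Smooth.of_isDedekindDomain [PerfectField k] [Algebra.FiniteType k R]
    [IsDedekindDomain R] : Algebra.Smooth k R := by
  have : Algebra.FinitePresentation k R := Algebra.FinitePresentation.of_finiteType.mp ‹_›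
  refine ⟨Algebra.smoothLocus_eq_univ_iff.mp (Set.eq_univ_iff_forall.mpr fun q => ?_), this⟩
  -- At the generic point the local ring is the fraction field, a finitely generated extension of a
  -- perfect field, hence formally smooth.
  by_cases hq : q.asIdeal = ⊥
  · have h1 : Algebra.EssFiniteType R (FractionRing R) := .of_isLocalization _ (nonZeroDivisors R)
    have h2 : Algebra.EssFiniteType k (FractionRing R) := .comp k R _
    have h3 : Algebra.FormallySmooth k (FractionRing R) := inferInstance
    have h4 : q.asIdeal.primeCompl = nonZeroDivisors R := by
      ext x
      rw [Ideal.mem_primeCompl_iff, hq, Ideal.mem_bot, mem_nonZeroDivisors_iff_ne_zero]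
    have h5 : IsLocalization q.asIdeal.primeCompl (FractionRing R) := by
      rw [h4]
      infer_instance
    exact .of_equiv ((IsLocalization.algEquiv q.asIdeal.primeCompl (FractionRing R)
      (Localization.AtPrime q.asIdeal)).restrictScalars k)
  · exact isSmoothAt_of_ne_bot hq

end Dedekind

/-! ### Normal charts are Dedekind and smooth -/

namespace FunctionField1

variable {k F : Type*} [Field k] [Field F] [Algebra k F] [IsFunctionField k F]

/-- Modulo a nonzero prime the ring is a domain of finite dimension over k, hence a field. -/
theorem dimensionLEOne_subalgebra (O : Subalgebra k F) : Ring.DimensionLEOne O := by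
  refine ⟨fun {q} hq0 hq => ?_⟩
  obtain ⟨x, hxq, hx0⟩ := Submodule.exists_mem_ne_zero_of_ne_bot hq0
  have hx : Transcendental k (x : F) :=
    (transcendental_algebraMap_iff (R := k) (S := O) (A := F) Subtype.val_injective).mpr
      (transcendental_of_mem_prime hxq hx0)
  have hfin := finite_quotient_span O x hx
  have hle : Ideal.span {x} ≤ q := (Ideal.span_singleton_le_iff_mem q).mpr hxq
  have : Module.Finite k (O ⧸ q) := Module.Finite.of_surjective
    (Ideal.Quotient.factorₐ k hle).toLinearMap (Ideal.Quotient.factor_surjective hle)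
  have hint : Algebra.IsIntegral k (O ⧸ q) := inferInstance
  exact Ideal.Quotient.maximal_of_isField q
    (isField_of_isIntegral_of_isField' (R := k) (Field.toIsField k))

theorem isDedekindDomain_subalgebra {O : Subalgebra k F}
    (hO : ∀ f : F, IsIntegral O f → f ∈ O) : IsDedekindDomain O := by
  have h1 := isNoetherianRing_subalgebra O
  have h2 := dimensionLEOne_subalgebra O
  have h3 : IsIntegrallyClosed O := by
    rw [isIntegrallyClosed_iff (FractionRing O)]
    intro x hx
    let φ : FractionRing O →ₐ[O] F := IsFractionRing.liftAlgHom (g := Algebra.ofId O F)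
      Subtype.val_injective
    have hφ : IsIntegral O (φ x) := hx.map φ
    refine ⟨⟨φ x, hO _ hφ⟩, φ.toRingHom.injective ?_⟩
    exact φ.commutes _
  exact {}

variable {σ : Type*} {y : σ → F}

theorem ChartsIntegrallyClosed.smooth [PerfectField k] [Finite σ] (h : ChartsIntegrallyClosed k y)
    {j : σ} (hj : y j ≠ 0) : Algebra.Smooth k (chart k y j) := by
  have := isDedekindDomain_subalgebra (h j hj)
  have : Algebra.FiniteType k (chart k y j) := by
    rw [← Subalgebra.fg_iff_finiteType]
    exact Subalgebra.fg_def.mpr ⟨_, Set.finite_range _, rfl⟩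
  exact .of_isDedekindDomain

end FunctionField1

/-! ### Base change and smoothness of the charts -/

namespace ProjectiveModel

open MvPolynomial TensorProduct

variable {A σ : Type*} [CommRing A] (I : Ideal (MvPolynomial σ A)) (j : σ)

/-- The coordinate ring of the affine chart `X j ≠ 0` of the projective scheme defined by `I`. -/
abbrev ChartRing : Type _ := MvPolynomial σ A ⧸ chartIdeal I j

variable (B : Type*) [CommRing B] [Algebra A B]

/-- The homomorphism of coordinate rings induced by a change of the base ring. -/
noncomputable def chartRingMap : ChartRing I j →ₐ[A]
    ChartRing (I.map (map (algebraMap A B))) j :=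
  Ideal.Quotient.liftₐ _ ((Ideal.Quotient.mkₐ A (chartIdeal (I.map (map (algebraMap A B))) j)).comp
    (mapAlgHom (Algebra.ofId A B))) fun f hf => by
      rw [AlgHom.comp_apply, Ideal.Quotient.mkₐ_eq_mk, Ideal.Quotient.eq_zero_iff_mem]
      have hle : chartIdeal I j ≤ (chartIdeal (I.map (map (algebraMap A B))) j).comap
          (map (algebraMap A B)) := by
        refine sup_le (fun g hg => Ideal.mem_sup_left (Ideal.mem_map_of_mem _ hg)) ?_
        rw [Ideal.span_singleton_le_iff_mem, Ideal.mem_comap, map_sub, map_X, map_one]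
        exact Ideal.mem_sup_right (Ideal.mem_span_singleton_self _)
      exact hle hf

theorem chartRingMap_mk (f : MvPolynomial σ A) :
    chartRingMap I j B (Ideal.Quotient.mk _ f) = Ideal.Quotient.mk _ (map (algebraMap A B) f) := rfl

/-- The coordinate rings of the charts commute with base change. -/
noncomputable def baseChangeChartRing : B ⊗[A] ChartRing I j ≃ₐ[B]
    ChartRing (I.map (map (algebraMap A B))) j := by
  let φ : B ⊗[A] ChartRing I j →ₐ[B] ChartRing (I.map (map (algebraMap A B))) j :=
    Algebra.TensorProduct.lift (Algebra.ofId _ _) (chartRingMap I j B) fun _ _ => .all _ _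
  let ψ₀ : MvPolynomial σ B →ₐ[B] B ⊗[A] ChartRing I j :=
    aeval fun i => (1 : B) ⊗ₜ[A] (Ideal.Quotient.mk (chartIdeal I j) (X i))
  have hψ₀ : ∀ f : MvPolynomial σ A, ψ₀ (map (algebraMap A B) f) =
      (1 : B) ⊗ₜ[A] (Ideal.Quotient.mk (chartIdeal I j) f) := by
    intro f
    have : ((ψ₀.restrictScalars A).comp (mapAlgHom (Algebra.ofId A B))) =
        (Algebra.TensorProduct.includeRight).comp (Ideal.Quotient.mkₐ A (chartIdeal I j)) := by
      ext i
      simp [ψ₀, Algebra.ofId]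
    exact congrArg (fun g => g f) this
  let ψ : ChartRing (I.map (map (algebraMap A B))) j →ₐ[B] B ⊗[A] ChartRing I j :=
    Ideal.Quotient.liftₐ _ ψ₀ fun f hf => by
      have hle : chartIdeal (I.map (map (algebraMap A B))) j ≤ RingHom.ker ψ₀ := by
        refine sup_le (Ideal.map_le_iff_le_comap.mpr fun g hg => ?_) ?_
        · rw [Ideal.mem_comap, RingHom.mem_ker, hψ₀,
            Ideal.Quotient.eq_zero_iff_mem.mpr 
              (show g ∈ chartIdeal I j from Ideal.mem_sup_left hg), tmul_zero]
        · rw [Ideal.span_singleton_le_iff_mem, RingHom.mem_ker]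
          have : (X j - 1 : MvPolynomial σ B) = map (algebraMap A B) (X j - 1) := by simp
          rw [this, hψ₀, Ideal.Quotient.eq_zero_iff_mem.mpr (show X j - 1 ∈ chartIdeal I j from
            Ideal.mem_sup_right (Ideal.mem_span_singleton_self _)), tmul_zero]
      exact hle hf
  refine AlgEquiv.ofAlgHom φ ψ ?_ ?_
  · have : φ.comp ψ₀ = Ideal.Quotient.mkₐ B _ := by
      refine MvPolynomial.algHom_ext fun i => ?_
      simp [φ, ψ₀, chartRingMap_mk]
    refine AlgHom.ext fun x => ?_
    obtain ⟨f, rfl⟩ := Ideal.Quotient.mk_surjective x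
    exact congrArg (fun g => g f) this
  · refine Algebra.TensorProduct.ext' fun b x => ?_
    obtain ⟨f, rfl⟩ := Ideal.Quotient.mk_surjective x
    have h1 : φ (b ⊗ₜ Ideal.Quotient.mk _ f) =
        Ideal.Quotient.mk _ (C b * map (algebraMap A B) f) := by
      simp only [φ, Algebra.TensorProduct.lift_tmul, chartRingMap_mk, map_mul]
      rfl
    rw [AlgHom.comp_apply, h1, AlgHom.id_apply]
    change ψ₀ _ = _
    rw [map_mul, hψ₀, ← algebraMap_eq, AlgHom.commutes, Algebra.TensorProduct.algebraMap_apply,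
      Algebra.TensorProduct.tmul_mul_tmul, one_mul, mul_one]
    rfl

theorem exists_ringHom_comp_eq {κ L : Type*} [CommRing κ] [CommRing L] {f : A →+* κ}
    (hf : Function.Surjective f) {g : A →+* L} (h : RingHom.ker f ≤ RingHom.ker g) :
    ∃ φ : κ →+* L, φ.comp f = g :=
  ⟨f.liftOfSurjective hf ⟨g, h⟩, f.liftOfSurjective_comp hf ⟨g, h⟩⟩

theorem exists_ringHom_comp_algebraMap_eq (K : Type*) {L : Type*} [Field K] [Field L] [Algebra A K]
    [IsFractionRing A K] {g : A →+* L} (hg : Function.Injective g) :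
    ∃ φ : K →+* L, φ.comp (algebraMap A K) = g :=
  ⟨IsLocalization.lift (M := nonZeroDivisors A) (S := K) fun a => (isUnit_iff_ne_zero.mpr
    ((map_ne_zero_iff g hg).mpr fun h => by
      have := IsLocalization.map_units K a
      rw [h, map_zero] at this
      exact not_isUnit_zero this)), IsLocalization.lift_comp _⟩

/-- The base change from A to L is made through B, so that smoothness known over K or κ passes to
the residue fields of the primes of A. -/
theorem formallySmooth_baseChange {L : Type*} [CommRing L] [Algebra A L] (φ : B →+* L)
    (hφ : φ.comp (algebraMap A B) = algebraMap A L)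
    [Algebra.FormallySmooth B (ChartRing (I.map (map (algebraMap A B))) j)] :
    Algebra.FormallySmooth L (L ⊗[A] ChartRing I j) := by
  let := φ.toAlgebra
  have : IsScalarTower A B L := .of_algebraMap_eq' hφ.symm
  have : Algebra.FormallySmooth B (B ⊗[A] ChartRing I j) :=
    .of_equiv (baseChangeChartRing I j B).symm
  exact .of_equiv (Algebra.TensorProduct.cancelBaseChange A B L L (ChartRing I j))

/-- Over a discrete valuation ring, a flat chart with smooth fibres is smooth. -/
theorem smooth_chartRing [IsDomain A] [IsDiscreteValuationRing A] [Finite σ] {π : A}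
    {K κ : Type*} [Field K] [Algebra A K] [IsFractionRing A K] [Field κ] [Algebra A κ]
    (hπ : Irreducible π)
    (hsurj : Function.Surjective (algebraMap A κ)) (hker : ∀ a : A, algebraMap A κ a = 0 ↔ π ∣ a)
    [Algebra.Smooth K (ChartRing (I.map (map (algebraMap A K))) j)]
    [Algebra.Smooth κ (ChartRing (I.map (map (algebraMap A κ))) j)]
    (htors : ∀ (a : A) (f : MvPolynomial σ A), a ≠ 0 → C a * f ∈ chartIdeal I j →
      f ∈ chartIdeal I j) :
    Algebra.Smooth A (ChartRing I j) := by
  have : Module.IsTorsionFree A (ChartRing I j) := by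
    refine .of_smul_eq_zero fun a x hax => ?_
    obtain ⟨f, rfl⟩ := Ideal.Quotient.mk_surjective x
    rw [or_iff_not_imp_left]
    intro ha
    refine Ideal.Quotient.eq_zero_iff_mem.mpr (htors a f ha ?_)
    rw [← Ideal.Quotient.eq_zero_iff_mem, ← hax, C_mul']
    rfl
  have : Module.Flat A (ChartRing I j) := inferInstance
  have : Algebra.FiniteType A (ChartRing I j) := inferInstance
  have : Algebra.FinitePresentation A (ChartRing I j) :=
    Algebra.FinitePresentation.of_finiteType.mp this
  refine .of_formallySmooth_fiber fun P hP => ?_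
  -- A has only two primes: the residue field of the zero ideal receives a map from K, that of (π)
  -- one from κ.
  by_cases hP0 : P = ⊥
  · have hinj : Function.Injective (algebraMap A P.ResidueField) := by
      rw [injective_iff_map_eq_zero]
      intro a ha
      rwa [Ideal.algebraMap_residueField_eq_zero, hP0, Ideal.mem_bot] at ha
    obtain ⟨φ, hφ⟩ := exists_ringHom_comp_algebraMap_eq K hinj
    exact formallySmooth_baseChange I j K φ hφ
  · have hPπ : P = Ideal.span {π} := by
      rw [← hπ.maximalIdeal_eq]
      exact IsLocalRing.eq_maximalIdeal (hP.isMaximal hP0)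
    have hle : RingHom.ker (algebraMap A κ) ≤ RingHom.ker (algebraMap A P.ResidueField) := by
      intro a ha
      rw [RingHom.mem_ker, hker] at ha
      rw [RingHom.mem_ker, Ideal.algebraMap_residueField_eq_zero, hPπ]
      exact Ideal.mem_span_singleton.mpr ha
    obtain ⟨φ, hφ⟩ := exists_ringHom_comp_eq hsurj hle
    exact formallySmooth_baseChange I j κ φ hφ

end ProjectiveModel

/-! ### The standard affine charts of `Proj` -/

namespace ProjectiveModel

open MvPolynomial HomogeneousLocalization

theorem eval₂_mul_left {A B σ : Type*} [CommSemiring A] [CommSemiring B] (f : A →+* B) (c : B)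
    (y : σ → B) {d : ℕ} {g : MvPolynomial σ A} (hg : g.IsHomogeneous d) :
    eval₂ f (fun i => c * y i) g = c ^ d * eval₂ f y g := by
  rw [eval₂_eq, eval₂_eq, Finset.mul_sum]
  refine Finset.sum_congr rfl fun m hm => ?_
  have hd : m.degree = d := by
    rw [Finsupp.degree_eq_weight_one]
    exact hg (mem_support_iff.mp hm)
  simp_rw [mul_pow]
  rw [Finset.prod_mul_distrib, Finset.prod_pow_eq_pow_sum, ← Finsupp.degree_apply, hd]
  ring

variable {A σ : Type*} [CommRing A] (I : HomogeneousIdeal (homogeneousSubmodule σ A))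

/-- The homogeneous coordinate ring. -/
noncomputable abbrev quotGrading : ℕ → Submodule A (MvPolynomial σ A ⧸ I.toIdeal) :=
  GradedQuotient.grading (homogeneousSubmodule σ A) I

variable {I} in
theorem mk_mem_quotGrading {d : ℕ} {g : MvPolynomial σ A} (hg : g.IsHomogeneous d) :
    Ideal.Quotient.mk I.toIdeal g ∈ quotGrading I d := ⟨g, hg, rfl⟩

/-- The `j`-th homogeneous coordinate. -/
noncomputable def coord (j : σ) : MvPolynomial σ A ⧸ I.toIdeal := Ideal.Quotient.mk I.toIdeal (X j)

theorem coord_mem (j : σ) : coord I j ∈ quotGrading I 1 := mk_mem_quotGrading (isHomogeneous_X A j)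

/-- The fraction `g / x_j ^ d` for a form `g` of degree `d`. -/
noncomputable def awayFraction (j : σ) {d : ℕ} (g : MvPolynomial σ A) (hg : g.IsHomogeneous d) :
    Away (quotGrading I) (coord I j) :=
  Away.mk (quotGrading I) (coord_mem I j) d (Ideal.Quotient.mk I.toIdeal g)
    (by rw [smul_eq_mul, mul_one]; exact mk_mem_quotGrading hg)

/-- The structure map of the chart. -/
noncomputable def awayConst (j : σ) : A →+* Away (quotGrading I) (coord I j) :=
  (fromZeroRingHom (quotGrading I) _).comp (algebraMap A (quotGrading I 0))

/-- Dehomogenization with respect to the `j`-th coordinate. -/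
noncomputable def awayHom (j : σ) : MvPolynomial σ A →+* Away (quotGrading I) (coord I j) :=
  eval₂Hom (awayConst I j) fun i => awayFraction I j (X i) (isHomogeneous_X A i)

theorem awayHom_C (j : σ) (a : A) : awayHom I j (C a) = awayConst I j a := eval₂Hom_C _ _ _

/-- In the full localization each affine coordinate is c x_i with c = 1 / x_j, and homogeneity pulls
out c ^ d. -/
theorem awayHom_of_isHomogeneous (j : σ) {d : ℕ} {g : MvPolynomial σ A} (hg : g.IsHomogeneous d) :
    awayHom I j g = awayFraction I j g hg := by
  refine val_injective _ ?_
  let L := Localization (Submonoid.powers (coord I j))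
  let v : Away (quotGrading I) (coord I j) →+* L := algebraMap _ _
  let ι : MvPolynomial σ A →+* L := (algebraMap (MvPolynomial σ A ⧸ I.toIdeal) L).comp
    (Ideal.Quotient.mk I.toIdeal)
  let c : L := Localization.mk 1 ⟨coord I j, Submonoid.mem_powers _⟩
  have hv : ∀ x, v x = x.val := algebraMap_apply
  have hpow : ∀ m : ℕ, c ^ m = Localization.mk 1 ⟨coord I j ^ m, Submonoid.pow_mem _ (Submonoid.mem_powers _) m⟩ := fun m => by
    rw [Localization.mk_pow, one_pow]
    rfl
  have hmk : ∀ (m : ℕ) (h : MvPolynomial σ A) (hh : h.IsHomogeneous m),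
      v (awayFraction I j h hh) = c ^ m * ι h := fun m h hh => by
    rw [hv, awayFraction, Away.val_mk, hpow]
    change _ = _ * algebraMap (MvPolynomial σ A ⧸ I.toIdeal) L _
    rw [← Localization.mk_one_eq_algebraMap, Localization.mk_mul, one_mul, mul_one]
    rfl
  have hc : (fun i => v (awayFraction I j (X i) (isHomogeneous_X A i))) = fun i => c * ι (X i) :=
    funext fun i => by simpa using hmk 1 (X i) (isHomogeneous_X A i)
  have hconst : v.comp (awayConst I j) = ι.comp C := RingHom.ext fun a => by
    rw [RingHom.comp_apply, hv]
    exact Localization.mk_one_eq_algebraMap _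
  rw [← hv, ← hv, hmk d g hg]
  change v (eval₂ _ _ g) = _
  rw [hom_eval₂, hconst, hc, eval₂_mul_left _ _ _ hg]
  congr 1
  have : eval₂Hom (ι.comp C) (fun i => ι (X i)) = ι := by
    ext <;> simp
  exact congrArg (fun f => f g) this

theorem exists_X_pow_mul_mem_of_awayHom_eq_zero (j : σ) {d : ℕ} {g : MvPolynomial σ A}
    (hg : g.IsHomogeneous d) (h : awayHom I j g = 0) : ∃ N : ℕ, X j ^ N * g ∈ I.toIdeal := by
  rw [awayHom_of_isHomogeneous I j hg] at h
  have h1 := congrArg val h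
  rw [awayFraction, Away.val_mk, val_zero, Localization.mk_eq_mk', IsLocalization.mk'_eq_zero_iff] at h1
  obtain ⟨⟨_, N, rfl⟩, hN⟩ := h1
  refine ⟨N, Ideal.Quotient.eq_zero_iff_mem.mp ?_⟩
  rw [map_mul, map_pow]
  exact hN

theorem awayHom_X_self (j : σ) : awayHom I j (X j) = 1 := by
  rw [awayHom_of_isHomogeneous I j (isHomogeneous_X A j)]
  refine val_injective _ ?_
  rw [awayFraction, Away.val_mk, val_one]
  simp_rw [pow_one]
  exact Localization.mk_self (⟨coord I j, Submonoid.mem_powers _⟩ : Submonoid.powers (coord I j))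

theorem ker_awayHom (j : σ) : RingHom.ker (awayHom I j) = chartIdeal I.toIdeal j := by
  refine le_antisymm (fun f hf => ?_) (sup_le (fun f hf => ?_) ?_)
  · exact mem_chartIdeal_of_map_eq_zero (awayHom_X_self I j)
      (fun d g hg h => exists_X_pow_mul_mem_of_awayHom_eq_zero I j hg h) hf
  · rw [RingHom.mem_ker, ← sum_homogeneousComponent f, map_sum]
    refine Finset.sum_eq_zero fun d _ => ?_
    have hd := homogeneousComponent_isHomogeneous d f
    rw [awayHom_of_isHomogeneous I j hd]
    refine val_injective _ ?_
    rw [awayFraction, Away.val_mk, val_zero]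
    have : Ideal.Quotient.mk I.toIdeal (homogeneousComponent d f) = 0 := by
      rw [Ideal.Quotient.eq_zero_iff_mem, ← coe_decompose]
      exact I.isHomogeneous d hf
    rw [this, Localization.mk_zero]
  · rw [Ideal.span_singleton_le_iff_mem, RingHom.mem_ker, map_sub, awayHom_X_self, map_one, sub_self]

theorem awayHom_surjective (j : σ) : Function.Surjective (awayHom I j) := by
  intro x
  obtain ⟨n, a, ha, rfl⟩ := Away.mk_surjective (quotGrading I) (coord_mem I j) x
  obtain ⟨g, hg, rfl⟩ := ha
  rw [smul_eq_mul, mul_one] at hg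
  exact ⟨g, awayHom_of_isHomogeneous I j hg⟩

/-- The coordinate ring of a standard chart of `Proj`. -/
noncomputable def chartRingEquivAway (j : σ) :
    ChartRing I.toIdeal j ≃+* Away (quotGrading I) (coord I j) :=
  (Ideal.quotEquivOfEq (ker_awayHom I j).symm).trans
    (RingHom.quotientKerEquivOfSurjective (awayHom_surjective I j))

theorem chartRingEquivAway_comp_algebraMap (j : σ) :
    (chartRingEquivAway I j : ChartRing I.toIdeal j →+* _).comp (algebraMap A _) =
      awayConst I j :=
  RingHom.ext fun a => awayHom_C I j a

/-- If the homogeneous coordinate ring is torsion free in large degrees, so are the charts. -/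
theorem mem_chartIdeal_of_C_mul_mem (j : σ) {d₀ : ℕ} (h : ∀ d ≥ d₀, ∀ f : MvPolynomial σ A,
    f.IsHomogeneous d → ∀ a : A, a ≠ 0 → C a * f ∈ I.toIdeal → f ∈ I.toIdeal) (a : A)
    (f : MvPolynomial σ A) (ha : a ≠ 0) (haf : C a * f ∈ chartIdeal I.toIdeal j) :
    f ∈ chartIdeal I.toIdeal j := by
  obtain ⟨d, g, hg, hfg⟩ := exists_homogenization j f
  have hfg' : f - g ∈ chartIdeal I.toIdeal j := Ideal.mem_sup_right hfg
  have hag : C a * g ∈ chartIdeal I.toIdeal j := by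
    have : C a * g = C a * f - C a * (f - g) := by ring
    rw [this]
    exact sub_mem haf (Ideal.mul_mem_left _ _ hfg')
  rw [← ker_awayHom, RingHom.mem_ker] at hag
  have hag' : (C a * g).IsHomogeneous d := by simpa using (isHomogeneous_C σ a).mul hg
  obtain ⟨N, hN⟩ := exists_X_pow_mul_mem_of_awayHom_eq_zero I j hag' hag
  -- The extra factor X j ^ d₀ raises the degree into the torsion-free range; it becomes 1 on the
  -- chart.
  have hmem : X j ^ (N + d₀) * g ∈ I.toIdeal := by
    refine h (N + d₀ + d) (by omega) _ ((isHomogeneous_X_pow j _).mul hg) a ha ?_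
    have : C a * (X j ^ (N + d₀) * g) = X j ^ d₀ * (X j ^ N * (C a * g)) := by ring
    rw [this]
    exact Ideal.mul_mem_left _ _ hN
  have hg' : g ∈ chartIdeal I.toIdeal j := by
    rw [← ker_awayHom, RingHom.mem_ker]
    have h1 : X j ^ (N + d₀) * g ∈ RingHom.ker (awayHom I j) := by
      rw [ker_awayHom]
      exact Ideal.mem_sup_left hmem
    rwa [RingHom.mem_ker, map_mul, map_pow, awayHom_X_self, one_pow, one_mul] at h1
  rw [← sub_add_cancel f g]
  exact add_mem hfg' hg'

end ProjectiveModel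

/-! ### Function fields of curves -/

namespace FunctionField1

open MvPolynomial IntermediateField

theorem maximal_of_isIntegral_of_injective {P R : Type*} [CommRing P] [CommRing R] [IsDomain R]
    [Algebra P R] [Algebra.IsIntegral P R] [FaithfulSMul P R] [Ring.DimensionLEOne R]
    {p : Ideal P} (hp : p ≠ ⊥) [p.IsPrime] : p.IsMaximal := by
  obtain ⟨q, hq, hqp⟩ := Ideal.exists_ideal_over_prime_of_isIntegral_of_isDomain (S := R) p
    (by rw [(RingHom.injective_iff_ker_eq_bot _).mp (FaithfulSMul.algebraMap_injective P R)]
        exact bot_le)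
  have hq0 : q ≠ ⊥ := by
    rintro rfl
    apply hp
    rw [← hqp]
    exact (RingHom.injective_iff_ker_eq_bot _).mp (FaithfulSMul.algebraMap_injective P R)
  have := hq.isMaximal hq0
  rw [← hqp]
  exact Ideal.isMaximal_comap_of_isIntegral_of_isMaximal q

variable {k : Type*} [Field k]

theorem natCard_le_one_of_dimensionLEOne {σ : Type*} [Finite σ]
    [Ring.DimensionLEOne (MvPolynomial σ k)] : Nat.card σ ≤ 1 := by
  have h1 : ringKrullDim (MvPolynomial σ k) ≤ 1 :=
    (Ring.krullDimLE_iff).mp (Ring.krullDimLE_one_iff_of_noZeroDivisors.mpr fun p h0 hp =>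
      hp.isMaximal h0)
  rw [MvPolynomial.ringKrullDim_of_isNoetherianRing, ringKrullDim_eq_zero_of_field, zero_add] at h1
  exact_mod_cast h1

variable {R F : Type*} [CommRing R] [IsDomain R] [Field F] [Algebra k R] [Algebra k F]
  [Algebra R F] [IsScalarTower k R F] [IsFractionRing R F]

/-- Noether normalization: R is integral over a polynomial ring in s variables, which inherits
dimension at most one, so s ≤ 1, and F is algebraic over the images of the variables. -/
theorem trdeg_le_one [Algebra.FiniteType k R] (hR : ringKrullDim R ≤ 1) :
    Algebra.trdeg k F ≤ 1 := by
  obtain ⟨s, g, hg, hint⟩ := exists_integral_inj_algHom_of_fg k R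
  let : Algebra (MvPolynomial (Fin s) k) R := g.toRingHom.toAlgebra
  have : Algebra.IsIntegral (MvPolynomial (Fin s) k) R := ⟨hint⟩
  have : FaithfulSMul (MvPolynomial (Fin s) k) R :=
    (faithfulSMul_iff_algebraMap_injective _ _).mpr hg
  have : Ring.KrullDimLE 1 R := Ring.krullDimLE_iff.mpr hR
  have : Ring.DimensionLEOne R :=
    ⟨fun h0 hp => Ring.krullDimLE_one_iff_of_noZeroDivisors.mp this _ h0 hp⟩
  have : Ring.DimensionLEOne (MvPolynomial (Fin s) k) :=
    ⟨fun h0 hp => maximal_of_isIntegral_of_injective (R := R) h0⟩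
  have hs : s ≤ 1 := by simpa using natCard_le_one_of_dimensionLEOne (k := k) (σ := Fin s)
  let t : Set F := Set.range fun i : Fin s => algebraMap R F (g (X i))
  have hR (a : R) : IsIntegral (Algebra.adjoin k t) (algebraMap R F a) := by
    let φ : MvPolynomial (Fin s) k →ₐ[k] Algebra.adjoin k t :=
      aeval fun i => ⟨algebraMap R F (g (X i)), Algebra.subset_adjoin ⟨i, rfl⟩⟩
    refine (Algebra.IsIntegral.isIntegral (R := MvPolynomial (Fin s) k) a).map_of_comp_eq
      φ.toRingHom (algebraMap R F) ?_
    refine MvPolynomial.ringHom_ext (fun c => ?_) fun i => ?_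
    · have h1 : φ (C c) = algebraMap k _ c := φ.commutes c
      have h2 : g (C c) = algebraMap k _ c := g.commutes c
      change algebraMap _ F (φ (C c)) = algebraMap R F (g (C c))
      rw [h1, h2, ← IsScalarTower.algebraMap_apply, ← IsScalarTower.algebraMap_apply]
    · change algebraMap _ F (φ (X i)) = algebraMap R F (g (X i))
      rw [aeval_X]
      rfl
  have : Algebra.IsAlgebraic (Algebra.adjoin k t) F := by
    refine ⟨fun z => ?_⟩
    obtain ⟨a, b, -, rfl⟩ := IsFractionRing.div_surjective (A := R) z
    rw [div_eq_mul_inv]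
    exact (hR a).isAlgebraic.mul (hR b).isAlgebraic.inv
  refine (Algebra.IsAlgebraic.trdeg_le_cardinalMk k t).trans
    (Cardinal.mk_le_one_iff_set_subsingleton.mpr ?_)
  rintro _ ⟨i, rfl⟩ _ ⟨j, rfl⟩
  have : i = j := by omega
  rw [this]

/-- Any transcendental x is a transcendence basis, and F is algebraic and essentially of finite type
over k(x), hence finite. -/
theorem isFunctionField_of_ringKrullDim_le_one [Algebra.FiniteType k R] (hR : ringKrullDim R ≤ 1)
    (hF : ¬ Algebra.IsAlgebraic k F) : IsFunctionField k F where
  exists_transcendental := by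
    rw [Algebra.isAlgebraic_def] at hF
    push Not at hF
    exact hF
  finite_adjoin x hx := by
    have hb : IsTranscendenceBasis k fun _ : Unit => x :=
      (algebraicIndependent_unique_type_iff.mpr hx).isTranscendenceBasis_of_lift_trdeg_le_of_finite
        (by simpa using trdeg_le_one (k := k) (F := F) hR)
    have h1 := hb.isAlgebraic_field
    rw [Set.range_const] at h1
    have : Algebra.EssFiniteType R F := Algebra.EssFiniteType.of_isLocalization F (nonZeroDivisors R)
    have : Algebra.EssFiniteType k F := Algebra.EssFiniteType.comp k R F
    have : Algebra.EssFiniteType k⟮x⟯ F := Algebra.EssFiniteType.of_comp k _ F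
    exact Algebra.finite_of_essFiniteType_of_isAlgebraic

end FunctionField1

/-- Regularity makes the cotangent space at most one-dimensional, which for a noetherian local
domain implies normality. -/
theorem IsRegularLocalRing.isIntegrallyClosed_of_ringKrullDim_le_one {R : Type*} [CommRing R]
    [IsDomain R] [IsRegularLocalRing R] (h : ringKrullDim R ≤ 1) : IsIntegrallyClosed R := by
  have h1 := (IsRegularLocalRing.iff_finrank_cotangentSpace R).mp inferInstance
  rw [← h1] at h
  have h2 := ((tfae_of_isNoetherianRing_of_isLocalRing_of_isDomain R).out 5 3).mp
    (by exact_mod_cast h)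
  exact h2.1

/-! ### Dimension, normality and function fields of schemes -/

namespace AlgebraicCurve

theorem krullDim_eq_topologicalKrullDim (X : Scheme.{0}) : Order.krullDim X = topologicalKrullDim X :=
  Order.krullDim_eq_of_orderIso (irreducibleSetEquivPoints (α := X)).symm

theorem ringKrullDim_stalk_le (X : Scheme.{0}) (x : X) :
    ringKrullDim (X.presheaf.stalk x) ≤ topologicalKrullDim X := by
  rw [ringKrullDim_stalk_eq_coheight, ← krullDim_eq_topologicalKrullDim]
  exact Order.coheight_le_krullDim x

theorem topologicalKrullDim_le_zero {X : Scheme.{0}} (h : ∀ x : X, IsField (X.presheaf.stalk x)) :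
    topologicalKrullDim X ≤ 0 := by
  rw [← krullDim_eq_topologicalKrullDim, Order.krullDim_eq_iSup_coheight]
  refine iSup_le fun x => ?_
  rw [← ringKrullDim_stalk_eq_coheight]
  let := (h x).toField
  exact (ringKrullDim_eq_zero_of_field (X.presheaf.stalk x)).le

theorem ringKrullDim_section_le {X : Scheme.{0}} {U : X.Opens} (hU : IsAffineOpen U) :
    ringKrullDim Γ(X, U) ≤ topologicalKrullDim X := by
  rw [← PrimeSpectrum.topologicalKrullDim_eq_ringKrullDim]
  exact hU.fromSpec.isOpenEmbedding.isInducing.topologicalKrullDim_le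

theorem isIntegrallyClosed_section {X : Scheme.{0}} [IsIntegral X] {U : X.Opens} [Nonempty U]
    (hU : IsAffineOpen U) (h : ∀ x : X, IsIntegrallyClosed (X.presheaf.stalk x)) :
    IsIntegrallyClosed Γ(X, U) := by
  let (x : PrimeSpectrum Γ(X, U)) : Algebra Γ(X, U) (X.presheaf.stalk (hU.fromSpec x)) :=
    TopCat.Presheaf.algebra_section_stalk X.presheaf ⟨_, (hU.isoSpec.inv _).2⟩
  have (P : Ideal Γ(X, U)) [hP : P.IsMaximal] : IsLocalization.AtPrime
      (X.presheaf.stalk (hU.fromSpec ⟨P, hP.isPrime⟩)) P :=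
      hU.isLocalization_stalk' ⟨P, hP.isPrime⟩ (hU.isoSpec.inv _).2
  refine IsIntegrallyClosed.of_localization_maximal fun P _ hP => ?_
  have := this P
  have := h (hU.fromSpec ⟨P, hP.isPrime⟩)
  exact .of_equiv (IsLocalization.algEquiv P.primeCompl
    (X.presheaf.stalk (hU.fromSpec ⟨P, hP.isPrime⟩)) (Localization.AtPrime P)).toRingEquiv

variable {k : Type} [Field k] {X : Scheme.{0}} {f : X ⟶ Spec (.of k)}

theorem IsCurve.isFunctionField (hf : IsCurve f) :
    haveI := hf.isIntegral
    letI : Algebra k X.functionField := (constantsHom f).toAlgebra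
    FunctionField1.IsFunctionField k X.functionField := by
  have := hf.isIntegral
  have := hf.locallyOfFiniteType
  let : Algebra k X.functionField := (constantsHom f).toAlgebra
  have halg : ¬ Algebra.IsAlgebraic k X.functionField := by
    -- If the function field were algebraic over k, every stalk would be a domain integral over k,
    -- hence a field, and the dimension would be 0.
    intro halg
    have h0 : topologicalKrullDim X ≤ 0 := topologicalKrullDim_le_zero fun x => by
      let ψ : k →+* X.presheaf.stalk x :=
        ((Scheme.ΓSpecIso (.of k)).inv ≫ f.appTop ≫ X.presheaf.germ ⊤ x trivial).hom
      let : Algebra k (X.presheaf.stalk x) := ψ.toAlgebra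
      have : IsScalarTower k (X.presheaf.stalk x) X.functionField := by
        refine .of_algebraMap_eq' ?_
        refine congrArg CommRingCat.Hom.hom (?_ : _ = ((Scheme.ΓSpecIso (.of k)).inv ≫ f.appTop ≫
          X.presheaf.germ ⊤ x trivial) ≫ X.presheaf.stalkSpecializes
            ((genericPoint_spec X).specializes trivial))
        exact congrArg (fun t => (Scheme.ΓSpecIso (.of k)).inv ≫ f.appTop ≫ t)
          (X.presheaf.germ_stalkSpecializes (U := ⊤) (y := x) trivial
            ((genericPoint_spec X).specializes trivial)).symm
      have : Algebra.IsIntegral k (X.presheaf.stalk x) := by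
        refine ⟨fun a => ?_⟩
        rw [← isIntegral_algebraMap_iff (IsFractionRing.injective (X.presheaf.stalk x) X.functionField)]
        exact (halg.isAlgebraic _).isIntegral
      exact isField_of_isIntegral_of_isField' (Field.toIsField k)
    rw [hf.dim_eq_one] at h0
    exact absurd h0 (by decide)
  obtain ⟨U, hU, hηU, -⟩ := exists_isAffineOpen_mem_and_subset (X := X) (x := genericPoint X)
    (U := ⊤) trivial
  have : Nonempty U := ⟨⟨_, hηU⟩⟩
  let ψ : k →+* Γ(X, U) := ((Scheme.ΓSpecIso (.of k)).inv ≫ f.appLE ⊤ U le_top).hom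
  let : Algebra k Γ(X, U) := ψ.toAlgebra
  have : IsScalarTower k Γ(X, U) X.functionField := by
    refine .of_algebraMap_eq' ?_
    refine congrArg CommRingCat.Hom.hom (?_ : _ = ((Scheme.ΓSpecIso (.of k)).inv ≫
      f.appLE ⊤ U le_top) ≫ X.presheaf.germ U (genericPoint X) hηU)
    exact congrArg (fun t => (Scheme.ΓSpecIso (.of k)).inv ≫ f.appTop ≫ t)
      (X.presheaf.germ_res (U := U) (homOfLE le_top) _ hηU).symm
  have : Algebra.FiniteType k Γ(X, U) := by
    have h1 := f.finiteType_appLE (isAffineOpen_top _) hU le_top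
    exact h1.comp (RingHom.FiniteType.of_surjective _
      (Scheme.ΓSpecIso (.of k)).symm.commRingCatIsoToRingEquiv.surjective)
  have := functionField_isFractionRing_of_isAffineOpen X U hU
  exact FunctionField1.isFunctionField_of_ringKrullDim_le_one (R := Γ(X, U))
    ((ringKrullDim_section_le hU).trans hf.dim_eq_one.le) halg

end AlgebraicCurve

/-! ### The projective scheme of a homogeneous ideal -/

namespace ProjectiveModel

open MvPolynomial HomogeneousLocalization

variable {A σ : Type} [CommRing A] (I : HomogeneousIdeal (homogeneousSubmodule σ A))

/-- The structure morphism of the projective scheme cut out by `I`. -/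
noncomputable def structMor : Proj (quotGrading I) ⟶ Spec (.of A) :=
  Proj.toSpecZero (quotGrading I) ≫
    Spec.map (CommRingCat.ofHom (algebraMap A (quotGrading I 0)))

theorem awayι_structMor (j : σ) :
    Proj.awayι (quotGrading I) (coord I j) (coord_mem I j) one_pos ≫ structMor I =
      Spec.map (CommRingCat.ofHom (awayConst I j)) := by
  rw [structMor, Proj.awayι_toSpecZero_assoc, ← Spec.map_comp]
  rfl

theorem iSup_basicOpen_coord : ⨆ j, Proj.basicOpen (quotGrading I) (coord I j) = ⊤ := by
  refine Proj.iSup_basicOpen_eq_top' _ _ (fun j => ⟨1, coord_mem I j⟩) (eq_top_iff.mpr ?_)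
  rintro x -
  obtain ⟨g, rfl⟩ := Ideal.Quotient.mk_surjective x
  induction g using MvPolynomial.induction_on with
  | C a =>
    exact (Algebra.adjoin _ _).algebraMap_mem
      (⟨Ideal.Quotient.mk _ (C a), mk_mem_quotGrading (isHomogeneous_C σ a)⟩ : quotGrading I 0)
  | add p q hp hq => rw [map_add]; exact add_mem hp hq
  | mul_X p i hp => rw [map_mul]; exact mul_mem hp (Algebra.subset_adjoin ⟨i, rfl⟩)

theorem ι_structMor (j : σ) : (Proj.basicOpen (quotGrading I) (coord I j)).ι ≫ structMor I =
    (Proj.basicOpenIsoSpec _ _ (coord_mem I j) one_pos).hom ≫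
      Spec.map (CommRingCat.ofHom (awayConst I j)) := by
  rw [← awayι_structMor, ← Proj.basicOpenIsoSpec_inv_ι, Category.assoc, Iso.hom_inv_id_assoc]

theorem smooth_structMor (h : ∀ j, Algebra.Smooth A (ChartRing I.toIdeal j)) :
    Smooth (structMor I) := by
  have : IsZariskiLocalAtSource @Smooth.{0} :=
    HasRingHomProperty.instIsZariskiLocalAtSource (Q := RingHom.Smooth)
  rw [IsZariskiLocalAtSource.iff_of_iSup_eq_top (P := @Smooth.{0}) _ (iSup_basicOpen_coord I)]
  intro j
  rw [ι_structMor]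
  refine IsZariskiLocalAtSource.comp (P := @Smooth.{0}) ?_ _
  rw [HasRingHomProperty.Spec_iff (P := @Smooth.{0}), CommRingCat.hom_ofHom, ← chartRingEquivAway_comp_algebraMap]
  exact RingHom.Smooth.respectsIso.1 (algebraMap A (ChartRing I.toIdeal j)) (chartRingEquivAway I j)
    (RingHom.smooth_algebraMap.mpr (h j))

/-- The section of `Proj` over a standard chart defined by a polynomial in the affine
coordinates, as a germ. -/
noncomputable def chartGerm (j : σ) (x : Proj (quotGrading I))
    (hx : x ∈ Proj.basicOpen (quotGrading I) (coord I j)) :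
    Away (quotGrading I) (coord I j) →+* (Proj (quotGrading I)).presheaf.stalk x :=
  (Proj.awayToSection (quotGrading I) (coord I j) ≫ (Proj (quotGrading I)).presheaf.germ _ x hx).hom

theorem chartGerm_comp_awayConst (j : σ) (x : Proj (quotGrading I))
    (hx : x ∈ Proj.basicOpen (quotGrading I) (coord I j)) :
    (chartGerm I j x hx).comp (awayConst I j) =
      ((Scheme.ΓSpecIso (.of A)).inv ≫ (structMor I).appTop ≫
        (Proj (quotGrading I)).presheaf.germ ⊤ x trivial).hom := by
  let U := Proj.basicOpen (quotGrading I) (coord I j)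
  have h1 : (Scheme.ΓSpecIso (.of A)).inv ≫ (U.ι ≫ structMor I).appTop =
      CommRingCat.ofHom (awayConst I j) ≫ Proj.awayToSection (quotGrading I) (coord I j) ≫
        U.topIso.inv := by
    rw [ι_structMor, Proj.basicOpenIsoSpec_hom, Scheme.Hom.comp_appTop,
      ← Scheme.ΓSpecIso_inv_naturality_assoc]
    congr 1
    rw [Iso.inv_comp_eq]
    exact Proj.basicOpenToSpec_app_top _ _
  have h2 : (Scheme.ΓSpecIso (.of A)).inv ≫ (structMor I).appTop ≫
      (Proj (quotGrading I)).presheaf.map (homOfLE le_top : U ⟶ ⊤).op =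
      CommRingCat.ofHom (awayConst I j) ≫ Proj.awayToSection (quotGrading I) (coord I j) := by
    rw [← cancel_mono U.topIso.inv, Category.assoc, Category.assoc, Category.assoc, ← h1,
      Scheme.Hom.comp_appTop]
    congr 2
  refine congrArg CommRingCat.Hom.hom (?_ : CommRingCat.ofHom (awayConst I j) ≫ (_ ≫ _) = _)
  rw [← Category.assoc, ← h2, Category.assoc, Category.assoc]
  exact congrArg (fun t => (Scheme.ΓSpecIso (.of A)).inv ≫ (structMor I).appTop ≫ t)
      ((Proj (quotGrading I)).presheaf.germ_res (U := U) (homOfLE le_top) _ hx)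

/-- The identity x_l / x_i = (x_l / x_j)(x_j / x_i), checked in the stalk of Proj, where both charts
are visible. -/
theorem chartGerm_mul (i j : σ) (x : Proj (quotGrading I))
    (hi : x ∈ Proj.basicOpen (quotGrading I) (coord I i))
    (hj : x ∈ Proj.basicOpen (quotGrading I) (coord I j)) (l : σ) :
    chartGerm I i x hi (awayHom I i (X l)) =
      chartGerm I j x hj (awayHom I j (X l)) * chartGerm I i x hi (awayHom I i (X j)) := by
  have key (m : σ) (hm : x ∈ Proj.basicOpen (quotGrading I) (coord I m)) (a) :
      chartGerm I m x hm a = (Proj.stalkIso (quotGrading I) x).inv.hom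
        (HomogeneousLocalization.mapId _ (Submonoid.powers_le.mpr hm) a) :=
    congrArg (fun f => f.hom a) (ProjectiveSpectrum.Proj.awayToSection_germ (quotGrading I) (coord I m) x hm)
  rw [key i hi, key j hj, key i hi, ← map_mul]
  congr 1
  rw [awayHom_of_isHomogeneous I i (isHomogeneous_X A l),
    awayHom_of_isHomogeneous I i (isHomogeneous_X A j),
    awayHom_of_isHomogeneous I j (isHomogeneous_X A l)]
  refine val_injective _ ?_
  rw [val_mul]
  change Localization.mk _ _ = Localization.mk _ _ * Localization.mk _ _
  rw [Localization.mk_mul, Localization.mk_eq_mk_iff]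
  refine Localization.r_of_eq ?_
  change (coord I j ^ 1 * coord I i ^ 1) * coord I l = coord I i ^ 1 * (coord I l * coord I j)
  ring

theorem subsingleton_away_of_basicOpen_eq_bot (j : σ)
    (h : Proj.basicOpen (quotGrading I) (coord I j) = ⊥) :
    Subsingleton (Away (quotGrading I) (coord I j)) := by
  have e := (Proj.basicOpenIsoAway (quotGrading I) (coord I j) (coord_mem I j) one_pos).commRingCatIsoToRingEquiv
  have : Subsingleton Γ(Proj (quotGrading I), Proj.basicOpen (quotGrading I) (coord I j)) := by
    rw [h]
    infer_instance
  exact e.toEquiv.subsingleton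

end ProjectiveModel

/-! ### The generic point in homogeneous coordinates -/

namespace FunctionField1

open MvPolynomial ProjectiveModel

variable {k F σ : Type*} [Field k] [Field F] [Algebra k F]

theorem IsGenericPoint.isFractionRing_chart {I : Ideal (MvPolynomial σ k)} {y : σ → F}
    (h : IsGenericPoint I y) {j : σ} (hj : y j ≠ 0) : IsFractionRing (chart k y j) F := by
  refine .of_field _ _ fun f => ?_
  obtain ⟨m, a, ha, b, hb, hb0, hfb⟩ := h.exists_fraction f
  have key (c : F) (hc : c ∈ formValues k y m) : c / y j ^ m ∈ chart k y j := by
    obtain ⟨g, hg, rfl⟩ := mem_formValues.mp hc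
    rw [← aeval_div y j hg, chart, Algebra.adjoin_range_eq_range_aeval]
    exact ⟨g, rfl⟩
  refine ⟨⟨_, key a ha⟩, ⟨_, key b hb⟩, ?_⟩
  change f = a / y j ^ m / (b / y j ^ m)
  rw [div_div_div_cancel_right₀ (pow_ne_zero m hj), ← hfb, mul_div_cancel_right₀ _ hb0]

theorem IsGenericPoint.chartsIntegrallyClosed {I : Ideal (MvPolynomial σ k)} {y : σ → F}
    (h : IsGenericPoint I y) (hI : I.IsHomogeneous (homogeneousSubmodule σ k))
    (hc : ∀ j, y j ≠ 0 → IsIntegrallyClosed (ChartRing I j)) : ChartsIntegrallyClosed k y := by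
  intro j hj f hf
  have := h.isFractionRing_chart hj
  have := hc j hj
  have : IsIntegrallyClosed (chart k y j) := .of_equiv (h.chartEquiv hI hj).toRingEquiv
  obtain ⟨z, rfl⟩ := IsIntegrallyClosed.isIntegral_iff.mp hf
  exact z.2

theorem IsGenericPoint.smooth_chartRing [IsFunctionField k F] [PerfectField k] [Finite σ]
    {I : Ideal (MvPolynomial σ k)} {y : σ → F}
    (h : IsGenericPoint I y) (hI : I.IsHomogeneous (homogeneousSubmodule σ k))
    (hc : ChartsIntegrallyClosed k y) (j : σ) : Algebra.Smooth k (ChartRing I j) := by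
  by_cases hj : y j = 0
  · have : Subsingleton (ChartRing I j) := Ideal.Quotient.subsingleton_iff.mpr (h.chartIdeal_eq_top hj)
    infer_instance
  · have := hc.smooth hj
    exact .of_equiv (h.chartEquiv hI hj).symm

variable (I : HomogeneousIdeal (homogeneousSubmodule σ k))

theorem mem_chartIdeal_iff {j : σ} {d : ℕ} {g : MvPolynomial σ k} (hg : g.IsHomogeneous d) :
    g ∈ chartIdeal I.toIdeal j ↔ ∃ N : ℕ, X j ^ N * g ∈ I.toIdeal := by
  rw [← ker_awayHom, RingHom.mem_ker]
  refine ⟨exists_X_pow_mul_mem_of_awayHom_eq_zero I j hg, fun ⟨N, hN⟩ => ?_⟩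
  have h1 : X j ^ N * g ∈ RingHom.ker (awayHom I j) := by
    rw [ker_awayHom]
    exact Ideal.mem_sup_left hN
  rwa [RingHom.mem_ker, map_mul, map_pow, awayHom_X_self, one_pow, one_mul] at h1

/-- A generic point is glued from compatible generic points of the nonempty charts. -/
theorem isGenericPoint_of_charts (S : Set σ) (φ : ∀ j, j ∈ S → ChartRing I.toIdeal j →ₐ[k] F)
    (hφ : ∀ j hj, Function.Injective (φ j hj))
    (hS : ∀ j, j ∉ S → chartIdeal I.toIdeal j = ⊤)
    (hglue : ∀ i hi j hj l, φ i hi (Ideal.Quotient.mk _ (X l)) =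
      φ j hj (Ideal.Quotient.mk _ (X l)) * φ i hi (Ideal.Quotient.mk _ (X j)))
    (i₀ : σ) (hi₀ : i₀ ∈ S) (hfrac : ∀ f : F, ∃ a b, b ≠ 0 ∧ f * φ i₀ hi₀ b = φ i₀ hi₀ a) :
    IsGenericPoint I.toIdeal fun l => φ i₀ hi₀ (Ideal.Quotient.mk _ (X l)) := by
  have hX (j : σ) : (Ideal.Quotient.mk (chartIdeal I.toIdeal j)) (X j) = 1 := by
    rw [← map_one (Ideal.Quotient.mk (chartIdeal I.toIdeal j)), Ideal.Quotient.eq]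
    exact Ideal.mem_sup_right (Ideal.subset_span rfl)
  set y : σ → F := fun l => φ i₀ hi₀ (Ideal.Quotient.mk _ (X l)) with hy
  have hev (j) (hj : j ∈ S) (g : MvPolynomial σ k) : φ j hj (Ideal.Quotient.mk _ g) =
      aeval (fun l => φ j hj (Ideal.Quotient.mk _ (X l))) g := by
    have : (φ j hj).comp (Ideal.Quotient.mkₐ k (chartIdeal I.toIdeal j)) =
      aeval (fun l => φ j hj (Ideal.Quotient.mk _ (X l))) := by
        ext l
        simp
    exact DFunLike.congr_fun this g
  have hone : y i₀ = 1 := by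
    simp only [hy]
    rw [hX, map_one]
  have hne (j) (hj : j ∈ S) : y j ≠ 0 := by
    intro h0
    have := hglue i₀ hi₀ j hj i₀
    change y i₀ = _ * y j at this
    rw [h0, hone, mul_zero] at this
    exact one_ne_zero this
  have hdiv (j) (hj : j ∈ S) (l) : φ j hj (Ideal.Quotient.mk _ (X l)) = y l / y j := by
    rw [eq_div_iff (hne j hj)]
    exact (hglue i₀ hi₀ j hj l).symm
  -- Vanishing at y is tested on any single nonempty chart, since every such chart embeds in F; this
  -- is what yields membership in the saturation for all j at once.
  have hmem (j) (hj : j ∈ S) {d : ℕ} {g : MvPolynomial σ k} (hg : g.IsHomogeneous d) :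
      aeval y g = 0 ↔ ∃ N, X j ^ N * g ∈ I.toIdeal := by
    rw [← mem_chartIdeal_iff I hg, ← Ideal.Quotient.eq_zero_iff_mem,
      ← map_eq_zero_iff _ (hφ j hj), hev j hj]
    simp_rw [hdiv j hj]
    rw [aeval_div y j hg, div_eq_zero_iff]
    simp [pow_ne_zero d (hne j hj)]
  refine ⟨⟨i₀, hone⟩, fun f => ?_, fun d g hg => ⟨fun h0 j => ?_, fun h => (hmem i₀ hi₀ hg).mpr (h i₀)⟩⟩
  · obtain ⟨a, b, hb, hab⟩ := hfrac f
    obtain ⟨p, rfl⟩ := Ideal.Quotient.mk_surjective a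
    obtain ⟨q, rfl⟩ := Ideal.Quotient.mk_surjective b
    obtain ⟨d, p', hp', hpp⟩ := exists_homogenization i₀ p
    obtain ⟨e, q', hq', hqq⟩ := exists_homogenization i₀ q
    have hp : Ideal.Quotient.mk (chartIdeal I.toIdeal i₀) p = Ideal.Quotient.mk _ p' :=
      Ideal.Quotient.eq.mpr (Ideal.mem_sup_right hpp)
    have hq : Ideal.Quotient.mk (chartIdeal I.toIdeal i₀) q = Ideal.Quotient.mk _ q' :=
      Ideal.Quotient.eq.mpr (Ideal.mem_sup_right hqq)
    have hb' : φ i₀ hi₀ (Ideal.Quotient.mk _ q) ≠ 0 := (map_ne_zero_iff _ (hφ i₀ hi₀)).mpr hb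
    rw [hp, hq, hev, hev] at hab
    rw [hq, hev] at hb'
    -- Multiplying by powers of X i₀, whose value is 1, brings numerator and denominator to the
    -- common degree d + e.
    refine ⟨d + e, aeval y p', ?_, aeval y q', ?_, hb', hab⟩
    · refine mem_formValues.mpr ⟨p' * X i₀ ^ e, hp'.mul (isHomogeneous_X_pow i₀ e), ?_⟩
      rw [map_mul, map_pow, aeval_X, hone, one_pow, mul_one]
    · refine mem_formValues.mpr ⟨X i₀ ^ d * q', (isHomogeneous_X_pow i₀ d).mul hq', ?_⟩
      rw [map_mul, map_pow, aeval_X, hone, one_pow, one_mul]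
  · by_cases hj : j ∈ S
    · exact (hmem j hj hg).mp h0
    · rw [← mem_chartIdeal_iff I hg, hS j hj]
      trivial

end FunctionField1

/-! ### The generic point of an integral projective scheme -/

namespace ProjectiveModel

open MvPolynomial HomogeneousLocalization FunctionField1

variable {k σ : Type} [Field k] (I : HomogeneousIdeal (homogeneousSubmodule σ k))

theorem basicOpen_coord_eq_bot_iff [IsIntegral (Proj (quotGrading I))] (j : σ) :
    Proj.basicOpen (quotGrading I) (coord I j) = ⊥ ↔
      genericPoint (Proj (quotGrading I)) ∉ Proj.basicOpen (quotGrading I) (coord I j) := by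
  refine ⟨fun h => by rw [h]; exact id, fun h => ?_⟩
  by_contra hne
  refine h (((genericPoint_spec (Proj (quotGrading I))).mem_open_set_iff
    (Proj.basicOpen (quotGrading I) (coord I j)).isOpen).mpr ?_)
  rw [Set.univ_inter]
  exact (TopologicalSpace.Opens.ne_bot_iff_nonempty _).mp hne

theorem chartGerm_injective [IsIntegral (Proj (quotGrading I))] (j : σ) (x : Proj (quotGrading I))
    (hx : x ∈ Proj.basicOpen (quotGrading I) (coord I j)) :
    Function.Injective (chartGerm I j x hx) := by
  refine (germ_injective_of_isIntegral _ x hx).comp ?_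
  have h := Proj.basicOpenIsoAway_hom (quotGrading I) (coord I j) (coord_mem I j) one_pos
  rw [← h]
  exact (Proj.basicOpenIsoAway (quotGrading I) (coord I j) (coord_mem I j)
    one_pos).commRingCatIsoToRingEquiv.injective

theorem chartIdeal_eq_top_of_basicOpen_eq_bot (j : σ)
    (h : Proj.basicOpen (quotGrading I) (coord I j) = ⊥) : chartIdeal I.toIdeal j = ⊤ := by
  have := subsingleton_away_of_basicOpen_eq_bot I j h
  exact Ideal.Quotient.subsingleton_iff.mp (chartRingEquivAway I j).toEquiv.subsingleton

theorem isIntegrallyClosed_chartRing [IsIntegral (Proj (quotGrading I))]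
    (h : ∀ x : Proj (quotGrading I), IsIntegrallyClosed ((Proj (quotGrading I)).presheaf.stalk x))
    (j : σ) (hj : chartIdeal I.toIdeal j ≠ ⊤) : IsIntegrallyClosed (ChartRing I.toIdeal j) := by
  have hne : Nonempty (Proj.basicOpen (quotGrading I) (coord I j)) := by
    refine Set.Nonempty.to_subtype ((TopologicalSpace.Opens.ne_bot_iff_nonempty _).mp fun h0 => ?_)
    exact hj (chartIdeal_eq_top_of_basicOpen_eq_bot I j h0)
  have := AlgebraicCurve.isIntegrallyClosed_section
    (Proj.isAffineOpen_basicOpen (quotGrading I) (coord I j) (coord_mem I j) one_pos) h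
  exact .of_equiv ((chartRingEquivAway I j).trans (Proj.basicOpenIsoAway (quotGrading I) (coord I j)
    (coord_mem I j) one_pos).commRingCatIsoToRingEquiv).symm

variable {F : Type} [Field F] [Algebra k F]

/-- The coordinates of the generic point of an integral projective scheme. -/
theorem exists_isGenericPoint [IsIntegral (Proj (quotGrading I))]
    (e : (Proj (quotGrading I)).functionField ≃+* F)
    (he : ∀ c, e (AlgebraicCurve.constantsHom (structMor I) c) = algebraMap k F c) :
    ∃ y : σ → F, IsGenericPoint I.toIdeal y := by
  let η := genericPoint (Proj (quotGrading I))
  let S : Set σ := {j | η ∈ Proj.basicOpen (quotGrading I) (coord I j)}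
  have hη : η ∈ ⨆ j, Proj.basicOpen (quotGrading I) (coord I j) := by
    rw [iSup_basicOpen_coord]
    trivial
  obtain ⟨i₀, hi₀⟩ := TopologicalSpace.Opens.mem_iSup.mp hη
  let φ (j : σ) (hj : j ∈ S) : ChartRing I.toIdeal j →ₐ[k] F :=
    { toRingHom := (e : _ →+* F).comp ((chartGerm I j η hj).comp
        (chartRingEquivAway I j : ChartRing I.toIdeal j →+* _))
      commutes' c := by
        have h1 := DFunLike.congr_fun (chartRingEquivAway_comp_algebraMap I j) c
        have h2 := DFunLike.congr_fun (chartGerm_comp_awayConst I j η hj) c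
        rw [← he c]
        refine congrArg e (Eq.trans ?_ h2)
        exact congrArg (chartGerm I j η hj) h1 }
  have hφ (j : σ) (hj : j ∈ S) (g : MvPolynomial σ k) :
      φ j hj (Ideal.Quotient.mk _ g) = e (chartGerm I j η hj (awayHom I j g)) := rfl
  refine ⟨_, isGenericPoint_of_charts I S φ (fun j hj => e.injective.comp
    ((chartGerm_injective I j η hj).comp (chartRingEquivAway I j).injective)) (fun j hj =>
    chartIdeal_eq_top_of_basicOpen_eq_bot I j ((basicOpen_coord_eq_bot_iff I j).mpr hj))
    (fun i hi j hj l => ?_) i₀ hi₀ fun f => ?_⟩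
  · rw [hφ, hφ, hφ, ← map_mul, chartGerm_mul I i j η hi hj l]
  · have : Nonempty (Proj.basicOpen (quotGrading I) (coord I i₀)) := ⟨⟨η, hi₀⟩⟩
    have := functionField_isFractionRing_of_isAffineOpen (Proj (quotGrading I))
      (Proj.basicOpen (quotGrading I) (coord I i₀))
      (Proj.isAffineOpen_basicOpen (quotGrading I) (coord I i₀) (coord_mem I i₀) one_pos)
    let θ := (chartRingEquivAway I i₀).trans (Proj.basicOpenIsoAway (quotGrading I) (coord I i₀)
      (coord_mem I i₀) one_pos).commRingCatIsoToRingEquiv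
    obtain ⟨a, b, hb, hab⟩ := IsFractionRing.div_surjective
      (A := Γ(Proj (quotGrading I), Proj.basicOpen (quotGrading I) (coord I i₀))) (e.symm f)
    have hθ (z) : φ i₀ hi₀ (θ.symm z) = e (algebraMap _ _ z) := by
      obtain ⟨w, rfl⟩ := θ.surjective z
      rw [θ.symm_apply_apply]
      rfl
    have hb0 : (algebraMap _ (Proj (quotGrading I)).functionField b) ≠ 0 :=
      IsFractionRing.to_map_ne_zero_of_mem_nonZeroDivisors hb
    refine ⟨θ.symm a, θ.symm b, ?_, ?_⟩
    · rw [ne_eq, EmbeddingLike.map_eq_zero_iff]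
      exact nonZeroDivisors.ne_zero hb
    · rw [hθ, hθ, ← e.apply_symm_apply f, ← map_mul, ← hab, div_mul_cancel₀ _ hb0]

end ProjectiveModel

/-! ### Function fields of birational schemes -/

namespace AlgebraicCurve

variable {k : Type} [Field k]

theorem exists_functionField_equiv_of_isOpenImmersion {U X : Scheme.{0}} [IrreducibleSpace U]
    [IrreducibleSpace X] (g : U ⟶ X) [IsOpenImmersion g] (f : X ⟶ Spec (.of k)) :
    ∃ e : X.functionField ≃+* U.functionField,
      ∀ c, e (constantsHom f c) = constantsHom (g ≫ f) c := by
  -- Stating this for a variable point x lets the equality of generic points be substituted instead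
  -- of transporting stalks along it.
  have key : ∀ x : X, g (genericPoint U) = x →
      ∃ e : X.presheaf.stalk x ≃+* U.functionField, ∀ c,
        e (((Scheme.ΓSpecIso (.of k)).inv ≫ f.appTop ≫ X.presheaf.germ ⊤ x trivial).hom c) =
          constantsHom (g ≫ f) c := by
    rintro _ rfl
    refine ⟨(asIso (g.stalkMap (genericPoint U))).commRingCatIsoToRingEquiv, fun c => ?_⟩
    have h1 : ((Scheme.ΓSpecIso (.of k)).inv ≫ f.appTop ≫
        X.presheaf.germ ⊤ (g (genericPoint U)) trivial) ≫ g.stalkMap (genericPoint U) =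
        (Scheme.ΓSpecIso (.of k)).inv ≫ (g ≫ f).appTop ≫
          U.presheaf.germ ⊤ (genericPoint U) trivial := by
      simp only [Category.assoc, Scheme.Hom.comp_appTop]
      exact congrArg (fun t => (Scheme.ΓSpecIso (.of k)).inv ≫ f.appTop ≫ t)
        (Scheme.Hom.germ_stalkMap g ⊤ (genericPoint U) trivial)
    exact congrArg (fun t => t.hom c) h1
  exact key _ (genericPoint_eq_of_isOpenImmersion g)

theorem exists_functionField_equiv_of_birationalOver {X Y : Scheme.{0}} [IsIntegral X]
    [IsIntegral Y] {sX : X ⟶ Spec (.of k)} {sY : Y ⟶ Spec (.of k)}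
    (h : Scheme.BirationalOver sX sY) :
    ∃ e : X.functionField ≃+* Y.functionField, ∀ c, e (constantsHom sX c) = constantsHom sY c := by
  obtain ⟨f, hf⟩ := h
  have : Nonempty f.source := f.dense_source.nonempty.to_subtype
  obtain ⟨e₁, he₁⟩ := exists_functionField_equiv_of_isOpenImmersion f.source.ι sX
  obtain ⟨e₂, he₂⟩ := exists_functionField_equiv_of_isOpenImmersion (f.iso.hom ≫ f.target.ι) sY
  refine ⟨e₁.trans e₂.symm, fun c => ?_⟩
  rw [RingEquiv.trans_apply, RingEquiv.symm_apply_eq, he₁, he₂]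
  have : (f.iso.hom ≫ f.target.ι) ≫ sY = f.source.ι ≫ sX := by
    rw [Category.assoc]
    exact hf
  rw [this]

end AlgebraicCurve

/-! ### The local ring `ℤ_(p)` -/

namespace ProjectiveModel

open MvPolynomial

theorem toIdeal_idealOver {n : ℕ} (J : Equations n) (A : Type) [CommRing A] :
    (idealOver J A).toIdeal = J.toIdeal.map (map (Int.castRingHom A)) := rfl

theorem map_idealOver {n : ℕ} (J : Equations n) (A B : Type) [CommRing A] [CommRing B] [Algebra A B] :
    (idealOver J A).toIdeal.map (map (algebraMap A B)) = (idealOver J B).toIdeal := by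
  rw [toIdeal_idealOver, toIdeal_idealOver, Ideal.map_map]
  congr 1
  ext <;> simp

variable (p : ℕ) [Fact p.Prime]

instance isDiscreteValuationRing_zAt : IsDiscreteValuationRing (ZAt p) := by
  have := isPrime_span p
  exact IsLocalization.AtPrime.isDiscreteValuationRing_of_dedekind_domain ℤ
    (P := Ideal.span {(p : ℤ)})
    (by simpa using (Fact.out : p.Prime).ne_zero) (ZAt p)

theorem irreducible_natCast_zAt : Irreducible (p : ZAt p) := by
  have := isPrime_span p
  rw [IsDiscreteValuationRing.irreducible_iff_uniformizer, ← Localization.AtPrime.map_eq_maximalIdeal,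
    Ideal.map_span]
  simp

/-- The embedding `ℤ_(p) → ℚ`. -/
noncomputable def zAtToRat : ZAt p →+* ℚ :=
  haveI := isPrime_span p
  IsLocalization.lift (M := (Ideal.span {(p : ℤ)}).primeCompl) (g := Int.castRingHom ℚ) fun y => by
    refine (Int.cast_ne_zero.mpr ?_).isUnit
    exact fun h => y.2 ((congrArg (· ∈ Ideal.span {(p : ℤ)}) h).mpr (zero_mem _))

/-- The reduction map `ℤ_(p) → 𝔽_p`. -/
noncomputable def zAtToZMod : ZAt p →+* ZMod p :=
  haveI := isPrime_span p
  IsLocalization.lift (M := (Ideal.span {(p : ℤ)}).primeCompl) (g := Int.castRingHom (ZMod p))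
    fun y => by
      refine IsUnit.mk0 _ fun h => y.2 ?_
      exact Ideal.mem_span_singleton.mpr ((ZMod.intCast_zmod_eq_zero_iff_dvd _ _).mp h)

theorem isFractionRing_zAt : @IsFractionRing (ZAt p) _ ℚ _ (zAtToRat p).toAlgebra := by
  have := isPrime_span p
  let : Algebra (ZAt p) ℚ := (zAtToRat p).toAlgebra
  have := IsScalarTower.of_algebraMap_eq' (R := ℤ) (S := ZAt p) (A := ℚ) (RingHom.ext_int _ _)
  exact IsFractionRing.isFractionRing_of_isDomain_of_isLocalization
    (Ideal.span {(p : ℤ)}).primeCompl (ZAt p) ℚ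

theorem zAtToZMod_surjective : Function.Surjective (zAtToZMod p) := by
  intro x
  obtain ⟨m, rfl⟩ := ZMod.intCast_surjective x
  exact ⟨m, map_intCast _ m⟩

theorem zAtToZMod_eq_zero_iff (a : ZAt p) : zAtToZMod p a = 0 ↔ (p : ZAt p) ∣ a := by
  have h1 := RingHom.ker_isMaximal_of_surjective _ (zAtToZMod_surjective p)
  rw [← RingHom.mem_ker, IsLocalRing.eq_maximalIdeal h1,
    (IsDiscreteValuationRing.irreducible_iff_uniformizer _).mp (irreducible_natCast_zAt p),
    Ideal.mem_span_singleton]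

end ProjectiveModel

theorem mainTheorem5 {n : ℕ} (J : ProjectiveModel.Equations n) (p : ℕ) [Fact p.Prime]
    -- `Y` is a geometrically irreducible curve over `ℚ`
    {Y : Scheme.{0}} (sY : Y ⟶ Spec (.of ℚ))
    (hY : AlgebraicCurve.IsCurve sY) (hYgeom : GeometricallyIrreducible sY)
    -- `X = V(J)_ℚ` is a nonsingular projective curve that is birational to `Y` over `ℚ`
    (hX : AlgebraicCurve.IsCurve (ProjectiveModel.toSpec J ℚ))
    (hXns : ∀ x : ProjectiveModel.scheme J ℚ, AlgebraicCurve.IsNonsingularAt _ x)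
    (hXY : Scheme.BirationalOver (ProjectiveModel.toSpec J ℚ) sY)
    -- the reduction `V(J)_{𝔽_p}` is an integral curve
    (hred : AlgebraicCurve.IsCurve (ProjectiveModel.toSpec J (ZMod p)))
    -- it has a nonsingular `𝔽_p`-point
    (hpt : ∃ s : Spec (.of (ZMod p)) ⟶ ProjectiveModel.scheme J (ZMod p),
      s ≫ ProjectiveModel.toSpec J (ZMod p) = 𝟙 _ ∧
      ∀ z, AlgebraicCurve.IsNonsingularAt (ProjectiveModel.scheme J (ZMod p)) (s z))
    -- its geometric genus is the genus of `Y`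
    (hgenus : AlgebraicCurve.geometricGenus (ProjectiveModel.toSpec J (ZMod p)) hred =
      AlgebraicCurve.geometricGenus sY hY) :
    ProjectiveModel.HasGoodReduction J p ∧ Smooth (ProjectiveModel.toSpec J (ZMod p)) := by
  have := hY.isIntegral
  have := hX.isIntegral
  have := hred.isIntegral
  let : Algebra ℚ Y.functionField := (AlgebraicCurve.constantsHom sY).toAlgebra
  let : Algebra (ZMod p) (ProjectiveModel.scheme J (ZMod p)).functionField :=
    (AlgebraicCurve.constantsHom (ProjectiveModel.toSpec J (ZMod p))).toAlgebra
  have : FunctionField1.IsFunctionField ℚ Y.functionField := hY.isFunctionField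
  have : FunctionField1.IsFunctionField (ZMod p)
    (ProjectiveModel.scheme J (ZMod p)).functionField := hred.isFunctionField
  let : Algebra (ProjectiveModel.ZAt p) ℚ := (ProjectiveModel.zAtToRat p).toAlgebra
  let : Algebra (ProjectiveModel.ZAt p) (ZMod p) := (ProjectiveModel.zAtToZMod p).toAlgebra
  have : IsFractionRing (ProjectiveModel.ZAt p) ℚ := ProjectiveModel.isFractionRing_zAt p
  have hsurj : Function.Surjective (algebraMap (ProjectiveModel.ZAt p) (ZMod p)) :=
    ProjectiveModel.zAtToZMod_surjective p
  have hker : ∀ a, algebraMap (ProjectiveModel.ZAt p) (ZMod p) a = 0 ↔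
      (p : ProjectiveModel.ZAt p) ∣ a := ProjectiveModel.zAtToZMod_eq_zero_iff p
  have hπ := ProjectiveModel.irreducible_natCast_zAt p
  have hQ := ProjectiveModel.map_idealOver J (ProjectiveModel.ZAt p) ℚ
  have hZ := ProjectiveModel.map_idealOver J (ProjectiveModel.ZAt p) (ZMod p)
  have hIQ := (ProjectiveModel.idealOver J ℚ).isHomogeneous
  have hIZ := (ProjectiveModel.idealOver J (ZMod p)).isHomogeneous
  obtain ⟨e, he⟩ := AlgebraicCurve.exists_functionField_equiv_of_birationalOver hXY
  -- The generic point of X takes its coordinates in the function field of Y, through the birational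
  -- equivalence, so the genus of Y enters directly.
  obtain ⟨y₁, h₁⟩ := ProjectiveModel.exists_isGenericPoint (ProjectiveModel.idealOver J ℚ) e he
  obtain ⟨y₂, h₂⟩ := ProjectiveModel.exists_isGenericPoint (ProjectiveModel.idealOver J (ZMod p))
    (RingEquiv.refl _) fun _ => rfl
  have hstalk (x : ProjectiveModel.scheme J ℚ) :
      IsIntegrallyClosed ((ProjectiveModel.scheme J ℚ).presheaf.stalk x) := by
    have : IsRegularLocalRing ((ProjectiveModel.scheme J ℚ).presheaf.stalk x) := hXns x
    exact IsRegularLocalRing.isIntegrallyClosed_of_ringKrullDim_le_one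
      ((AlgebraicCurve.ringKrullDim_stalk_le _ x).trans hX.dim_eq_one.le)
  -- Nonsingularity of X is used through normality of its charts, the equality case of the Hilbert
  -- function bound.
  have hc₁ : FunctionField1.ChartsIntegrallyClosed ℚ y₁ := by
    refine h₁.chartsIntegrallyClosed hIQ fun j hj =>
      ProjectiveModel.isIntegrallyClosed_chartRing _ hstalk j fun htop => ?_
    have := (h₁.chartEquiv hIQ hj).toEquiv.nontrivial
    exact Ideal.Quotient.nontrivial_iff.mp this htop
  obtain ⟨hc₂, d₀, hd₀⟩ := FunctionField1.chartsIntegrallyClosed_reduction hπ hsurj hker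
    (ProjectiveModel.idealOver J (ProjectiveModel.ZAt p)).isHomogeneous (by rwa [hQ])
    (by rwa [hZ]) (by rwa [hQ]) (by rwa [hZ]) hc₁ hgenus
  have hs₁ := h₁.smooth_chartRing hIQ hc₁
  have hs₂ := h₂.smooth_chartRing hIZ hc₂
  refine ⟨ProjectiveModel.smooth_structMor _ fun j => ?_, ProjectiveModel.smooth_structMor _ hs₂⟩
  rw [← hQ] at hs₁
  rw [← hZ] at hs₂
  have := hs₁ j
  have := hs₂ j
  -- Torsion-freeness in degrees at least d₀ passes to each chart, giving flatness; smoothness of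
  -- the two fibres then gives smoothness over ℤ_(p).
  exact ProjectiveModel.smooth_chartRing (K := ℚ) _ j hπ hsurj hker
    (ProjectiveModel.mem_chartIdeal_of_C_mul_mem _ j hd₀)
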